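/- Let $n\in\{2,3\}$, $k\ge 2$, $\alpha,\sigma>0$, and let $\Omega\subset\mathbb R^n$ be a bounded polyhedral Lipschitz domain. Let $A\in C(\overline\Omega;\mathbb S)$ be symmetric-matrix valued with $\lambda I_n\le A\le\Lambda I_n$ in $\Omega$ for constants $0<\lambda\le\Lambda$, let $b\in L^\infty(\Omega;\mathbb R^n)$ and $0\le c\in L^\infty(\Omega)$, and set $Lv:=-A:\mathrm D^2v+b\cdot\nabla v+c\,v$. Let $(\mathcal T_j)_j$ be a quasi-uniform sequence of regular triangulations of $\Omega$ into closed simplices whose maximal mesh-size tends to $0$; quasi-uniform with parameter $\kappa>0$ means that every $T\in\mathcal T_j$ contains a ball of radius $\kappa h_T$ and satisfies $h_T\ge\kappa\max_{T'\in\mathcal T_j}h_{T'}$, where $h_T$ is the diameter of $T$. Let $V_{\mathrm{nc}}(\mathcal T_j):=P_k(\mathcal T_j)$ be the space of (discontinuous) piecewise polynomials of degree at most $k$. Let $\mathcal L_{j,b}^k$ be the set of those points on $\partial\Omega$ that have, with respect to some cell of $\mathcal T_j$ containing them, barycentric coordinates in $\{0,1/k,\dots,1\}$ (the Lagrange points).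 For $g_j\in V_{\mathrm{nc}}(\mathcal T_j)$ let $$\mathcal A_{\mathrm{nc}}(g_j,\mathcal T_j):=\{(v,t)\in V_{\mathrm{nc}}(\mathcal T_j)\times\mathbb R_{\ge0}:\ -t\le(g_j-v)|_T(z)\le t\ \text{ for all }T\in\mathcal T_j,\ z\in\mathcal L_{j,b}^k\cap T\}.$$ Given $f\in L^n(\Omega)$, let $$\Psi_{\mathrm{nc}}(v,t):=\alpha t^n+\|f-L_{\mathrm{pw}}v\|_{L^n(\Omega)}^n+\sigma\sum_{T\in\mathcal T_j}\ \sum_{F}\big(h_F^{1-2n}\|[v]_F\|_{L^n(F)}^n+h_F^{1-n}\|[\nabla_{\mathrm{pw}}v]_F\|_{L^n(F)}^n\big),$$ where $F$ runs through the interior sides of $T$, $h_F$ is the diameter of $F$, $[\cdot]_F$ is the jump across $F$, and $L_{\mathrm{pw}},\nabla_{\mathrm{pw}}$ are applied piecewise. Let $g\in C(\partial\Omega)$ and suppose that the strong solution $u\in C(\overline\Omega)$ of $Lu=f$ a.e. in $\Omega$, $u=g$ on $\partial\Omega$, satisfies $u\in W^{2,n}(\Omega)$. Suppose that $g_j=g$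 on the boundary for every $j$, i.e. $g_j|_T=g$ on $T\cap\partial\Omega$ for every $T\in\mathcal T_j$. Let $\Pi_{\mathcal T_j}^k u\in P_k(\mathcal T_j)$ denote the $L^2$ projection of $u$. Then $$\inf_{\mathcal A_{\mathrm{nc}}(g_j,\mathcal T_j)}\Psi_{\mathrm{nc}}\ \le\ C\,\|(1-\Pi_{\mathcal T_j}^k)u\|_{W^{2,n}(\mathcal T_j)}^n\qquad\text{for all }j,$$ and hence $\Psi_{\mathrm{nc}}(u_j,t_j)\le C\,\|(1-\Pi_{\mathcal T_j}^k)u\|_{W^{2,n}(\mathcal T_j)}^n$ for every minimizer $(u_j,t_j)$ of $\Psi_{\mathrm{nc}}$ in $\mathcal A_{\mathrm{nc}}(g_j,\mathcal T_j)$. Here $\|w\|_{W^{2,n}(\mathcal T_j)}^n:=\sum_{T\in\mathcal T_j}\big(\|w\|_{L^n(T)}^n+\|\nabla w\|_{L^n(T)}^n+\|\mathrm D^2w\|_{L^n(T)}^n\big)$, and the constant $C>0$ depends only on $n,k,\Omega,A,b,c,\alpha,\sigma$, and $\kappa$; in particular it is independent of the mesh-size and of $u$, $f$, $g$. -/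

import Mathlib

open MeasureTheory Set Filter Topology
open scoped ENNReal NNReal ContDiff

noncomputable section

namespace NonconformingFEM

/-- The Euclidean space `ℝⁿ`. -/
abbrev Sp (n : ℕ) := EuclideanSpace ℝ (Fin n)

/-- The space of polynomials in `n` variables of total degree at most `k`. -/
abbrev Poly (n k : ℕ) := MvPolynomial.restrictTotalDegree (Fin n) ℝ k

/-! ### Domains, weak derivatives, strong solutions -/

/-- Bounded open sets with Lipschitz boundary: near every boundary point, in suitable orthonormal
coordinates (with `e` as the last coordinate direction, the other coordinates of `y` being those of
`y - ⟪e, y⟫ e`), the set is the region strictly above the graph of a Lipschitz function. -/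
structure IsBoundedLipschitz {n : ℕ} (Ω : Set (Sp n)) : Prop where
  isOpen : IsOpen Ω
  isBounded : Bornology.IsBounded Ω
  graph : ∀ x ∈ frontier Ω, ∃ (e : Sp n) (r : ℝ) (K : ℝ≥0) (φ : Sp n → ℝ),
    ‖e‖ = 1 ∧ 0 < r ∧ LipschitzWith K φ ∧
      ∀ y ∈ Metric.ball x r, (y ∈ Ω ↔ φ (y - inner ℝ e y • e) < inner ℝ e y)

/-- `w` is the weak partial derivative `∂ᵢ v` in the open set `Ω`. -/
def HasWeakPartial {n : ℕ} (Ω : Set (Sp n)) (i : Fin n) (v w : Sp n → ℝ) : Prop :=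
  LocallyIntegrableOn v Ω ∧ LocallyIntegrableOn w Ω ∧
    ∀ φ : Sp n → ℝ, ContDiff ℝ ∞ φ → HasCompactSupport φ → tsupport φ ⊆ Ω →
      ∫ x in Ω, v x * fderiv ℝ φ x (EuclideanSpace.single i 1) = - ∫ x in Ω, w x * φ x

/-- `v ∈ W^{2,p}(Ω)` with weak gradient `G` and weak Hessian `H`. -/
structure IsW2 {n : ℕ} (Ω : Set (Sp n)) (p : ℝ≥0∞) (v : Sp n → ℝ) (G : Sp n → Sp n)
    (H : Sp n → Matrix (Fin n) (Fin n) ℝ) : Prop where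
  weakGrad : ∀ i, HasWeakPartial Ω i v (fun x => G x i)
  weakHess : ∀ i j, HasWeakPartial Ω j (fun x => G x i) (fun x => H x i j)
  memLp : MemLp v p (volume.restrict Ω)
  memLp_grad : ∀ i, MemLp (fun x => G x i) p (volume.restrict Ω)
  memLp_hess : ∀ i j, MemLp (fun x => H x i j) p (volume.restrict Ω)

/-- The assumptions on the coefficients: `A ∈ C(Ω̄; 𝕊)` with `lam I ≤ A ≤ Lam I`,
`b ∈ L^∞(Ω; ℝⁿ)`, and `0 ≤ c ∈ L^∞(Ω)`. -/
structure CoefficientAssumption {n : ℕ} (Ω : Set (Sp n)) (lam Lam : ℝ)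
    (A : Sp n → Matrix (Fin n) (Fin n) ℝ) (b : Sp n → Sp n) (c : Sp n → ℝ) : Prop where
  lam_pos : 0 < lam
  lam_le : lam ≤ Lam
  continuousOn : ContinuousOn A (closure Ω)
  symm : ∀ x ∈ Ω, (A x).IsSymm
  lower : ∀ x ∈ Ω, (A x - lam • (1 : Matrix (Fin n) (Fin n) ℝ)).PosSemidef
  upper : ∀ x ∈ Ω, (Lam • (1 : Matrix (Fin n) (Fin n) ℝ) - A x).PosSemidef
  memLp_b : MemLp b ∞ (volume.restrict Ω)
  memLp_c : MemLp c ∞ (volume.restrict Ω)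
  c_nonneg : ∀ᵐ x ∂(volume.restrict Ω), 0 ≤ c x

/-- The value at `x` of `-A : D²v + b · ∇v + c v`, where `v`, `∇v`, `D²v` take the values
`s`, `G`, `H` at `x`. -/
def diffOp {n : ℕ} (A : Sp n → Matrix (Fin n) (Fin n) ℝ) (b : Sp n → Sp n) (c : Sp n → ℝ)
    (x : Sp n) (s : ℝ) (G : Sp n) (H : Matrix (Fin n) (Fin n) ℝ) : ℝ :=
  -(∑ i, ∑ j, A x i j * H i j) + inner ℝ (b x) G + c x * s

/-- `u ∈ C(Ω̄) ∩ W^{2,n}(Ω)`, with weak gradient `G` and weak Hessian `H`, is a strong solution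
to `L u = f` a.e. in `Ω` and `u = g` on `∂Ω`. -/
structure IsStrongSolutionW2 {n : ℕ} (Ω : Set (Sp n)) (A : Sp n → Matrix (Fin n) (Fin n) ℝ)
    (b : Sp n → Sp n) (c f g : Sp n → ℝ) (u : Sp n → ℝ) (G : Sp n → Sp n)
    (H : Sp n → Matrix (Fin n) (Fin n) ℝ) : Prop where
  continuousOn : ContinuousOn u (closure Ω)
  w2 : IsW2 Ω n u G H
  pde : ∀ᵐ x ∂(volume.restrict Ω), diffOp A b c x (u x) (G x) (H x) = f x
  boundary : ∀ x ∈ frontier Ω, u x = g x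

/-! ### Triangulations -/

/-- A regular triangulation of (the closure of) `Ω` into finitely many closed `n`-simplices, each
of which is given by its `n + 1` vertices. Two simplices meet exactly in the simplex spanned by
their common vertices. The existence of one makes `Ω` polyhedral. -/
structure Triangulation {n : ℕ} (Ω : Set (Sp n)) where
  cells : Finset (Finset (Sp n))
  card_eq : ∀ T ∈ cells, T.card = n + 1
  indep : ∀ T ∈ cells, AffineIndependent ℝ ((↑) : T → Sp n)
  inter : ∀ T ∈ cells, ∀ T' ∈ cells,
    convexHull ℝ (T : Set (Sp n)) ∩ convexHull ℝ (T' : Set (Sp n)) =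
      convexHull ℝ ((T : Set (Sp n)) ∩ (T' : Set (Sp n)))
  cover : ⋃ T ∈ cells, convexHull ℝ (T : Set (Sp n)) = closure Ω

/-- The closed simplex with the given vertices. -/
abbrev hull {n : ℕ} (T : Finset (Sp n)) : Set (Sp n) := convexHull ℝ (T : Set (Sp n))

/-- The diameter `h_T` of a simplex. -/
def diam {n : ℕ} (T : Finset (Sp n)) : ℝ := Metric.diam (hull T)

/-- The maximal mesh-size. -/
def Triangulation.meshSize {n : ℕ} {Ω : Set (Sp n)} (M : Triangulation Ω) : ℝ :=
  ⨆ T : M.cells, diam T.1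

/-- Quasi-uniformity with parameter `κ`: every cell contains a ball whose radius is `κ` times
the diameter of the cell, and this diameter is at least `κ` times the maximal mesh-size. -/
def QuasiUniform {n : ℕ} {Ω : Set (Sp n)} (κ : ℝ) (M : ℕ → Triangulation Ω) : Prop :=
  ∀ j, ∀ T ∈ (M j).cells,
    (∃ x, Metric.closedBall x (κ * diam T) ⊆ hull T) ∧ κ * (M j).meshSize ≤ diam T

open Classical in
/-- The common vertices of two cells. -/
def side {n : ℕ} (T T' : Finset (Sp n)) : Finset (Sp n) := T ∩ T'

open Classical in
/-- The cells `T' ≠ T` that share an `(n-1)`-dimensional side with `T`. The map `T' ↦ side T T'` is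
a bijection from these cells onto the interior sides of `T`. -/
def Triangulation.neighbours {n : ℕ} {Ω : Set (Sp n)} (M : Triangulation Ω) (T : Finset (Sp n)) :
    Finset (Finset (Sp n)) :=
  M.cells.filter (fun T' => T' ≠ T ∧ (side T T').card = n)

/-- The Lagrange points of degree `k` of the triangulation: the points of the cells whose
barycentric coordinates are integer multiples of `1 / k`. -/
def Triangulation.lagrangePoints {n : ℕ} {Ω : Set (Sp n)} (M : Triangulation Ω) (k : ℕ) :
    Set (Sp n) :=
  {z | ∃ T ∈ M.cells, ∃ β : Sp n → ℕ,
    ∑ p ∈ T, β p = k ∧ z = ∑ p ∈ T, ((β p : ℝ) / (k : ℝ)) • p}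

/-! ### Polynomials and piecewise polynomials -/

/-- The value of a polynomial at a point. -/
def value {n : ℕ} (p : MvPolynomial (Fin n) ℝ) (x : Sp n) : ℝ :=
  MvPolynomial.eval (fun i => x i) p

/-- The gradient of a polynomial. -/
def grad {n : ℕ} (p : MvPolynomial (Fin n) ℝ) (x : Sp n) : Sp n :=
  WithLp.toLp 2 (fun i => value (MvPolynomial.pderiv i p) x)

/-- The Hessian of a polynomial. -/
def hess {n : ℕ} (p : MvPolynomial (Fin n) ℝ) (x : Sp n) : Matrix (Fin n) (Fin n) ℝ :=
  Matrix.of fun i j => value (MvPolynomial.pderiv j (MvPolynomial.pderiv i p)) x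

/-- The Frobenius norm of a matrix. -/
def frobenius {n : ℕ} (H : Matrix (Fin n) (Fin n) ℝ) : ℝ := √(∑ i, ∑ j, H i j ^ 2)

/-- The space `V_nc(𝒯) = P_k(𝒯)` of piecewise polynomials, as families of polynomials indexed by
the cells. -/
abbrev Vnc {n : ℕ} {Ω : Set (Sp n)} (M : Triangulation Ω) (k : ℕ) := M.cells → Poly n k

/-- `p` is the `L²(K)`-projection of `u` onto the polynomials of degree at most `k`. -/
def IsL2Projection {n : ℕ} (K : Set (Sp n)) (k : ℕ) (u : Sp n → ℝ) (p : Poly n k) : Prop :=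
  ∀ q : Poly n k, ∫ x in K, (u x - value p.1 x) * value q.1 x = 0

open Classical in
/-- The `L²(K)`-projection of `u` onto the polynomials of degree at most `k` (it exists and is
unique if `K` is compact with nonempty interior and `u` is integrable on `K`). -/
def l2Projection {n : ℕ} (K : Set (Sp n)) (k : ℕ) (u : Sp n → ℝ) : Poly n k :=
  if h : ∃ p, IsL2Projection K k u p then h.choose else 0

/-- The piecewise `L²` projection `Π^k_𝒯 u`. -/
def pwProjection {n : ℕ} {Ω : Set (Sp n)} (M : Triangulation Ω) (k : ℕ) (u : Sp n → ℝ) :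
    Vnc M k :=
  fun T => l2Projection (hull T.1) k u

/-! ### Norms and the discrete functional -/

/-- The norm of `W^{2,n}(𝒯)` of a piecewise function, given on each cell by its values `w`, its
gradient `G`, and its Hessian `H`. -/
def brokenW2Norm {n : ℕ} {Ω : Set (Sp n)} (M : Triangulation Ω) (w : M.cells → Sp n → ℝ)
    (G : M.cells → Sp n → Sp n) (H : M.cells → Sp n → Matrix (Fin n) (Fin n) ℝ) : ℝ :=
  (∑ T : M.cells, ((∫ x in hull T.1, |w T x| ^ n) + (∫ x in hull T.1, ‖G T x‖ ^ n) +
    ∫ x in hull T.1, frobenius (H T x) ^ n)) ^ (1 / (n : ℝ))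

/-- `‖(1 - Π^k_𝒯) u‖_{W^{2,n}(𝒯)}` for `u` with gradient `G` and Hessian `H`. -/
def projectionError {n : ℕ} {Ω : Set (Sp n)} (M : Triangulation Ω) (k : ℕ) (u : Sp n → ℝ)
    (G : Sp n → Sp n) (H : Sp n → Matrix (Fin n) (Fin n) ℝ) : ℝ :=
  brokenW2Norm M (fun T x => u x - value (pwProjection M k u T).1 x)
    (fun T x => G x - grad (pwProjection M k u T).1 x)
    (fun T x => H x - hess (pwProjection M k u T).1 x)

/-- `‖[v]_F‖ⁿ_{Lⁿ(F)}` for the common side `F` of two cells, with respect to the `(n-1)`-dimensional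
surface measure. -/
def jumpValue {n : ℕ} {Ω : Set (Sp n)} {M : Triangulation Ω} {k : ℕ} (v : Vnc M k)
    (T T' : M.cells) : ℝ :=
  ∫ x in hull (side T.1 T'.1), |value (v T).1 x - value (v T').1 x| ^ n
    ∂(Measure.euclideanHausdorffMeasure (n - 1))

/-- `‖[∇_pw v]_F‖ⁿ_{Lⁿ(F)}` for the common side `F` of two cells. -/
def jumpGrad {n : ℕ} {Ω : Set (Sp n)} {M : Triangulation Ω} {k : ℕ} (v : Vnc M k)
    (T T' : M.cells) : ℝ :=
  ∫ x in hull (side T.1 T'.1), ‖grad (v T).1 x - grad (v T').1 x‖ ^ n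
    ∂(Measure.euclideanHausdorffMeasure (n - 1))

open Classical in
/-- The stabilization `s(v) = ∑_T ∑_F (h_F^{1-2n} ‖[v]_F‖ⁿ + h_F^{1-n} ‖[∇_pw v]_F‖ⁿ)`, where `F`
runs through the interior sides of `T`. -/
def stabilization {n : ℕ} {Ω : Set (Sp n)} {M : Triangulation Ω} {k : ℕ} (v : Vnc M k) : ℝ :=
  ∑ T : M.cells, ∑ T' : M.cells with T'.1 ∈ M.neighbours T.1,
    (diam (side T.1 T'.1) ^ (1 - 2 * (n : ℤ)) * jumpValue v T T' +
      diam (side T.1 T'.1) ^ (1 - (n : ℤ)) * jumpGrad v T T')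

/-- The functional `Ψ_nc(v, t) = α tⁿ + ‖f - L_pw v‖ⁿ_{Lⁿ(Ω)} + σ s(v)`. -/
def Psi {n : ℕ} {Ω : Set (Sp n)} {M : Triangulation Ω} {k : ℕ}
    (A : Sp n → Matrix (Fin n) (Fin n) ℝ) (b : Sp n → Sp n) (c f : Sp n → ℝ) (α σ : ℝ)
    (vt : Vnc M k × ℝ) : ℝ :=
  α * vt.2 ^ n +
    (∑ T : M.cells, ∫ x in hull T.1,
      |f x - diffOp A b c x (value (vt.1 T).1 x) (grad (vt.1 T).1 x) (hess (vt.1 T).1 x)| ^ n) +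
    σ * stabilization vt.1

/-- The set `𝒜_nc(gh, 𝒯)` of admissible pairs: `t ≥ 0` and `-t ≤ (gh - v)|_T (z) ≤ t` for all
cells `T` and all Lagrange points `z ∈ T` on the boundary of `Ω`. -/
def admissible {n : ℕ} {Ω : Set (Sp n)} {M : Triangulation Ω} {k : ℕ} (gh : Vnc M k) :
    Set (Vnc M k × ℝ) :=
  {vt | 0 ≤ vt.2 ∧ ∀ T : M.cells, ∀ z ∈ M.lagrangePoints k ∩ frontier Ω ∩ hull T.1,
    -vt.2 ≤ value (gh T).1 z - value (vt.1 T).1 z ∧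
      value (gh T).1 z - value (vt.1 T).1 z ≤ vt.2}

/-- The discrete data `gh` coincides with `g` on the boundary: for every cell `T`, the polynomial
`gh|_T` has the values of `g` on `T ∩ ∂Ω`. -/
def AgreesOnBoundary {n : ℕ} {Ω : Set (Sp n)} {M : Triangulation Ω} {k : ℕ} (gh : Vnc M k)
    (g : Sp n → ℝ) : Prop :=
  ∀ T : M.cells, ∀ x ∈ hull T.1 ∩ frontier Ω, value (gh T).1 x = g x

end NonconformingFEM

end

open NonconformingFEM

/-! The functional is tested with one pair: the piecewise projection Πu, together with t equal to a
constant times diam(Ω) times the projection error. The infimum and every minimum are at most the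
value of Ψ at this pair. So the theorem reduces to the admissibility of the pair and to bounds for
the three terms of Ψ (`exists_admissible_Psi_le`).

The hinge is a maximum-norm estimate for w = u - Πu on a cell T: |w| ≤ C h_T ‖D²w‖ in Lⁿ(T)
(`IsW2.exists_abs_sub_l2Projection_le`). Let q be the first-order Taylor polynomial of w, averaged
over its base point. In the remainder, the contraction of T towards x has Jacobian (1-t)ⁿ; its
inverse becomes (1-t)⁻¹ after Hölder in Lⁿ, and the weight 1-t of Taylor's formula cancels it. Hence
|w - q| ≤ C h_T ‖D²w‖. Since w is orthogonal to affine functions, ∫q² = -∫(w - q)q, and the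
equivalence of polynomial norms (`IsLinePoly.exists_abs_le`) bounds q by w - q. The estimate gives
admissibility, because the discrete data equal g = u on the boundary, and it bounds the jumps of
values.

The residual is f - LΠu = Lw almost everywhere, so bounds on the coefficients suffice
(`exists_residual_le`).

The jumps of gradients are treated without traces of ∇u. For a direction v transversal to a side,
Taylor's formula along v in one cell and along -v in the other bounds the v-derivative of the
difference of the two polynomials, because the derivative of u at the common base point cancels.
Averaging over base points turns integrals along segments into volume integrals over half balls
(`lintegral_segments_le`), and the equivalence of polynomial norms leads back to a pointwise bound
on the side (`IsW2.exists_abs_inner_grad_sub_le`, `IsW2.exists_jump_le`). The powers of h_F match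
the scaling of the surface measure, and each cell has boundedly many neighbours, so the local bounds
add up (`exists_stabilization_le`).

Taylor's formula is applied to mollifications, which approximate u only on compact subsets of Ω. A
cell is therefore first shrunk towards a point of its interior, whereas the balls around barycenters
of interior sides already lie in Ω. -/

noncomputable section

namespace NonconformingFEM

variable {n : ℕ}

/-! ### Second derivatives and Taylor's formula -/

/-- The partial derivative `∂ᵢ w`. -/
def partialD (i : Fin n) (w : Sp n → ℝ) (x : Sp n) : ℝ :=
  fderiv ℝ w x (EuclideanSpace.single i 1)

/-- The Hessian of a function. -/
def hessian (w : Sp n → ℝ) (x : Sp n) : Matrix (Fin n) (Fin n) ℝ :=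
  Matrix.of fun i j => partialD j (partialD i w) x

theorem frobenius_nonneg (H : Matrix (Fin n) (Fin n) ℝ) : 0 ≤ frobenius H := Real.sqrt_nonneg _

theorem abs_quadratic_le (H : Matrix (Fin n) (Fin n) ℝ) (v : Sp n) :
    |∑ i, ∑ j, H i j * (v i * v j)| ≤ frobenius H * ‖v‖ ^ 2 := by
  apply abs_le_of_sq_le_sq
  · rw [mul_pow, frobenius, Real.sq_sqrt (by positivity),
      ← Finset.sum_product' Finset.univ Finset.univ (fun i j => H i j * (v i * v j)),
      ← Finset.sum_product' Finset.univ Finset.univ (fun i j => H i j ^ 2)]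
    refine (Finset.sum_mul_sq_le_sq_mul_sq _ _ _).trans (le_of_eq ?_)
    congr 1
    rw [EuclideanSpace.norm_sq_eq, Finset.sum_product, sq, Finset.sum_mul_sum]
    simp [mul_pow]
  · exact mul_nonneg (frobenius_nonneg H) (by positivity)

theorem continuous_frobenius : Continuous (frobenius : Matrix (Fin n) (Fin n) ℝ → ℝ) := by
  unfold frobenius
  fun_prop

theorem fderiv_apply_eq_sum (w : Sp n → ℝ) (x v : Sp n) :
    fderiv ℝ w x v = ∑ i, v i * partialD i w x := by
  conv_lhs => rw [← (EuclideanSpace.basisFun (Fin n) ℝ).sum_repr v]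
  simp [partialD]

theorem ContDiff.partialD {m : ℕ} {w : Sp n → ℝ} (hw : ContDiff ℝ (m + 1 : ℕ) w) (i : Fin n) :
    ContDiff ℝ m (partialD i w) := by
  have := hw.fderiv_right (m := m) (by norm_cast)
  exact this.clm_apply contDiff_const

theorem continuous_hessian {w : Sp n → ℝ} (hw : ContDiff ℝ 2 w) : Continuous (hessian w) := by
  refine continuous_matrix fun i j => ?_
  have h1 : ContDiff ℝ (1 : ℕ) (NonconformingFEM.partialD i w) := ContDiff.partialD (m := 1) hw i
  exact (ContDiff.partialD (m := 0) h1 j).continuous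

theorem hasDerivAt_line {w : Sp n → ℝ} (hw : ContDiff ℝ 1 w) (y v : Sp n) (t : ℝ) :
    HasDerivAt (fun s : ℝ => w (y + s • v)) (fderiv ℝ w (y + t • v) v) t := by
  have h1 := (hw.differentiable (by norm_num) (y + t • v)).hasFDerivAt
  have h2 : HasDerivAt (fun s : ℝ => y + s • v) v t := by
    simpa using ((hasDerivAt_id t).smul_const v).const_add y
  exact h1.comp_hasDerivAt t h2

theorem hasDerivAt_line_fderiv {w : Sp n → ℝ} (hw : ContDiff ℝ 2 w) (y v : Sp n) (t : ℝ) :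
    HasDerivAt (fun s : ℝ => fderiv ℝ w (y + s • v) v)
      (∑ i, ∑ j, hessian w (y + t • v) i j * (v i * v j)) t := by
  have h1 : ∀ i, ContDiff ℝ 1 (partialD i w) := fun i => ContDiff.partialD (m := 1) hw i
  have h2 := HasDerivAt.fun_sum (u := Finset.univ) fun i _ =>
    (hasDerivAt_line (h1 i) y v t).const_mul (v i)
  have h3 : (fun s : ℝ => fderiv ℝ w (y + s • v) v) =
      fun s => ∑ i, v i * partialD i w (y + s • v) := by
    ext s
    exact fderiv_apply_eq_sum w _ v
  rw [h3]
  refine h2.congr_deriv ?_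
  refine Finset.sum_congr rfl fun i _ => ?_
  rw [fderiv_apply_eq_sum, Finset.mul_sum]
  refine Finset.sum_congr rfl fun j _ => ?_
  simp only [hessian, Matrix.of_apply]
  ring

/-- Taylor's formula along a segment. -/
theorem abs_taylor_le {w : Sp n → ℝ} (hw : ContDiff ℝ 2 w) (y v : Sp n) {s : ℝ} (hs : 0 ≤ s) :
    |w (y + s • v) - w y - s * fderiv ℝ w y v| ≤
      ∫ t in (0 : ℝ)..s, (s - t) * (‖v‖ ^ 2 * frobenius (hessian w (y + t • v))) := by
  have hw1 : ContDiff ℝ 1 w := hw.of_le (by norm_num)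
  have hcN : Continuous fun t : ℝ => hessian w (y + t • v) :=
    (continuous_hessian hw).comp (by fun_prop)
  have key : ∫ t in (0 : ℝ)..s, (s - t) * ∑ i, ∑ j, hessian w (y + t • v) i j * (v i * v j)
      = w (y + s • v) - w y - s * fderiv ℝ w y v := by
    have hd : ∀ t ∈ uIcc 0 s, HasDerivAt
        (fun t : ℝ => w (y + t • v) + (s - t) * fderiv ℝ w (y + t • v) v)
        ((s - t) * ∑ i, ∑ j, hessian w (y + t • v) i j * (v i * v j)) t := by
      intro t _
      have h2 := ((hasDerivAt_id t).const_sub s).mul (hasDerivAt_line_fderiv hw y v t)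
      have h3 := (hasDerivAt_line hw1 y v t).add h2
      refine h3.congr_deriv ?_
      simp
    rw [intervalIntegral.integral_eq_sub_of_hasDerivAt hd]
    · simp
      ring
    · apply Continuous.intervalIntegrable
      fun_prop
  rw [← key]
  have h0 : ∀ t ∈ Ioc 0 s, ‖(s - t) * ∑ i, ∑ j, hessian w (y + t • v) i j * (v i * v j)‖ ≤
      (s - t) * (‖v‖ ^ 2 * frobenius (hessian w (y + t • v))) := by
    intro t ht
    rw [norm_mul, Real.norm_eq_abs, Real.norm_eq_abs, abs_of_nonneg (by linarith [ht.2]),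
      mul_comm (‖v‖ ^ 2)]
    exact mul_le_mul_of_nonneg_left (abs_quadratic_le _ _) (by linarith [ht.2])
  rw [← Real.norm_eq_abs]
  refine intervalIntegral.norm_integral_le_of_norm_le hs (ae_of_all _ h0) ?_
  apply Continuous.intervalIntegrable
  have := continuous_frobenius.comp hcN
  simp only [Function.comp_def] at this
  fun_prop

/-! ### Values, gradients and Hessians of polynomials -/

theorem hasFDerivAt_value (p : MvPolynomial (Fin n) ℝ) (x : Sp n) :
    HasFDerivAt (value p) (innerSL ℝ (grad p x)) x := by
  induction p using MvPolynomial.induction_on with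
  | C a =>
    have : value (MvPolynomial.C a : MvPolynomial (Fin n) ℝ) = fun _ => a := by
      ext; simp [value]
    rw [this]
    refine (hasFDerivAt_const a x).congr_fderiv ?_
    ext v
    simp [grad, value, PiLp.inner_apply]
  | add p q hp hq =>
    have : value (p + q) = fun x => value p x + value q x := by ext; simp [value]
    rw [this]
    refine (hp.add hq).congr_fderiv ?_
    ext v
    simp [grad, value, PiLp.inner_apply, mul_add, Finset.sum_add_distrib]
  | mul_X p i hp =>
    have : value (p * MvPolynomial.X i) = fun x => value p x * x i := by ext; simp [value]
    rw [this]
    have h2 : HasFDerivAt (fun x : Sp n => x i) (EuclideanSpace.proj i : Sp n →L[ℝ] ℝ) x :=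
      (EuclideanSpace.proj i : Sp n →L[ℝ] ℝ).hasFDerivAt
    refine (hp.mul h2).congr_fderiv ?_
    ext v
    simp [grad, value, PiLp.inner_apply, MvPolynomial.pderiv_X, Pi.single_apply, mul_add,
      Finset.sum_add_distrib, apply_ite, Finset.mul_sum]
    rw [mul_comm]
    exact congrArg _ (Finset.sum_congr rfl fun j _ => by ring)

theorem partialD_value (p : MvPolynomial (Fin n) ℝ) (i : Fin n) :
    partialD i (value p) = value (MvPolynomial.pderiv i p) := by
  ext x
  rw [partialD, (hasFDerivAt_value p x).fderiv]
  simp [grad, EuclideanSpace.inner_single_right]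

theorem hessian_value (p : MvPolynomial (Fin n) ℝ) : hessian (value p) = hess p := by
  ext x i j
  simp [hessian, hess, partialD_value]

theorem contDiff_value (p : MvPolynomial (Fin n) ℝ) : ContDiff ℝ ∞ (value p) := by
  unfold value
  simp only [MvPolynomial.eval_eq]
  fun_prop

theorem continuous_value (p : MvPolynomial (Fin n) ℝ) : Continuous (value p) :=
  (contDiff_value p).continuous

theorem continuous_hess (p : MvPolynomial (Fin n) ℝ) : Continuous (hess p) :=
  continuous_matrix fun _ _ => continuous_value _

theorem partialD_sub {v w : Sp n → ℝ} (hv : Differentiable ℝ v) (hw : Differentiable ℝ w)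
    (i : Fin n) : partialD i (fun x => v x - w x) = fun x => partialD i v x - partialD i w x := by
  ext x
  simp [partialD, fderiv_fun_sub (hv x) (hw x)]

theorem hessian_sub {v w : Sp n → ℝ} (hv : ContDiff ℝ 2 v) (hw : ContDiff ℝ 2 w) (x : Sp n) :
    hessian (fun x => v x - w x) x = hessian v x - hessian w x := by
  ext i j
  have h1 := fun u : Sp n → ℝ => fun hu : ContDiff ℝ 2 u =>
    (ContDiff.partialD (m := 1) hu i).differentiable (by norm_num)
  simp only [hessian, Matrix.of_apply, Matrix.sub_apply]
  rw [partialD_sub (hv.differentiable (by norm_num)) (hw.differentiable (by norm_num)),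
    partialD_sub (h1 v hv) (h1 w hw)]

/-! ### Averaged Taylor polynomials -/

theorem lintegral_comp_smul_add (f : Sp n → ℝ≥0∞) {a : ℝ} (ha : 0 < a) (z : Sp n) :
    ∫⁻ y, f (a • y + z) = ENNReal.ofReal ((a ^ n)⁻¹) * ∫⁻ y, f y := by
  have h1 : ∫⁻ y, f (a • y + z) = ∫⁻ y, f (y + z) ∂(Measure.map (a • ·) volume) :=
    ((Homeomorph.smulOfNeZero a ha.ne').toMeasurableEquiv.measurableEmbedding.lintegral_map
      (fun y => f (y + z))).symm
  rw [h1, Measure.map_addHaar_smul _ ha.ne', lintegral_smul_measure,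
    lintegral_add_right_eq_self f z, finrank_euclideanSpace, Fintype.card_fin,
    abs_of_pos (by positivity), smul_eq_mul]

/-- Integrals over a shrunken copy of a convex set, in terms of the original set. -/
theorem setLIntegral_comp_segment_le {T : Set (Sp n)} (hT : Convex ℝ T) (hTm : MeasurableSet T)
    (f : Sp n → ℝ≥0∞) {x : Sp n} (hx : x ∈ T) {t : ℝ} (ht : 0 ≤ t) (ht1 : t < 1) :
    ∫⁻ y in T, f (y + t • (x - y)) ≤ ENNReal.ofReal (((1 - t) ^ n)⁻¹) * ∫⁻ y in T, f y := by
  rw [← lintegral_indicator hTm, ← lintegral_indicator hTm,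
    ← lintegral_comp_smul_add _ (sub_pos.2 ht1) (t • x)]
  refine lintegral_mono fun y => ?_
  by_cases hy : y ∈ T
  · have e : (1 - t) • y + t • x = y + t • (x - y) := by module
    have : (1 - t) • y + t • x ∈ T := hT hy hx (by linarith) ht (by ring)
    simp only [indicator_of_mem hy, indicator_of_mem this]
    rw [e]
  · simp [hy]

/-- Hölder's inequality against the constant function on a set. -/
theorem setLIntegral_le_rpow {T : Set (Sp n)} {f : Sp n → ℝ≥0∞} (hf : Measurable f) {p : ℕ}
    (hp : 1 ≤ p) :
    ∫⁻ y in T, f y ≤ (∫⁻ y in T, f y ^ p) ^ (1 / (p : ℝ)) * volume T ^ (1 - 1 / (p : ℝ)) := by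
  have h := eLpNorm_le_eLpNorm_mul_rpow_measure_univ (μ := volume.restrict T) (p := 1)
    (q := (p : ℝ≥0∞)) (f := f) (by exact_mod_cast hp) hf.aestronglyMeasurable
  rw [eLpNorm_one_eq_lintegral_enorm, eLpNorm_eq_lintegral_rpow_enorm_toReal (by positivity)
    (by simp)] at h
  simpa using h

/-- Averaged Taylor expansion. The remainder at x is an integral over y in T and t in (0, 1) of (1 -
t) times the Hessian at y + t(x - y). For fixed t, the substitution y ↦ (1 - t)y + tx followed by
Hölder costs (1 - t)⁻¹, exactly the available weight. -/
theorem exists_affine_abs_sub_le {T : Set (Sp n)} (hn : 1 ≤ n) (hT : Convex ℝ T)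
    (hTc : IsCompact T) {h : ℝ} (hTh : ∀ x ∈ T, ∀ y ∈ T, ‖x - y‖ ≤ h)
    (hpos : 0 < volume.real T) {w : Sp n → ℝ} (hw : ContDiff ℝ 2 w) {E : ℝ} (hE : 0 ≤ E)
    (hwE : ∫⁻ y in T, ENNReal.ofReal (frobenius (hessian w y)) ^ n ≤ ENNReal.ofReal E ^ n) :
    ∃ (a : ℝ) (l : Sp n →L[ℝ] ℝ), ∀ x ∈ T,
      |w x - (a + l x)| * volume.real T ≤ h ^ 2 * E * volume.real T ^ (1 - 1 / (n : ℝ)) := by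
  have hTm : MeasurableSet T := hTc.isClosed.measurableSet
  have hTfin : volume T ≠ ⊤ := hTc.measure_lt_top.ne
  have hw1 : ContDiff ℝ 1 w := hw.of_le (by norm_num)
  have hcf : Continuous (fderiv ℝ w) := (hw.fderiv_right (m := 1) (by norm_num)).continuous
  have hcw : Continuous w := hw.continuous
  set N : Sp n → ℝ := fun y => frobenius (hessian w y) with hN
  have hcN : Continuous N := continuous_frobenius.comp (continuous_hessian hw)
  have hN0 : ∀ y, 0 ≤ N y := fun y => frobenius_nonneg _
  have hint : ∀ {F : Type} [NormedAddCommGroup F] {f : Sp n → F}, Continuous f →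
      IntegrableOn f T := fun hf => hf.continuousOn.integrableOn_compact hTc
  set V := volume.real T with hV
  -- Mean over y of the Taylor polynomial w(y) + Dw(y)(x - y), split into the part constant in x and
  -- the part linear in x.
  refine ⟨V⁻¹ * ∫ y in T, (w y - fderiv ℝ w y y), V⁻¹ • ∫ y in T, fderiv ℝ w y, fun x hx => ?_⟩
  have hq : (w x - (V⁻¹ * (∫ y in T, (w y - fderiv ℝ w y y)) +
      (V⁻¹ • ∫ y in T, fderiv ℝ w y) x)) * V =
      ∫ y in T, (w x - w y - fderiv ℝ w y (x - y)) := by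
    have e : ∀ y, w x - w y - fderiv ℝ w y (x - y) =
        (w x - (w y - fderiv ℝ w y y)) - fderiv ℝ w y x := fun y => by
      rw [map_sub]; ring
    simp_rw [e]
    rw [integral_sub (f := fun y => w x - (w y - fderiv ℝ w y y)),
      integral_sub (f := fun _ => w x) (g := fun y => w y - fderiv ℝ w y y),
      smul_apply, ContinuousLinearMap.integral_apply (hint hcf)]
    · simp only [integral_const, measureReal_restrict_apply MeasurableSet.univ, univ_inter,
        smul_eq_mul]
      field_simp
      ring
    all_goals refine hint ?_
    all_goals fun_prop
  have hpt : ∀ y ∈ T, ‖w x - w y - fderiv ℝ w y (x - y)‖ₑ ≤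
      ∫⁻ t in Ioo (0 : ℝ) 1, ENNReal.ofReal ((1 - t) * h ^ 2) *
        ENNReal.ofReal (N (y + t • (x - y))) := by
    intro y hy
    have h1 := abs_taylor_le hw y (x - y) zero_le_one
    rw [one_smul, one_mul, add_sub_cancel, intervalIntegral.integral_of_le zero_le_one,
      integral_Ioc_eq_integral_Ioo] at h1
    rw [← ofReal_norm, Real.norm_eq_abs]
    refine (ENNReal.ofReal_le_ofReal h1).trans ?_
    rw [ofReal_integral_eq_lintegral_ofReal]
    · refine setLIntegral_mono' measurableSet_Ioo fun t ht => ?_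
      rw [← ENNReal.ofReal_mul (by nlinarith [ht.2, sq_nonneg h]), mul_assoc]
      have := hTh x hx y hy
      have := ht.2
      have := hN0 (y + t • (x - y))
      gcongr
    · refine Continuous.integrableOn_Ioc ?_ |>.mono_set Ioo_subset_Ioc_self
      have : Continuous fun t : ℝ => N (y + t • (x - y)) := by fun_prop
      exact (continuous_const.sub continuous_id).mul (continuous_const.mul this)
    · filter_upwards [ae_restrict_mem measurableSet_Ioo] with t ht
      have := ht.2
      exact mul_nonneg (by linarith) (mul_nonneg (by positivity) (hN0 _))
  have hmain : ∫⁻ y in T, ∫⁻ t in Ioo (0 : ℝ) 1, ENNReal.ofReal ((1 - t) * h ^ 2) *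
        ENNReal.ofReal (N (y + t • (x - y))) ≤
      ENNReal.ofReal (h ^ 2 * E * V ^ (1 - 1 / (n : ℝ))) := by
    have hNm : ∀ t : ℝ, Measurable fun y => ENNReal.ofReal (N (y + t • (x - y))) := fun t => by
      apply Continuous.measurable
      exact ENNReal.continuous_ofReal.comp (hcN.comp (by fun_prop))
    rw [lintegral_lintegral_swap]
    · have hle : ∀ t ∈ Ioo (0 : ℝ) 1, ∫⁻ y in T, ENNReal.ofReal ((1 - t) * h ^ 2) *
          ENNReal.ofReal (N (y + t • (x - y))) ≤
            ENNReal.ofReal (h ^ 2 * E * V ^ (1 - 1 / (n : ℝ))) := by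
        intro t ht
        have ht0 : 0 < 1 - t := by linarith [ht.2]
        rw [lintegral_const_mul _ (hNm t)]
        have h1 := setLIntegral_le_rpow (T := T) (hNm t) hn
        have h2 := (setLIntegral_comp_segment_le hT hTm
          (fun y => ENNReal.ofReal (N y) ^ n) hx ht.1.le ht.2).trans
            (mul_le_mul_right hwE _)
        rw [← inv_pow, ENNReal.ofReal_pow (by positivity), ← mul_pow] at h2
        have h3 := ENNReal.rpow_le_rpow h2 (by positivity : 0 ≤ (1 / (n : ℝ)))
        rw [one_div, ENNReal.pow_rpow_inv_natCast (by omega)] at h3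
        have h4 : volume T ^ (1 - 1 / (n : ℝ)) = ENNReal.ofReal (V ^ (1 - 1 / (n : ℝ))) := by
          rw [← ENNReal.ofReal_rpow_of_pos hpos, hV, ofReal_measureReal hTfin]
        rw [h4, one_div] at h1
        -- The factor (1 - t)⁻¹ is the n-th root of the inverse Jacobian. It cancels against the
        -- Taylor weight, so the bound does not depend on t.
        calc _ ≤ ENNReal.ofReal ((1 - t) * h ^ 2) * (ENNReal.ofReal (1 - t)⁻¹ * ENNReal.ofReal E *
              ENNReal.ofReal (V ^ (1 - (n : ℝ)⁻¹))) := by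
              gcongr
              exact h1.trans (mul_le_mul_left h3 _)
          _ = _ := by
            rw [← ENNReal.ofReal_mul (by positivity), ← ENNReal.ofReal_mul (by positivity),
              ← ENNReal.ofReal_mul (by positivity), one_div]
            congr 1
            field_simp
      refine (setLIntegral_mono' measurableSet_Ioo hle).trans ?_
      simp
    · apply Measurable.aemeasurable
      refine Measurable.mul (f := fun z : Sp n × ℝ => ENNReal.ofReal ((1 - z.2) * h ^ 2)) ?_ ?_
      · fun_prop
      · apply Continuous.measurable
        exact ENNReal.continuous_ofReal.comp (hcN.comp (by fun_prop))
  have h1 : |w x - (V⁻¹ * (∫ y in T, (w y - fderiv ℝ w y y)) +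
      (V⁻¹ • ∫ y in T, fderiv ℝ w y) x)| * V =
      |∫ y in T, (w x - w y - fderiv ℝ w y (x - y))| := by
    rw [← hq, abs_mul, abs_of_pos hpos]
  rw [h1]
  have h2 := (enorm_integral_le_lintegral_enorm
    (μ := volume.restrict T) fun y => w x - w y - fderiv ℝ w y (x - y)).trans
    ((setLIntegral_mono' hTm hpt).trans hmain)
  rw [← ofReal_norm, ENNReal.ofReal_le_ofReal_iff (by positivity),
    Real.norm_eq_abs] at h2
  exact h2

/-! ### Functions that are polynomials along lines -/

/-- Continuous functions whose restriction to every line is a polynomial of degree at most `k`. -/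
def IsLinePoly (k : ℕ) (q : Sp n → ℝ) : Prop :=
  Continuous q ∧ ∀ x v : Sp n, ∃ r : Polynomial ℝ, r.natDegree ≤ k ∧
    ∀ t : ℝ, q (x + t • v) = r.eval t

namespace IsLinePoly

theorem add {k : ℕ} {p q : Sp n → ℝ} (hp : IsLinePoly k p) (hq : IsLinePoly k q) :
    IsLinePoly k (fun x => p x + q x) := by
  refine ⟨hp.1.add hq.1, fun x v => ?_⟩
  obtain ⟨r, hr, h⟩ := hp.2 x v
  obtain ⟨s, hs, h'⟩ := hq.2 x v
  exact ⟨r + s, Polynomial.natDegree_add_le_of_degree_le hr hs, fun t => by simp [h, h']⟩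

theorem const_mul {k : ℕ} {p : Sp n → ℝ} (hp : IsLinePoly k p) (a : ℝ) :
    IsLinePoly k (fun x => a * p x) := by
  refine ⟨continuous_const.mul hp.1, fun x v => ?_⟩
  obtain ⟨r, hr, h⟩ := hp.2 x v
  exact ⟨Polynomial.C a * r, (Polynomial.natDegree_C_mul_le _ _).trans hr, fun t => by simp [h]⟩

theorem sub {k : ℕ} {p q : Sp n → ℝ} (hp : IsLinePoly k p) (hq : IsLinePoly k q) :
    IsLinePoly k (fun x => p x - q x) := by
  simpa [sub_eq_add_neg] using hp.add (hq.const_mul (-1))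

theorem mul {k l : ℕ} {p q : Sp n → ℝ} (hp : IsLinePoly k p) (hq : IsLinePoly l q) :
    IsLinePoly (k + l) (fun x => p x * q x) := by
  refine ⟨hp.1.mul hq.1, fun x v => ?_⟩
  obtain ⟨r, hr, h⟩ := hp.2 x v
  obtain ⟨s, hs, h'⟩ := hq.2 x v
  exact ⟨r * s, Polynomial.natDegree_mul_le_of_le hr hs, fun t => by simp [h, h']⟩

theorem zero (k : ℕ) : IsLinePoly k (fun _ : Sp n => (0 : ℝ)) :=
  ⟨continuous_const, fun _ _ => ⟨0, by simp, by simp⟩⟩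

theorem sum {ι : Type*} {k : ℕ} (s : Finset ι) {p : ι → Sp n → ℝ}
    (hp : ∀ i ∈ s, IsLinePoly k (p i)) : IsLinePoly k (fun x => ∑ i ∈ s, p i x) := by
  classical
  induction s using Finset.induction_on with
  | empty => simpa using zero k
  | insert i s hi ih =>
    simp only [Finset.sum_insert hi]
    exact (hp i (by simp)).add (ih fun j hj => hp j (by simp [hj]))

/-- Stability under affine maps with an unchanged degree bound; it is applied to the oblique
projection onto a hyperplane. -/
theorem comp {k : ℕ} {p : Sp n → ℝ} (hp : IsLinePoly k p) (f : Sp n →ᵃ[ℝ] Sp n) :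
    IsLinePoly k (fun x => p (f x)) := by
  refine ⟨hp.1.comp f.continuous_of_finiteDimensional, fun x v => ?_⟩
  obtain ⟨r, hr, h⟩ := hp.2 (f x) (f.linear v)
  refine ⟨r, hr, fun t => ?_⟩
  have e : f (x + t • v) = f x + t • f.linear v := by
    rw [add_comm, ← vadd_eq_add, AffineMap.map_vadd, map_smul, vadd_eq_add, add_comm]
  rw [← h, ← e]

theorem affine (a : ℝ) (l : Sp n →L[ℝ] ℝ) : IsLinePoly 1 (fun x => a + l x) := by
  refine ⟨by fun_prop, fun x v => ⟨Polynomial.C (a + l x) + Polynomial.X * Polynomial.C (l v),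
    ?_, fun t => by simp; ring⟩⟩
  compute_degree

theorem value {k : ℕ} {p : MvPolynomial (Fin n) ℝ} (hp : p.totalDegree ≤ k) :
    IsLinePoly k (value p) := by
  refine ⟨continuous_value p, fun x v => ?_⟩
  refine ⟨MvPolynomial.aeval (fun i => Polynomial.C (x i) + Polynomial.X * Polynomial.C (v i)) p,
    ?_, fun t => ?_⟩
  · refine (MvPolynomial.aeval_natDegree_le p hp _ (n := 1) fun i => ?_).trans (by simp)
    compute_degree
  · rw [← Polynomial.coe_evalRingHom, MvPolynomial.aeval_def, MvPolynomial.hom_eval₂,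
      NonconformingFEM.value, MvPolynomial.eval]
    have e : (Polynomial.evalRingHom t).comp (algebraMap ℝ (Polynomial ℝ)) = RingHom.id ℝ :=
      RingHom.ext fun r => by simp
    rw [e, MvPolynomial.coe_eval₂Hom]
    congr 1
    ext i
    simp only [map_add, map_mul, Polynomial.coe_evalRingHom, Polynomial.eval_C, Polynomial.eval_X]
    rfl

end IsLinePoly

/-- Lagrange interpolation at k + 1 equidistant nodes near 0, evaluated at 1. The weights depend
only on k and τ, so the constants built from them are uniform in the polynomial. -/
theorem exists_extrapolation (k : ℕ) {τ : ℝ} (hτ : 0 < τ) :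
    ∃ c : ℕ → ℝ, ∀ r : Polynomial ℝ, r.natDegree ≤ k →
      r.eval 1 = ∑ m ∈ Finset.range (k + 1), c m * r.eval (m * τ) := by
  have hinj : Set.InjOn (fun m : ℕ => (m : ℝ) * τ) (Finset.range (k + 1)) := by
    intro a _ b _ h
    simpa [hτ.ne'] using h
  refine ⟨fun m => (Lagrange.basis (Finset.range (k + 1)) (fun m : ℕ => (m : ℝ) * τ) m).eval 1,
    fun r hr => ?_⟩
  have hd : r.degree < ((Finset.range (k + 1)).card : WithBot ℕ) := by
    rw [Finset.card_range]
    exact lt_of_le_of_lt Polynomial.degree_le_natDegree (by exact_mod_cast Nat.lt_succ_of_le hr)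
  conv_lhs => rw [Lagrange.eq_interpolate hinj hd, Lagrange.interpolate_apply,
    Polynomial.eval_finsetSum]
  simp [mul_comm]

/-- A polynomial is bounded on a ball by its mean over a smaller ball. -/
theorem IsLinePoly.exists_abs_le (n k : ℕ) (R : ℝ) : ∃ C : ℝ, 0 < C ∧ ∀ q : Sp n → ℝ,
    IsLinePoly k q → ∀ (x₀ : Sp n) (ρ : ℝ), 0 < ρ → ∀ x ∈ Metric.closedBall x₀ (R * ρ),
      ENNReal.ofReal (|q x| * ρ ^ n) ≤
        ENNReal.ofReal C * ∫⁻ y in Metric.ball x₀ ρ, ENNReal.ofReal |q y| := by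
  -- For every node m ≤ k this gives mτ(|R| + 1) ≤ 1/2. The points y + mτ(x - y) with y in the half
  -- ball and x in the ball of radius Rρ then stay in the ball of radius ρ.
  set τ : ℝ := 1 / (2 * (k + 1) * (|R| + 1)) with hτ
  have hτ0 : 0 < τ := by positivity
  obtain ⟨c, hc⟩ := exists_extrapolation k hτ0
  set V := (volume (Metric.ball (0 : Sp n) 1)).toReal with hV
  have hVtop : volume (Metric.ball (0 : Sp n) 1) ≠ ⊤ := measure_ball_lt_top.ne
  have hV0 : 0 < V := ENNReal.toReal_pos (Metric.measure_ball_pos _ _ one_pos).ne' hVtop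
  set S := ∑ m ∈ Finset.range (k + 1), |c m| with hS
  have hS0 : 0 ≤ S := Finset.sum_nonneg fun _ _ => abs_nonneg _
  -- One factor 2ⁿ bounds the Jacobian (1 - mτ)⁻ⁿ, the other comes from the volume of the half ball;
  -- S + 1 keeps the constant positive.
  refine ⟨(S + 1) * 2 ^ n * 2 ^ n / V, by positivity, fun q hq x₀ ρ hρ x hx => ?_⟩
  have hqm : Measurable fun y => ENNReal.ofReal |q y| := by
    have := hq.1.measurable
    fun_prop
  have ht : ∀ m ∈ Finset.range (k + 1), 0 ≤ m * τ ∧ m * τ * (|R| + 1) ≤ 1 / 2 := by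
    intro m hm
    have hm' : (m : ℝ) ≤ k + 1 := by exact_mod_cast (Finset.mem_range.1 hm).le
    refine ⟨by positivity, ?_⟩
    rw [hτ]
    have : (m : ℝ) * (1 / (2 * (k + 1) * (|R| + 1))) * (|R| + 1) = (m / (k + 1)) / 2 := by
      field_simp
    rw [this]
    gcongr
    exact (div_le_one (by positivity)).2 hm'
  set I := ∫⁻ y in Metric.ball x₀ ρ, ENNReal.ofReal |q y| with hI
  have h1 : ∀ y, ENNReal.ofReal |q x| ≤ ∑ m ∈ Finset.range (k + 1),
      ENNReal.ofReal |c m| * ENNReal.ofReal |q (y + (m * τ) • (x - y))| := by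
    intro y
    obtain ⟨r, hr, h⟩ := hq.2 y (x - y)
    have e : q x = ∑ m ∈ Finset.range (k + 1), c m * q (y + (m * τ : ℝ) • (x - y)) := by
      have := h 1
      rw [one_smul, add_sub_cancel] at this
      rw [this, hc r hr]
      simp_rw [h]
    rw [e]
    simp_rw [← ENNReal.ofReal_mul (abs_nonneg _), ← abs_mul]
    rw [← ENNReal.ofReal_sum_of_nonneg fun _ _ => abs_nonneg _]
    exact ENNReal.ofReal_le_ofReal (Finset.abs_sum_le_sum_abs _ _)
  have h2 : ∀ m ∈ Finset.range (k + 1), ∫⁻ y in Metric.ball x₀ (ρ / 2),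
      ENNReal.ofReal |q (y + (m * τ) • (x - y))| ≤ ENNReal.ofReal (2 ^ n) * I := by
    intro m hm
    obtain ⟨t0, t1⟩ := ht m hm
    set t : ℝ := m * τ
    have htt : t ≤ 1 / 2 := by nlinarith [abs_nonneg R]
    have hmono : ENNReal.ofReal (((1 - t) ^ n)⁻¹) ≤ ENNReal.ofReal (2 ^ n) := by
      apply ENNReal.ofReal_le_ofReal
      rw [← inv_pow]
      gcongr
      · exact inv_nonneg.2 (by linarith)
      · rw [inv_le_comm₀ (by linarith) two_pos]
        linarith
    refine le_trans ?_ (mul_le_mul_left hmono _)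
    rw [hI, ← lintegral_indicator measurableSet_ball, ← lintegral_indicator measurableSet_ball,
      ← lintegral_comp_smul_add _ (by linarith : 0 < 1 - t) (t • x)]
    refine lintegral_mono fun y => ?_
    by_cases hy : y ∈ Metric.ball x₀ (ρ / 2)
    · have e : (1 - t) • y + t • x = y + t • (x - y) := by module
      have hmem : (1 - t) • y + t • x ∈ Metric.ball x₀ ρ := by
        rw [mem_ball_iff_norm] at hy ⊢
        rw [mem_closedBall_iff_norm] at hx
        have e2 : (1 - t) • y + t • x - x₀ = (1 - t) • (y - x₀) + t • (x - x₀) := by module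
        rw [e2]
        refine (norm_add_le _ _).trans_lt ?_
        rw [norm_smul, norm_smul, Real.norm_of_nonneg (by linarith), Real.norm_of_nonneg t0]
        have h3 : t * ‖x - x₀‖ ≤ t * (|R| * ρ) := by
          refine mul_le_mul_of_nonneg_left (hx.trans ?_) t0
          gcongr
          exact le_abs_self R
        have h4 : t * |R| ≤ 1 / 2 := by nlinarith
        nlinarith [norm_nonneg (y - x₀)]
      simp only [indicator_of_mem hy, indicator_of_mem hmem]
      rw [e]
    · simp [hy]
  have h3 : ENNReal.ofReal |q x| * volume (Metric.ball x₀ (ρ / 2)) ≤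
      ENNReal.ofReal (S * 2 ^ n) * I := by
    calc _ = ∫⁻ _ in Metric.ball x₀ (ρ / 2), ENNReal.ofReal |q x| := by simp
      _ ≤ ∫⁻ y in Metric.ball x₀ (ρ / 2), ∑ m ∈ Finset.range (k + 1),
          ENNReal.ofReal |c m| * ENNReal.ofReal |q (y + (m * τ) • (x - y))| :=
        lintegral_mono h1
      _ = ∑ m ∈ Finset.range (k + 1), ENNReal.ofReal |c m| * ∫⁻ y in Metric.ball x₀ (ρ / 2),
          ENNReal.ofReal |q (y + (m * τ) • (x - y))| := by
        rw [lintegral_finsetSum]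
        · refine Finset.sum_congr rfl fun m _ => ?_
          rw [lintegral_const_mul]
          exact hqm.comp (by fun_prop)
        · intro m _
          exact (hqm.comp (by fun_prop)).const_mul _
      _ ≤ ∑ m ∈ Finset.range (k + 1), ENNReal.ofReal |c m| * (ENNReal.ofReal (2 ^ n) * I) :=
        Finset.sum_le_sum fun m hm => mul_le_mul_right (h2 m hm) _
      _ = _ := by
        rw [← Finset.sum_mul, ← ENNReal.ofReal_sum_of_nonneg fun _ _ => abs_nonneg _, ← mul_assoc,
          ENNReal.ofReal_mul hS0]
  rw [Measure.addHaar_ball_of_pos _ _ (by positivity), finrank_euclideanSpace, Fintype.card_fin,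
    ← ENNReal.ofReal_toReal hVtop, ← hV, ← ENNReal.ofReal_mul (by positivity),
    ← ENNReal.ofReal_mul (abs_nonneg _)] at h3
  have e : |q x| * ρ ^ n = |q x| * ((ρ / 2) ^ n * V) * (2 ^ n / V) := by
    rw [div_pow]; field_simp
  rw [e, ENNReal.ofReal_mul (by positivity)]
  refine (mul_le_mul_left h3 _).trans ?_
  rw [mul_right_comm, ← ENNReal.ofReal_mul (by positivity)]
  gcongr
  rw [mul_div_assoc]
  gcongr
  linarith

/-! ### Mollification -/

section Mollification

open scoped Convolution
open ContinuousLinearMap (lsmul)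

theorem two_le_infty : (2 : WithTop ℕ∞) ≤ ((⊤ : ℕ∞) : WithTop ℕ∞) :=
  WithTop.coe_le_coe.2 (le_top : (2 : ℕ∞) ≤ ⊤)

/-- The convolution `ρ * f`. -/
def mollify (ρ f : Sp n → ℝ) (x : Sp n) : ℝ := ∫ t, ρ t * f (x - t)

theorem mollify_eq_convolution (ρ f : Sp n → ℝ) : mollify ρ f = ρ ⋆[lsmul ℝ ℝ, volume] f := rfl

theorem mollify_eq_swap (ρ f : Sp n → ℝ) (x : Sp n) : mollify ρ f x = ∫ y, f y * ρ (x - y) := by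
  rw [mollify, ← integral_sub_left_eq_self _ volume x]
  simp [mul_comm]

theorem mollify_eq_convolution' (ρ f : Sp n → ℝ) : mollify ρ f = f ⋆[lsmul ℝ ℝ, volume] ρ := by
  ext x
  rw [mollify_eq_swap]
  rfl

/-- The derivative falls on the kernel, so only local integrability of `f` is needed; this also
covers functions cut off outside Ω. -/
theorem partialD_mollify {ρ f : Sp n → ℝ} (hρ : ContDiff ℝ 1 ρ) (hρc : HasCompactSupport ρ)
    (hf : LocallyIntegrable f) (i : Fin n) :
    partialD i (mollify ρ f) = mollify (partialD i ρ) f := by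
  ext x
  rw [partialD, mollify_eq_convolution', mollify_eq_convolution',
    (hρc.hasFDerivAt_convolution_right (lsmul ℝ ℝ) hf hρ x).fderiv,
    convolution_precompR_apply _ hf (hρc.fderiv ℝ) (hρ.continuous_fderiv one_ne_zero)]
  rfl

theorem hasCompactSupport_partialD {ρ : Sp n → ℝ} (hρc : HasCompactSupport ρ) (i : Fin n) :
    HasCompactSupport (partialD i ρ) :=
  hρc.fderiv_apply ℝ _

theorem contDiff_partialD {ρ : Sp n → ℝ} (hρ : ContDiff ℝ ∞ ρ) (i : Fin n) :
    ContDiff ℝ ∞ (partialD i ρ) :=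
  (hρ.fderiv_right (m := ∞) (by simp)).clm_apply contDiff_const

theorem hessian_mollify {ρ f : Sp n → ℝ} (hρ : ContDiff ℝ ∞ ρ) (hρc : HasCompactSupport ρ)
    (hf : LocallyIntegrable f) (x : Sp n) (i j : Fin n) :
    hessian (mollify ρ f) x i j = mollify (partialD j (partialD i ρ)) f x := by
  rw [hessian, Matrix.of_apply, partialD_mollify (hρ.of_le (by simp)) hρc hf,
    partialD_mollify ((contDiff_partialD hρ i).of_le (by simp))
      (hasCompactSupport_partialD hρc i) hf]

theorem contDiff_mollify {ρ f : Sp n → ℝ} (hρ : ContDiff ℝ ∞ ρ) (hρc : HasCompactSupport ρ)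
    (hf : LocallyIntegrable f) : ContDiff ℝ ∞ (mollify ρ f) := by
  rw [mollify_eq_convolution']
  exact hρc.contDiff_convolution_right (lsmul ℝ ℝ) hf hρ

theorem partialD_comm {ρ : Sp n → ℝ} (hρ : ContDiff ℝ ∞ ρ) (i j : Fin n) :
    partialD j (partialD i ρ) = partialD i (partialD j ρ) := by
  have h1 : Differentiable ℝ (fderiv ℝ ρ) :=
    (hρ.fderiv_right (m := 1) (WithTop.coe_le_coe.2 (le_top :
      (1 + 1 : ℕ∞) ≤ ⊤))).differentiable one_ne_zero
  have h2 : ∀ (i j : Fin n) x, partialD j (partialD i ρ) x =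
      fderiv ℝ (fderiv ℝ ρ) x (EuclideanSpace.single j 1) (EuclideanSpace.single i 1) := by
    intro i j x
    have := (h1 x).hasFDerivAt.clm_apply (hasFDerivAt_const (EuclideanSpace.single i 1 : Sp n) x)
    rw [partialD]
    change fderiv ℝ (fun y => fderiv ℝ ρ y (EuclideanSpace.single i 1)) x _ = _
    rw [this.fderiv]
    simp
  ext x
  rw [h2, h2]
  exact (hρ.contDiffAt.isSymmSndFDerivAt (by simpa using two_le_infty)).eq _ _

/-- The kernel is the density of a probability measure. Monotonicity of the Lᵖ norms for that
measure bounds the p-th power of the mollification by the mollified p-th power, and Tonelli with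
translation invariance concludes. -/
theorem eLpNorm_mollify_le (φ : ContDiffBump (0 : Sp n)) {f : Sp n → ℝ} {p : ℕ} (hp : 1 ≤ p)
    (hf : AEStronglyMeasurable f) :
    eLpNorm (mollify (φ.normed volume) f) p ≤ eLpNorm f p := by
  set ρ := φ.normed volume with hρ
  have hρc : Continuous ρ := φ.continuous_normed
  have hρ1 : ∫⁻ t, ENNReal.ofReal (ρ t) = 1 := by
    rw [← ofReal_integral_eq_lintegral_ofReal φ.integrable_normed
      (ae_of_all _ φ.nonneg_normed), φ.integral_normed, ENNReal.ofReal_one]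
  have hρm : Measurable fun t => ENNReal.ofReal (ρ t) := by
    have := hρc.measurable
    fun_prop
  set ν := volume.withDensity fun t => ENNReal.ofReal (ρ t) with hν
  have : IsProbabilityMeasure ν := ⟨by simp [hν, hρ1]⟩
  have hmeas : AEMeasurable (fun z : Sp n × Sp n => ‖f (z.1 - z.2)‖ₑ)
      (volume.prod volume) := by
    have h1 : Measure.QuasiMeasurePreserving (fun z : Sp n × Sp n => z.1 - z.2)
        (volume.prod volume) volume := quasiMeasurePreserving_sub _ _
    exact (hf.comp_quasiMeasurePreserving h1).enorm
  have hsl : ∀ x, AEStronglyMeasurable (fun t => f (x - t)) volume := fun x =>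
    hf.comp_quasiMeasurePreserving (quasiMeasurePreserving_sub_left volume x)
  have hpt : ∀ x, ‖mollify ρ f x‖ₑ ^ p ≤ ∫⁻ t, ENNReal.ofReal (ρ t) * ‖f (x - t)‖ₑ ^ p := by
    intro x
    have hslν : AEStronglyMeasurable (fun t => f (x - t)) ν :=
      (hsl x).mono_ac (withDensity_absolutelyContinuous _ _)
    have h1 : ‖mollify ρ f x‖ₑ ≤ ∫⁻ t, ‖f (x - t)‖ₑ ∂ν := by
      refine (enorm_integral_le_lintegral_enorm _).trans (le_of_eq ?_)
      rw [hν, lintegral_withDensity_eq_lintegral_mul₀ hρm.aemeasurable (hsl x).enorm]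
      refine lintegral_congr fun t => ?_
      rw [enorm_mul, Real.enorm_eq_ofReal (φ.nonneg_normed t)]
      rfl
    have h2 := eLpNorm_le_eLpNorm_of_exponent_le (μ := ν) (p := 1) (q := p)
      (by exact_mod_cast hp) hslν
    rw [eLpNorm_one_eq_lintegral_enorm, eLpNorm_eq_lintegral_rpow_enorm_toReal (by positivity)
      (by simp)] at h2
    have h3 := pow_le_pow_left' (h1.trans h2) p
    rw [one_div, ENNReal.toReal_natCast, ENNReal.rpow_inv_natCast_pow (n := p) (by omega)] at h3
    refine h3.trans (le_of_eq ?_)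
    rw [hν, lintegral_withDensity_eq_lintegral_mul₀ hρm.aemeasurable
      ((hsl x).enorm.pow_const _)]
    simp
  rw [eLpNorm_eq_lintegral_rpow_enorm_toReal (by positivity) (by simp),
    eLpNorm_eq_lintegral_rpow_enorm_toReal (by positivity) (by simp)]
  gcongr ?_ ^ _
  simp only [ENNReal.toReal_natCast, ENNReal.rpow_natCast]
  calc _ ≤ ∫⁻ x, ∫⁻ t, ENNReal.ofReal (ρ t) * ‖f (x - t)‖ₑ ^ p := lintegral_mono hpt
    _ = ∫⁻ t, ∫⁻ x, ENNReal.ofReal (ρ t) * ‖f (x - t)‖ₑ ^ p := by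
      refine lintegral_lintegral_swap ?_
      exact (hρm.comp measurable_snd).aemeasurable.mul (hmeas.pow_const p)
    _ = ∫⁻ t, ENNReal.ofReal (ρ t) * ∫⁻ x, ‖f x‖ₑ ^ p := by
      refine lintegral_congr fun t => ?_
      rw [lintegral_const_mul' _ _ ENNReal.ofReal_ne_top]
      congr 1
      exact lintegral_sub_right_eq_self (fun x => ‖f x‖ₑ ^ p) t
    _ = _ := by rw [lintegral_mul_const _ hρm, hρ1, one_mul]

theorem mollify_sub {ρ f g : Sp n → ℝ} (hρ : Continuous ρ) (hρc : HasCompactSupport ρ)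
    (hf : LocallyIntegrable f) (hg : LocallyIntegrable g) :
    mollify ρ (f - g) = mollify ρ f - mollify ρ g := by
  ext x
  have h1 := hρc.convolutionExists_left (lsmul ℝ ℝ) hρ hf x
  have h2 := hρc.convolutionExists_left (lsmul ℝ ℝ) hρ hg x
  have := integral_sub h1 h2
  simpa [mollify, mul_sub] using this

/-- Density of compactly supported continuous functions and the contraction property of
mollification. For such a function the convergence is uniform, and the finite measure of `K`
converts this to Lᵖ. One radius serves all smaller bumps, so that finitely many functions can later
be mollified with the same kernel. -/
theorem exists_eLpNorm_mollify_sub_le {f : Sp n → ℝ} {p : ℕ} (hp : 1 ≤ p) (hf : MemLp f p)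
    {K : Set (Sp n)} (hK : volume K ≠ ⊤) {ε : ℝ≥0∞} (hε : ε ≠ 0) :
    ∃ r > 0, ∀ φ : ContDiffBump (0 : Sp n), φ.rOut ≤ r →
      eLpNorm (mollify (φ.normed volume) f - f) p (volume.restrict K) ≤ ε := by
  have hp1 : (1 : ℝ≥0∞) ≤ p := by exact_mod_cast hp
  have hε3 : ε / 3 ≠ 0 := (ENNReal.div_pos hε (by simp)).ne'
  obtain ⟨g, hgc, hfg, hgcont, hgp⟩ := hf.exists_hasCompactSupport_eLpNorm_sub_le (by simp) hε3
  obtain ⟨δ, hδ, hδ'⟩ : ∃ δ : ℝ, 0 < δ ∧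
      ENNReal.ofReal δ * volume K ^ (1 / (p : ℝ)) ≤ ε / 3 := by
    have hV : volume K ^ (1 / (p : ℝ)) ≠ ⊤ := ENNReal.rpow_ne_top_of_nonneg (by positivity) hK
    obtain ⟨δ, hδ, h⟩ := ENNReal.exists_nnreal_pos_mul_lt hV hε3
    exact ⟨δ, by exact_mod_cast hδ, by simpa using h.le⟩
  obtain ⟨r, hr, hgr⟩ := Metric.uniformContinuous_iff.1
    (hgc.uniformContinuous_of_continuous hgcont) δ hδ
  refine ⟨r, hr, fun φ hφ => ?_⟩
  have hfl := hf.locallyIntegrable hp1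
  have hgl := hgp.locallyIntegrable hp1
  have e : mollify (φ.normed volume) f - f = mollify (φ.normed volume) (f - g) +
      ((mollify (φ.normed volume) g - g) + (g - f)) := by
    rw [mollify_sub φ.continuous_normed φ.hasCompactSupport_normed hfl hgl]
    ring
  have hm : ∀ {h : Sp n → ℝ}, LocallyIntegrable h →
      AEStronglyMeasurable (mollify (φ.normed volume) h) (volume.restrict K) := fun hh =>
    (contDiff_mollify φ.contDiff_normed φ.hasCompactSupport_normed
      hh).continuous.aestronglyMeasurable
  have h1 : eLpNorm (mollify (φ.normed volume) (f - g)) p (volume.restrict K) ≤ ε / 3 :=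
    (eLpNorm_restrict_le _ _ _ _).trans
      ((eLpNorm_mollify_le φ hp (hf.1.sub hgp.1)).trans hfg)
  have h2 : eLpNorm (g - f) p (volume.restrict K) ≤ ε / 3 := by
    rw [eLpNorm_sub_comm]
    exact (eLpNorm_restrict_le _ _ _ _).trans hfg
  have h3 : eLpNorm (mollify (φ.normed volume) g - g) p (volume.restrict K) ≤ ε / 3 := by
    refine (eLpNorm_le_of_ae_bound (C := δ) (ae_of_all _ fun x => ?_)).trans ?_
    · rw [Pi.sub_apply, ← dist_eq_norm, mollify_eq_convolution]
      refine ContDiffBump.dist_normed_convolution_le hgcont.aestronglyMeasurable fun y hy => ?_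
      exact (hgr (lt_of_lt_of_le hy hφ)).le
    · simpa [mul_comm] using hδ'
  rw [e]
  refine (eLpNorm_add_le (hm (hfl.sub hgl)) ((hm hgl).sub hgcont.aestronglyMeasurable |>.add
    (hgcont.aestronglyMeasurable.sub hf.1.restrict)) hp1).trans ?_
  refine (add_le_add h1 ((eLpNorm_add_le ((hm hgl).sub hgcont.aestronglyMeasurable)
    (hgcont.aestronglyMeasurable.sub hf.1.restrict) hp1).trans (add_le_add h3 h2))).trans ?_
  rw [← add_assoc, ENNReal.add_thirds]

theorem frobenius_le_sum (H : Matrix (Fin n) (Fin n) ℝ) : frobenius H ≤ ∑ i, ∑ j, |H i j| := by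
  rw [frobenius]
  apply Real.sqrt_le_iff.2 ⟨by positivity, ?_⟩
  rw [← Finset.sum_product' Finset.univ Finset.univ (fun i j => H i j ^ 2),
    ← Finset.sum_product' Finset.univ Finset.univ (fun i j => |H i j|)]
  simp_rw [← sq_abs (H _ _)]
  exact Finset.sum_sq_le_sq_sum_of_nonneg fun _ _ => abs_nonneg _

theorem IsW2.integral_mul_partialD_partialD {Ω : Set (Sp n)} {p : ℝ≥0∞} {u : Sp n → ℝ}
    {G : Sp n → Sp n} {H : Sp n → Matrix (Fin n) (Fin n) ℝ} (hu : IsW2 Ω p u G H)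
    {φ : Sp n → ℝ} (hφ : ContDiff ℝ ∞ φ) (hc : HasCompactSupport φ) (hs : tsupport φ ⊆ Ω)
    (i j : Fin n) :
    ∫ x in Ω, u x * partialD i (partialD j φ) x = ∫ x in Ω, H x i j * φ x := by
  have h1 := (hu.weakGrad i).2.2 (partialD j φ) (contDiff_partialD hφ j)
    (hasCompactSupport_partialD hc j) ((tsupport_fderiv_apply_subset ℝ _).trans hs)
  have h2 := (hu.weakHess i j).2.2 φ hφ hc hs
  rw [neg_eq_iff_eq_neg.symm] at h2
  exact h1.trans h2

theorem partialD_comp_sub_left (ρ : Sp n → ℝ) (x : Sp n) (i : Fin n) (hρ : Differentiable ℝ ρ) :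
    partialD i (fun y => ρ (x - y)) = fun y => -partialD i ρ (x - y) := by
  ext y
  have h1 : HasFDerivAt (fun y : Sp n => x - y) (-ContinuousLinearMap.id ℝ (Sp n)) y :=
    (hasFDerivAt_id y).const_sub x
  have h2 := (hρ (x - y)).hasFDerivAt.comp y h1
  rw [partialD]
  change fderiv ℝ (ρ ∘ fun y => x - y) y _ = _
  rw [h2.fderiv]
  simp [partialD]

/-- The reflected kernel y ↦ ρ(x - y) is supported in Ω when its ball around x is, so it is an
admissible test function for the weak derivatives. The two reflections of sign cancel; the order of
differentiation is adjusted by symmetry of second derivatives. -/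
theorem IsW2.hessian_mollify {Ω : Set (Sp n)} (hΩ : IsOpen Ω) {p : ℝ≥0∞} {u : Sp n → ℝ}
    {G : Sp n → Sp n} {H : Sp n → Matrix (Fin n) (Fin n) ℝ} (hu : IsW2 Ω p u G H)
    (hi : LocallyIntegrable (Ω.indicator u))
    {φ : ContDiffBump (0 : Sp n)} {x : Sp n} (hx : Metric.closedBall x φ.rOut ⊆ Ω) (i j : Fin n) :
    hessian (mollify (φ.normed volume) (Ω.indicator u)) x i j =
      mollify (φ.normed volume) (Ω.indicator fun x => H x i j) x := by
  set ρ := φ.normed volume with hρ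
  have hρs : ContDiff ℝ ∞ ρ := φ.contDiff_normed
  have hρc : HasCompactSupport ρ := φ.hasCompactSupport_normed
  rw [NonconformingFEM.hessian_mollify hρs hρc hi, mollify_eq_swap, mollify_eq_swap]
  have hts : tsupport (fun y => ρ (x - y)) ⊆ Metric.closedBall x φ.rOut := by
    refine closure_minimal (fun y hy => ?_) Metric.isClosed_closedBall
    have : x - y ∈ Function.support ρ := hy
    rw [hρ, φ.support_normed_eq, mem_ball_zero_iff] at this
    rw [mem_closedBall_iff_norm, norm_sub_rev]
    exact this.le
  have hcs : HasCompactSupport fun y => ρ (x - y) :=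
    (isCompact_closedBall x φ.rOut).of_isClosed_subset (isClosed_tsupport _) hts
  have hsm : ContDiff ℝ ∞ fun y => ρ (x - y) := hρs.comp (contDiff_const.sub contDiff_id)
  have key := hu.integral_mul_partialD_partialD hsm hcs (hts.trans hx) i j
  have e : partialD i (partialD j fun y => ρ (x - y)) =
      fun y => partialD j (partialD i ρ) (x - y) := by
    rw [partialD_comp_sub_left ρ x j (hρs.differentiable (by simp))]
    have h1 : partialD i (fun y => -partialD j ρ (x - y)) =
        fun y => -partialD i (fun y => partialD j ρ (x - y)) y := by
      ext y
      simp [partialD]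
    rw [h1, partialD_comp_sub_left _ x i ((contDiff_partialD hρs j).differentiable (by simp)),
      partialD_comm hρs i j]
    simp
  rw [e] at key
  have h3 : ∀ f g : Sp n → ℝ, ∫ y, Ω.indicator f y * g y = ∫ y in Ω, f y * g y := fun f g => by
    rw [← integral_indicator hΩ.measurableSet]
    congr 1
    ext y
    rw [indicator_mul_left]
  rw [h3, h3]
  exact key

/-- Approximation by smooth functions, uniformly and in the Hessian seminorm, on compact subsets. -/
theorem IsW2.exists_contDiff_approx {Ω : Set (Sp n)} (hn : 1 ≤ n) (hΩ : IsOpen Ω)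
    (hΩb : Bornology.IsBounded Ω) {u : Sp n → ℝ} (huc : ContinuousOn u (closure Ω))
    {G : Sp n → Sp n} {H : Sp n → Matrix (Fin n) (Fin n) ℝ} (hu : IsW2 Ω n u G H)
    {K : Set (Sp n)} (hK : IsCompact K) (hKΩ : K ⊆ Ω) {δ : ℝ} (hδ : 0 < δ) :
    ∃ ψ : Sp n → ℝ, ContDiff ℝ 2 ψ ∧ (∀ x ∈ K, |ψ x - u x| ≤ δ) ∧
      eLpNorm (fun x => frobenius (hessian ψ x - H x)) n (volume.restrict K) ≤
        ENNReal.ofReal δ := by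
  have hΩm := hΩ.measurableSet
  have hcl : IsCompact (closure Ω) := hΩb.isCompact_closure
  have hi : Integrable (Ω.indicator u) :=
    ((huc.integrableOn_compact hcl).mono_set subset_closure).integrable_indicator hΩm
  have hH : ∀ i j, MemLp (Ω.indicator fun x => H x i j) n := fun i j =>
    (memLp_indicator_iff_restrict hΩm).2 (hu.memLp_hess i j)
  obtain ⟨η, hη, hηK⟩ := hK.exists_cthickening_subset_open hΩ hKΩ
  obtain ⟨r, hr, hur⟩ := Metric.uniformContinuousOn_iff.1
    (hcl.uniformContinuousOn_of_continuous huc) δ hδ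
  have hε : ENNReal.ofReal (δ / n ^ 2) ≠ 0 := by
    have : (0 : ℝ) < n := by exact_mod_cast hn
    exact (ENNReal.ofReal_pos.2 (by positivity)).ne'
  have hev : ∀ i j, ∀ᶠ s in 𝓝[>] (0 : ℝ), ∀ φ : ContDiffBump (0 : Sp n), φ.rOut ≤ s →
      eLpNorm (mollify (φ.normed volume) (Ω.indicator fun x => H x i j) -
        Ω.indicator fun x => H x i j) n (volume.restrict K) ≤ ENNReal.ofReal (δ / n ^ 2) := by
    intro i j
    obtain ⟨s, hs, h⟩ := exists_eLpNorm_mollify_sub_le hn (hH i j) hK.measure_lt_top.ne hε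
    filter_upwards [Ioo_mem_nhdsGT hs] with s' hs' φ hφ
    exact h φ (hφ.trans hs'.2.le)
  -- One radius is needed for all Hessian entries, for the uniform approximation, and for keeping
  -- the balls around `K` inside Ω.
  have hev2 := eventually_all.2 fun i => eventually_all.2 fun j => hev i j
  obtain ⟨s, ⟨hs, hs1⟩, hs2⟩ :=
    ((eventually_mem_set.2 (Ioo_mem_nhdsGT (lt_min hr hη))).and hev2).exists
  have hs0 : 0 < s := hs
  let φ : ContDiffBump (0 : Sp n) := ⟨s / 2, s, by linarith, by linarith⟩
  have hφ : φ.rOut = s := rfl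
  have hball : ∀ x ∈ K, Metric.closedBall x φ.rOut ⊆ Ω := fun x hx =>
    (Metric.closedBall_subset_cthickening hx _).trans
      ((Metric.cthickening_mono (hs1.le.trans (min_le_right _ _)) _).trans hηK)
  have hsm := contDiff_mollify (ρ := φ.normed volume) φ.contDiff_normed φ.hasCompactSupport_normed
    hi.locallyIntegrable
  refine ⟨mollify (φ.normed volume) (Ω.indicator u), hsm.of_le two_le_infty, fun x hx => ?_, ?_⟩
  · have h1 : Ω.indicator u x = u x := indicator_of_mem (hKΩ hx) u
    rw [← h1, ← Real.dist_eq, mollify_eq_convolution]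
    refine ContDiffBump.dist_normed_convolution_le hi.aestronglyMeasurable fun y hy => ?_
    have hyΩ : y ∈ Ω := hball x hx (Metric.ball_subset_closedBall hy)
    rw [indicator_of_mem hyΩ, h1]
    exact (hur y (subset_closure hyΩ) x (subset_closure (hKΩ hx))
      (lt_of_lt_of_le hy (hs1.le.trans (min_le_left _ _)))).le
  · have hmeas : ∀ i j, AEStronglyMeasurable (fun x => |(mollify (φ.normed volume)
        (Ω.indicator fun x => H x i j) - Ω.indicator fun x => H x i j) x|)
        (volume.restrict K) := fun i j => by
      have h1 := (contDiff_mollify (ρ := φ.normed volume) φ.contDiff_normed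
        φ.hasCompactSupport_normed ((hH i j).locallyIntegrable
          (by exact_mod_cast hn))).continuous.aestronglyMeasurable
        (μ := volume.restrict K)
      exact (h1.sub (hH i j).1.restrict).norm
    have h1 : ∀ᵐ x ∂(volume.restrict K), ‖frobenius (hessian (mollify (φ.normed volume)
        (Ω.indicator u)) x - H x)‖ ≤ (∑ i, ∑ j, fun x => |(mollify (φ.normed volume)
        (Ω.indicator fun x => H x i j) - Ω.indicator fun x => H x i j) x|) x := by
      filter_upwards [ae_restrict_mem hK.measurableSet] with x hx
      rw [Real.norm_of_nonneg (frobenius_nonneg _)]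
      refine (frobenius_le_sum _).trans (le_of_eq ?_)
      simp only [Finset.sum_apply]
      refine Finset.sum_congr rfl fun i _ => Finset.sum_congr rfl fun j _ => ?_
      rw [Matrix.sub_apply, hu.hessian_mollify hΩ hi.locallyIntegrable (hball x hx), Pi.sub_apply,
        indicator_of_mem (hKΩ hx)]
    refine (eLpNorm_mono_ae_real h1).trans ?_
    have hn1 : (1 : ℝ≥0∞) ≤ n := by exact_mod_cast hn
    refine (eLpNorm_sum_le (fun i _ => Finset.aestronglyMeasurable_sum _ fun j _ => hmeas i j)
      hn1).trans ?_
    calc _ ≤ ∑ _i : Fin n, ∑ _j : Fin n, ENNReal.ofReal (δ / n ^ 2) := by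
          refine Finset.sum_le_sum fun i _ => ?_
          refine (eLpNorm_sum_le (fun j _ => hmeas i j) hn1).trans ?_
          refine Finset.sum_le_sum fun j _ => ?_
          exact le_of_eq_of_le (eLpNorm_norm (mollify (φ.normed volume)
            (Ω.indicator fun x => H x i j) - Ω.indicator fun x => H x i j)) (hs2 i j φ hφ.le)
      _ = _ := by
        have : (n : ℝ) ≠ 0 := by positivity
        simp only [Finset.sum_const, Finset.card_univ, Fintype.card_fin, nsmul_eq_mul]
        rw [← ENNReal.ofReal_natCast, ← ENNReal.ofReal_mul (by positivity),
          ← ENNReal.ofReal_mul (by positivity)]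
        congr 1
        field_simp

end Mollification

/-! ### Geometry of simplices -/

/-- The barycenter of a finite set of points. -/
def barycenter (F : Finset (Sp n)) : Sp n := (F.card : ℝ)⁻¹ • ∑ q ∈ F, q

theorem barycenter_mem_hull {F : Finset (Sp n)} (hF : F.Nonempty) : barycenter F ∈ hull F := by
  have h0 : (0 : ℝ) < F.card := by exact_mod_cast hF.card_pos
  rw [barycenter, Finset.smul_sum]
  refine (convex_convexHull ℝ _).sum_mem (fun _ _ => by positivity) ?_
    fun i hi => subset_convexHull ℝ _ hi
  simp [h0.ne']

/-- A nondegenerate `n`-simplex, given by its vertices. -/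
structure IsSimplex (T : Finset (Sp n)) : Prop where
  card : T.card = n + 1
  indep : AffineIndependent ℝ ((↑) : T → Sp n)

namespace IsSimplex

variable {T T' : Finset (Sp n)}

/-- The affine basis formed by the vertices of a nondegenerate simplex. -/
def basis (h : IsSimplex T) : AffineBasis T ℝ (Sp n) :=
  ⟨((↑) : T → Sp n), h.indep, by
    rw [h.indep.affineSpan_eq_top_iff_card_eq_finrank_add_one]
    simp [h.card]⟩

@[simp]
theorem basis_apply (h : IsSimplex T) (p : T) : h.basis p = p := rfl

theorem mem_hull_iff (h : IsSimplex T) {x : Sp n} :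
    x ∈ hull T ↔ ∀ p, 0 ≤ h.basis.coord p x := by
  have := h.basis.convexHull_eq_nonneg_coord
  have e : range h.basis = (T : Set (Sp n)) := by
    ext x
    simp
  rw [e] at this
  rw [hull, this]
  rfl

theorem coord_le_one (h : IsSimplex T) {x : Sp n} (hx : x ∈ hull T) (p : T) :
    h.basis.coord p x ≤ 1 := by
  rw [← h.basis.sum_coord_apply_eq_one x]
  exact Finset.single_le_sum (f := fun q => h.basis.coord q x)
    (fun q _ => h.mem_hull_iff.1 hx q) (Finset.mem_univ p)

theorem coord_sub (h : IsSimplex T) (p : T) (x y : Sp n) :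
    h.basis.coord p x - h.basis.coord p y = (h.basis.coord p).linear (x - y) := by
  rw [← vsub_eq_sub x y, AffineMap.linearMap_vsub, vsub_eq_sub]

/-- Barycentric coordinates are Lipschitz continuous with the reciprocal of the inradius. -/
theorem abs_coord_sub_le (h : IsSimplex T) {x₀ : Sp n} {r : ℝ} (hr : 0 < r)
    (hball : Metric.closedBall x₀ r ⊆ hull T) (p : T) (x y : Sp n) :
    r * |h.basis.coord p x - h.basis.coord p y| ≤ ‖x - y‖ := by
  rw [coord_sub]
  set v := x - y with hv
  rcases eq_or_ne v 0 with h0 | h0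
  · simp [h0]
  have hv0 : 0 < ‖v‖ := norm_pos_iff.2 h0
  -- A step of length r from the centre of the ball, in the direction of v, stays in the simplex.
  -- There the coordinate has values in [0, 1], so its increment along the step is at most 1.
  have hmem : x₀ + (r / ‖v‖) • v ∈ hull T := by
    apply hball
    rw [mem_closedBall_iff_norm, add_sub_cancel_left, norm_smul,
      Real.norm_of_nonneg (by positivity)]
    field_simp
    rfl
  have hx₀ : x₀ ∈ hull T := hball (Metric.mem_closedBall_self hr.le)
  have e := h.coord_sub p (x₀ + (r / ‖v‖) • v) x₀
  rw [add_sub_cancel_left, map_smul, smul_eq_mul] at e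
  have h1 := h.mem_hull_iff.1 hmem p
  have h2 := h.mem_hull_iff.1 hx₀ p
  have h3 := h.coord_le_one hmem p
  have h4 := h.coord_le_one hx₀ p
  have h5 : |r / ‖v‖ * (h.basis.coord p).linear v| ≤ 1 := by
    rw [← e, abs_le]
    constructor <;> linarith
  rw [abs_mul, abs_of_pos (by positivity), div_mul_eq_mul_div, div_le_one hv0] at h5
  exact h5

/-- The coordinate of p drops from 1 at p to 0 at q and has Lipschitz constant 1/r. This makes the
diameter of a side comparable to that of the cell. -/
theorem le_norm_sub_of_ne (h : IsSimplex T) {x₀ : Sp n} {r : ℝ} (hr : 0 < r)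
    (hball : Metric.closedBall x₀ r ⊆ hull T) {p q : Sp n} (hp : p ∈ T) (hq : q ∈ T)
    (hpq : p ≠ q) : r ≤ ‖p - q‖ := by
  have h1 := h.abs_coord_sub_le hr hball ⟨p, hp⟩ p q
  have e1 : h.basis.coord ⟨p, hp⟩ p = 1 := h.basis.coord_apply_eq ⟨p, hp⟩
  have e2 : h.basis.coord ⟨p, hp⟩ q = 0 :=
    h.basis.coord_apply_ne (i := ⟨p, hp⟩) (j := ⟨q, hq⟩) (by simpa using hpq)
  simpa [e1, e2] using h1

/-- The value of an affine function that vanishes at all vertices but one. -/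
theorem eq_mul_coord (h : IsSimplex T) (f : Sp n →ᵃ[ℝ] ℝ) (a : T)
    (hf : ∀ p ∈ T, p ≠ a → f p = 0) (x : Sp n) : f x = f a * h.basis.coord a x := by
  have h1 := h.basis.affineCombination_coord_eq_self x
  have h2 := Finset.univ.map_affineCombination h.basis (fun i => h.basis.coord i x)
    (h.basis.sum_coord_apply_eq_one x) f
  rw [h1] at h2
  rw [h2, Finset.affineCombination_eq_linear_combination _ _ _ (h.basis.sum_coord_apply_eq_one x),
    Finset.sum_eq_single a]
  · exact mul_comm _ _
  · intro p _ hp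
    have : f p = 0 := hf p p.2 fun e => hp (Subtype.ext e)
    simp [this]
  · simp

/-- Near the barycenter of a side, membership in the simplex is decided by the barycentric
coordinate of the opposite vertex. -/
theorem mem_hull_of_coord_nonneg (hn : 1 ≤ n) (h : IsSimplex T) {x₀ : Sp n} {r : ℝ} (hr : 0 < r)
    (hball : Metric.closedBall x₀ r ⊆ hull T) {F : Finset (Sp n)} (hF : F ⊆ T) (hFc : F.card = n)
    {a : T} (ha : a.1 ∉ F) {x : Sp n}
    (hx : x ∈ Metric.closedBall (barycenter F) (r / n))
    (hxa : 0 ≤ h.basis.coord a x) : x ∈ hull T := by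
  rw [h.mem_hull_iff]
  intro p
  by_cases hp : p = a
  · rwa [hp]
  have hn0 : (0 : ℝ) < n := by exact_mod_cast hn
  have hTF : T = insert a.1 F := by
    classical
    refine (Finset.eq_of_subset_of_card_le (Finset.insert_subset a.2 hF) ?_).symm
    rw [Finset.card_insert_of_notMem ha, hFc, h.card]
  have hpF : p.1 ∈ F := by
    have : p.1 ∈ insert a.1 F := hTF ▸ p.2
    rw [Finset.mem_insert] at this
    exact this.resolve_left fun e => hp (Subtype.ext e)
  -- At the barycenter the coordinates of the vertices of F are 1/n. With Lipschitz constant 1/r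
  -- they remain nonnegative within distance r/n, so only the opposite vertex matters.
  have hcF : h.basis.coord p (barycenter F) = 1 / n := by
    have h0 := h.coord_sub p (barycenter F) p
    have e1 : h.basis.coord p p = 1 := h.basis.coord_apply_eq p
    have e2 : barycenter F - p = (1 / n : ℝ) • ∑ q ∈ F, (q - p : Sp n) := by
      rw [Finset.sum_sub_distrib, Finset.sum_const, barycenter, hFc, smul_sub,
        ← Nat.cast_smul_eq_nsmul ℝ, smul_smul]
      simp [hn0.ne']
    have e3 : ∀ q ∈ F, (h.basis.coord p).linear (q - p : Sp n) = if q = p then 0 else -1 := by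
      intro q hq
      split_ifs with hqp
      · simp [hqp]
      · rw [← coord_sub, e1]
        have : h.basis.coord p q = 0 :=
          h.basis.coord_apply_ne (i := p) (j := ⟨q, hF hq⟩) (by
            rw [Ne, Subtype.ext_iff]; exact fun e => hqp e.symm)
        rw [this]; ring
    rw [e2, map_smul, map_sum, Finset.sum_congr rfl e3, e1, Finset.sum_ite, Finset.sum_const_zero,
      Finset.sum_const, Finset.filter_ne' , Finset.card_erase_of_mem hpF, hFc] at h0
    rw [zero_add, nsmul_eq_mul, Nat.cast_sub hn, smul_eq_mul] at h0
    have : h.basis.coord p (barycenter F) =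
        1 + 1 / n * ((n - (1 : ℕ) : ℝ) * -1) := by linarith
    rw [this]
    field_simp
    push_cast
    ring
  have h1 := h.abs_coord_sub_le hr hball p x (barycenter F)
  rw [mem_closedBall_iff_norm] at hx
  have h2 : |h.basis.coord p x - h.basis.coord p (barycenter F)| ≤ 1 / n := by
    have h3 := h1.trans hx
    rw [div_eq_mul_one_div r] at h3
    exact le_of_mul_le_mul_left h3 hr
  rw [hcF, abs_le] at h2
  linarith [h2.1]

theorem exists_opposite (h : IsSimplex T) {F : Finset (Sp n)} (hF : F ⊆ T) (hFc : F.card = n) :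
    ∃ a : T, a.1 ∉ F ∧ ∀ p ∈ T, p ≠ a → p ∈ F := by
  classical
  have h1 : (T \ F).card = 1 := by
    rw [Finset.card_sdiff_of_subset hF, hFc, h.card]
    omega
  obtain ⟨a, ha⟩ := Finset.card_eq_one.1 h1
  have ha' : a ∈ T \ F := by simp [ha]
  rw [Finset.mem_sdiff] at ha'
  refine ⟨⟨a, ha'.1⟩, ha'.2, fun p hp hpa => ?_⟩
  by_contra hpF
  have : p ∈ T \ F := Finset.mem_sdiff.2 ⟨hp, hpF⟩
  rw [ha, Finset.mem_singleton] at this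
  exact hpa this

theorem coord_linear_ne_zero (hn : 1 ≤ n) (h : IsSimplex T) (p : T) :
    (h.basis.coord p).linear ≠ 0 := by
  intro h0
  have : 1 < T.card := by rw [h.card]; omega
  obtain ⟨q, hq, hqp⟩ := Finset.exists_mem_ne this p.1
  have h1 := h.coord_sub p p q
  have e1 : h.basis.coord p p = 1 := h.basis.coord_apply_eq p
  have e2 : h.basis.coord p q = 0 :=
    h.basis.coord_apply_ne (i := p) (j := ⟨q, hq⟩) (by
      rw [Ne, Subtype.ext_iff]; exact fun e => hqp e.symm)
  rw [e1, e2, h0] at h1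
  simp at h1

end IsSimplex

/-! ### Simplices with a common side -/

namespace IsSimplex

variable {T T' T'' F : Finset (Sp n)}

theorem coord_eq_zero_of_mem_hull (h : IsSimplex T) (hF : F ⊆ T) {a : T} (ha : a.1 ∉ F) {x : Sp n}
    (hx : x ∈ hull F) : h.basis.coord a x = 0 := by
  have hs : (F : Set (Sp n)) ⊆ {y | h.basis.coord a y = 0} := by
    intro q hq
    refine h.basis.coord_apply_ne (i := a) (j := ⟨q, hF hq⟩) ?_
    rw [Ne, Subtype.ext_iff]
    rintro e
    exact ha (e ▸ hq)
  have hconv : Convex ℝ {y | h.basis.coord a y = 0} :=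
    (convex_singleton (0 : ℝ)).affine_preimage (h.basis.coord a)
  exact convexHull_min hs hconv hx

/-- The linear part of a barycentric coordinate is a positive multiple of the inner product with a
unit vector. -/
theorem exists_unit_normal (hn : 1 ≤ n) (h : IsSimplex T) (a : T) {c : Sp n}
    (hc : h.basis.coord a c = 0) :
    ∃ (ν : Sp n) (m : ℝ), ‖ν‖ = 1 ∧ 0 < m ∧
      ∀ x, h.basis.coord a x = m * inner ℝ ν (x - c) := by
  set L := LinearMap.toContinuousLinearMap (h.basis.coord a).linear with hL
  set g := (InnerProductSpace.toDual ℝ (Sp n)).symm L with hg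
  have hLg : ∀ v, (h.basis.coord a).linear v = inner ℝ g v := fun v => by
    rw [hg, InnerProductSpace.toDual_symm_apply]
    rfl
  have hg0 : g ≠ 0 := by
    intro e
    apply h.coord_linear_ne_zero hn a
    ext v
    rw [hLg, e, inner_zero_left, LinearMap.zero_apply]
  have hgp : 0 < ‖g‖ := norm_pos_iff.2 hg0
  refine ⟨‖g‖⁻¹ • g, ‖g‖, ?_, hgp, fun x => ?_⟩
  · rw [norm_smul, norm_inv, norm_norm, inv_mul_cancel₀ hgp.ne']
  · have := h.coord_sub a x c
    rw [hc, sub_zero, hLg] at this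
    rw [this, real_inner_smul_left, mul_inv_cancel_left₀ hgp.ne']

/-- The coordinates of the two vertices opposite to F vanish on F, so they are proportional as
affine functions. The factor is negative, since otherwise the two simplices would overlap off F.
Hence the nonpositive side for T is the nonnegative side for T'. -/
theorem mem_hull_neighbour (hn : 1 ≤ n) (h : IsSimplex T) (h' : IsSimplex T')
    (hinter : hull T ∩ hull T' = hull F) {x₀ x₀' : Sp n} {r : ℝ} (hr : 0 < r)
    (hball : Metric.closedBall x₀ r ⊆ hull T) (hball' : Metric.closedBall x₀' r ⊆ hull T')
    (hF : F ⊆ T) (hF' : F ⊆ T') (hFc : F.card = n) {a : T} (ha : a.1 ∉ F) {x : Sp n}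
    (hx : x ∈ Metric.closedBall (barycenter F) (r / n)) (hxa : h.basis.coord a x ≤ 0) :
    x ∈ hull T' := by
  have hn0 : (0 : ℝ) < n := by exact_mod_cast hn
  obtain ⟨a', ha', -⟩ := h'.exists_opposite hF' hFc
  have hcF : barycenter F ∈ hull F := barycenter_mem_hull (Finset.card_pos.1 (by omega))
  have hTF : ∀ p ∈ T, p ≠ a.1 → p ∈ F := by
    obtain ⟨b, hb, hb'⟩ := h.exists_opposite hF hFc
    have : a.1 = b := by
      by_contra e
      exact ha (hb' a a.2 e)
    rwa [this]
  have hmul := h.eq_mul_coord (h'.basis.coord a') a fun p hp hpa =>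
    h'.coord_eq_zero_of_mem_hull hF' ha' (subset_convexHull ℝ _ (hTF p hp hpa))
  set f := h'.basis.coord a' with hf
  -- Otherwise the point reached from the barycenter by a step of length r/n into T would lie in
  -- both simplices, hence in hull F, where the coordinate is zero.
  have hfa : f a < 0 := by
    by_contra! hle
    have hne : f a ≠ 0 := by
      intro e
      have h1 := hmul a'
      have h2 : f a' = 1 := h'.basis.coord_apply_eq a'
      rw [e, zero_mul, h2] at h1
      exact one_ne_zero h1
    obtain ⟨ν, m, hν, hm, hν'⟩ :=
      h.exists_unit_normal hn a (h.coord_eq_zero_of_mem_hull hF ha hcF)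
    have hy : barycenter F + (r / n) • ν ∈ Metric.closedBall (barycenter F) (r / n) := by
      rw [mem_closedBall_iff_norm, add_sub_cancel_left, norm_smul, hν, mul_one,
        Real.norm_of_nonneg (by positivity)]
    have hpos : 0 < h.basis.coord a (barycenter F + (r / n) • ν) := by
      rw [hν', add_sub_cancel_left, real_inner_smul_right, real_inner_self_eq_norm_sq, hν]
      positivity
    have h1 := h.mem_hull_of_coord_nonneg hn hr hball hF hFc ha hy hpos.le
    have h2 : barycenter F + (r / n) • ν ∈ hull T' :=
      h'.mem_hull_of_coord_nonneg hn hr hball' hF' hFc ha' hy (by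
        rw [← hf, hmul]
        exact mul_nonneg hle hpos.le)
    have h3 : barycenter F + (r / n) • ν ∈ hull F := hinter ▸ ⟨h1, h2⟩
    exact hpos.ne' (h.coord_eq_zero_of_mem_hull hF ha h3)
  refine h'.mem_hull_of_coord_nonneg hn hr hball' hF' hFc ha' hx ?_
  rw [← hf, hmul]
  exact mul_nonneg_of_nonpos_of_nonpos hfa.le hxa

/-- Near the barycenter of a common side, two neighbouring simplices are half balls. -/
theorem exists_normal_of_neighbour (hn : 1 ≤ n) (h : IsSimplex T) (h' : IsSimplex T')
    (hinter : hull T ∩ hull T' = hull F) {x₀ x₀' : Sp n} {r : ℝ} (hr : 0 < r)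
    (hball : Metric.closedBall x₀ r ⊆ hull T) (hball' : Metric.closedBall x₀' r ⊆ hull T')
    (hF : F ⊆ T) (hF' : F ⊆ T') (hFc : F.card = n) :
    ∃ ν : Sp n, ‖ν‖ = 1 ∧ (∀ x ∈ hull F, inner ℝ ν (x - barycenter F) = 0) ∧
      (∀ x ∈ Metric.closedBall (barycenter F) (r / n), 0 ≤ inner ℝ ν (x - barycenter F) →
        x ∈ hull T) ∧
      ∀ x ∈ Metric.closedBall (barycenter F) (r / n), inner ℝ ν (x - barycenter F) ≤ 0 →
        x ∈ hull T' := by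
  obtain ⟨a, ha, -⟩ := h.exists_opposite hF hFc
  have hcF : barycenter F ∈ hull F := barycenter_mem_hull (Finset.card_pos.1 (by omega))
  obtain ⟨ν, m, hν, hm, hν'⟩ := h.exists_unit_normal hn a (h.coord_eq_zero_of_mem_hull hF ha hcF)
  refine ⟨ν, hν, fun x hx => ?_, fun x hx hxν => ?_, fun x hx hxν => ?_⟩
  · have := h.coord_eq_zero_of_mem_hull hF ha hx
    rw [hν'] at this
    exact (mul_eq_zero.1 this).resolve_left hm.ne'
  · refine h.mem_hull_of_coord_nonneg hn hr hball hF hFc ha hx ?_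
    rw [hν']
    positivity
  · refine h.mem_hull_neighbour hn h' hinter hr hball hball' hF hF' hFc ha hx ?_
    rw [hν']
    exact mul_nonpos_of_nonneg_of_nonpos hm.le hxν

/-- Nonempty interior means that the points of S span the whole space, which forces n + 1 of them.
-/
theorem interior_hull_nonempty_iff (h : IsSimplex T) {S : Finset (Sp n)} (hS : S ⊆ T) :
    (interior (hull S)).Nonempty ↔ S = T := by
  have hSi : AffineIndependent ℝ ((↑) : S → Sp n) :=
    h.indep.mono (s := (S : Set (Sp n))) (t := (T : Set (Sp n))) (by exact_mod_cast hS)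
  have h1 := hSi.affineSpan_eq_top_iff_card_eq_finrank_add_one
  rw [interior_convexHull_nonempty_iff_affineSpan_eq_top]
  have e : range ((↑) : S → Sp n) = (S : Set (Sp n)) := by simp
  rw [e] at h1
  rw [h1]
  simp only [Fintype.card_coe, finrank_euclideanSpace, Fintype.card_fin]
  constructor
  · intro hc
    exact Finset.eq_of_subset_of_card_le hS (by rw [hc, h.card])
  · rintro rfl
    exact h.card

/-- At most two cells of a triangulation share a side. -/
theorem eq_of_side_eq (hn : 1 ≤ n) (h : IsSimplex T) (h' : IsSimplex T') (h'' : IsSimplex T'')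
    (hinter' : hull T ∩ hull T' = hull F) (hinter'' : hull T ∩ hull T'' = hull F)
    (hinter : hull T' ∩ hull T'' = convexHull ℝ ((T' : Set (Sp n)) ∩ T''))
    {x₀ x₀' x₀'' : Sp n} {r : ℝ} (hr : 0 < r)
    (hball : Metric.closedBall x₀ r ⊆ hull T) (hball' : Metric.closedBall x₀' r ⊆ hull T')
    (hball'' : Metric.closedBall x₀'' r ⊆ hull T'')
    (hF : F ⊆ T) (hF' : F ⊆ T') (hF'' : F ⊆ T'') (hFc : F.card = n) : T' = T'' := by
  classical
  have hn0 : (0 : ℝ) < n := by exact_mod_cast hn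
  obtain ⟨a, ha, -⟩ := h.exists_opposite hF hFc
  have hcF : barycenter F ∈ hull F := barycenter_mem_hull (Finset.card_pos.1 (by omega))
  obtain ⟨ν, m, hν, hm, hν'⟩ := h.exists_unit_normal hn a (h.coord_eq_zero_of_mem_hull hF ha hcF)
  -- The half ball on the far side of F is open, nonempty and contained in both T' and T''. The
  -- common vertices of these two simplices thus span a set with interior, so they are all the
  -- vertices.
  set U := Metric.ball (barycenter F) (r / n) ∩ {x | h.basis.coord a x < 0} with hU
  have hUo : IsOpen U := Metric.isOpen_ball.inter
    (isOpen_lt (h.basis.coord a).continuous_of_finiteDimensional continuous_const)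
  have hUne : U.Nonempty := by
    refine ⟨barycenter F + (-(r / n / 2)) • ν, ?_, ?_⟩
    · rw [mem_ball_iff_norm, add_sub_cancel_left, norm_smul, hν, mul_one, norm_neg,
        Real.norm_of_nonneg (by positivity)]
      exact half_lt_self (by positivity)
    · rw [mem_ofPred_eq, hν', add_sub_cancel_left, real_inner_smul_right,
        real_inner_self_eq_norm_sq, hν]
      have : 0 < m * (r / n / 2) := by positivity
      nlinarith
  have hsub : U ⊆ hull (T' ∩ T'') := by
    intro x hx
    have hx1 := Metric.ball_subset_closedBall hx.1
    have h1 := h.mem_hull_neighbour hn h' hinter' hr hball hball' hF hF' hFc ha hx1 hx.2.le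
    have h2 := h.mem_hull_neighbour hn h'' hinter'' hr hball hball'' hF hF'' hFc ha hx1 hx.2.le
    have h3 := hinter.subset ⟨h1, h2⟩
    rwa [hull, Finset.coe_inter]
  have hne : (interior (hull (T' ∩ T''))).Nonempty :=
    hUne.mono (interior_maximal hsub hUo)
  rw [← (h'.interior_hull_nonempty_iff Finset.inter_subset_left).1 hne]
  exact (h''.interior_hull_nonempty_iff Finset.inter_subset_right).1 hne

theorem isCompact_hull (T : Finset (Sp n)) : IsCompact (hull T) :=
  T.finite_toSet.isCompact_convexHull ℝ

theorem norm_sub_le_diam {x y : Sp n} (hx : x ∈ hull T) (hy : y ∈ hull T) : ‖x - y‖ ≤ diam T := by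
  rw [← dist_eq_norm]
  exact Metric.dist_le_diam_of_mem (isCompact_hull T).isBounded hx hy

end IsSimplex

/-- The surface measure of a side is bounded by a power of its diameter. -/
theorem exists_euclideanHausdorffMeasure_hull_le (d : ℕ) : ∃ C : ℝ, 0 < C ∧
    ∀ (n : ℕ) (F : Finset (Sp n)), AffineIndependent ℝ ((↑) : F → Sp n) → F.card = d + 1 →
      Measure.euclideanHausdorffMeasure d (hull F) ≤ ENNReal.ofReal (C * diam F ^ d) := by
  have hVtop : volume (Metric.closedBall (0 : Sp d) 1) ≠ ⊤ := measure_closedBall_lt_top.ne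
  set V := (volume (Metric.closedBall (0 : Sp d) 1)).toReal with hV
  have hV0 : 0 < V := ENNReal.toReal_pos
    (Metric.measure_closedBall_pos _ _ one_pos).ne' hVtop
  refine ⟨V, hV0, fun n F hi hc => ?_⟩
  obtain ⟨p, hp⟩ : F.Nonempty := Finset.card_pos.1 (by omega)
  set S := vectorSpan ℝ (F : Set (Sp n)) with hS
  have hfr : Module.finrank ℝ S = d := by
    have := hi.finrank_vectorSpan (n := d) (by simpa using hc)
    have e : range ((↑) : F → Sp n) = (F : Set (Sp n)) := by simp
    rwa [e] at this
  -- An isometric parametrization of the affine span by `Sp d`, under which the normalized Hausdorff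
  -- measure is Lebesgue measure and the side lies in a ball with its diameter as radius.
  let e : Sp d ≃ₗᵢ[ℝ] S := ((stdOrthonormalBasis ℝ S).reindex (finCongr hfr)).repr.symm
  let f : Sp d → Sp n := fun y => p + (e y : Sp n)
  have hf : Isometry f := by
    refine Isometry.of_dist_eq fun x y => ?_
    simp only [f, dist_add_left]
    rw [← Subtype.dist_eq, e.dist_map]
  have hsub : hull F ⊆ f '' Metric.closedBall 0 (diam F) := by
    intro x hx
    have h1 : x - p ∈ S := by
      have h2 : x ∈ affineSpan ℝ (F : Set (Sp n)) := convexHull_subset_affineSpan _ hx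
      have h3 : p ∈ affineSpan ℝ (F : Set (Sp n)) := subset_affineSpan ℝ _ hp
      have := AffineSubspace.vsub_mem_direction h2 h3
      rwa [direction_affineSpan] at this
    refine ⟨e.symm ⟨x - p, h1⟩, ?_, by simp [f]⟩
    rw [mem_closedBall_zero_iff, LinearIsometryEquiv.norm_map, Submodule.coe_norm]
    exact IsSimplex.norm_sub_le_diam hx (subset_convexHull ℝ _ hp)
  refine (measure_mono hsub).trans ?_
  have hd : 0 ≤ diam F := Metric.diam_nonneg
  rw [hf.euclideanHausdorffMeasure_image, EuclideanSpace.euclideanHausdorffMeasure_eq_volume,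
    Measure.addHaar_closedBall' _ _ hd, finrank_euclideanSpace, Fintype.card_fin,
    ← ENNReal.ofReal_toReal hVtop, ← hV, ← ENNReal.ofReal_mul (pow_nonneg hd _),
    mul_comm]

/-- A bounded Lipschitz domain is the interior of its closure. -/
theorem IsBoundedLipschitz.interior_closure {Ω : Set (Sp n)} (hΩ : IsBoundedLipschitz Ω) :
    interior (closure Ω) = Ω := by
  refine Subset.antisymm (fun x hx => ?_) (interior_maximal subset_closure hΩ.isOpen)
  by_contra hxΩ
  have hfr : x ∈ frontier Ω := by
    rw [hΩ.isOpen.frontier_eq]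
    exact ⟨interior_subset hx, hxΩ⟩
  obtain ⟨e, r, K, φ, he, hr, hφ, hgraph⟩ := hΩ.graph x hfr
  have hval : inner ℝ e x ≤ φ (x - inner ℝ e x • e) :=
    not_lt.1 fun h => hxΩ ((hgraph x (Metric.mem_ball_self hr)).2 h)
  obtain ⟨s, hs, hsx⟩ := Metric.isOpen_iff.1 isOpen_interior x hx
  set t := min r s / 2 with ht
  have ht0 : 0 < t := by positivity
  have htr : t < r := (half_lt_self (by positivity)).trans_le (min_le_left _ _)
  have hts : t < s := (half_lt_self (by positivity)).trans_le (min_le_right _ _)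
  -- A boundary point lies on or below the graph, so y lies strictly below it. A neighbourhood of y
  -- then misses Ω, although y would belong to its closure.
  set y := x - t • e with hy
  have hyx : dist y x = t := by
    rw [dist_eq_norm, hy, sub_sub_cancel_left, norm_neg, norm_smul, he, mul_one,
      Real.norm_of_nonneg ht0.le]
  have hey : inner ℝ e y = inner ℝ e x - t := by
    rw [hy, inner_sub_right, real_inner_smul_right, real_inner_self_eq_norm_sq, he]
    ring
  have hproj : y - (inner ℝ e y : ℝ) • e = x - (inner ℝ e x : ℝ) • e := by
    rw [hey, hy]
    module
  have hcl : y ∈ closure Ω := interior_subset (hsx (by rw [Metric.mem_ball, hyx]; exact hts))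
  set U := {z | inner ℝ e z < φ (z - (inner ℝ e z : ℝ) • e)} ∩ Metric.ball x r with hU
  have hφc := hφ.continuous
  have hUo : IsOpen U := (isOpen_lt (by fun_prop) (by fun_prop)).inter Metric.isOpen_ball
  have hyU : y ∈ U := by
    refine ⟨?_, by rw [Metric.mem_ball, hyx]; exact htr⟩
    rw [mem_ofPred_eq, hproj, hey]
    linarith
  obtain ⟨z, hzU, hzΩ⟩ := mem_closure_iff.1 hcl U hUo hyU
  have := (hgraph z hzU.2).1 hzΩ
  exact lt_asymm this hzU.1

/-! ### The maximum norm of functions orthogonal to affine functions -/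

theorem lintegral_ofReal_pow_le {μ : Measure (Sp n)} {g : Sp n → ℝ} (hg : ∀ x, 0 ≤ g x) {p : ℕ}
    (hp : 1 ≤ p) {E : ℝ} (h : eLpNorm g p μ ≤ ENNReal.ofReal E) :
    ∫⁻ x, ENNReal.ofReal (g x) ^ p ∂μ ≤ ENNReal.ofReal E ^ p := by
  have hp0 : p ≠ 0 := by omega
  rw [eLpNorm_eq_lintegral_rpow_enorm_toReal (by exact_mod_cast hp0) (by simp)] at h
  have h2 := pow_le_pow_left' h p
  rw [one_div, ENNReal.toReal_natCast, ENNReal.rpow_inv_natCast_pow (n := p) hp0] at h2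
  refine le_trans (le_of_eq ?_) h2
  refine lintegral_congr fun x => ?_
  rw [Real.enorm_eq_ofReal (hg x), ENNReal.rpow_natCast]

theorem frobenius_eq_norm (H : Matrix (Fin n) (Fin n) ℝ) :
    frobenius H = ‖(WithLp.toLp 2 fun z : Fin n × Fin n => H z.1 z.2 :
      EuclideanSpace ℝ (Fin n × Fin n))‖ := by
  rw [EuclideanSpace.norm_eq, frobenius]
  simp [Fintype.sum_prod_type]

theorem frobenius_add_le (A B : Matrix (Fin n) (Fin n) ℝ) :
    frobenius (A + B) ≤ frobenius A + frobenius B := by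
  simp only [frobenius_eq_norm]
  exact norm_add_le (WithLp.toLp 2 fun z : Fin n × Fin n => A z.1 z.2 :
      EuclideanSpace ℝ (Fin n × Fin n)) (WithLp.toLp 2 fun z : Fin n × Fin n => B z.1 z.2)

theorem exists_poly_eq_affine (a : ℝ) (l : Sp n →L[ℝ] ℝ) :
    ∃ q : MvPolynomial (Fin n) ℝ, q.totalDegree ≤ 1 ∧ ∀ x, value q x = a + l x := by
  refine ⟨MvPolynomial.C a + ∑ i, MvPolynomial.C (l (EuclideanSpace.single i 1)) *
    MvPolynomial.X i, ?_, fun x => ?_⟩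
  · refine (MvPolynomial.totalDegree_add _ _).trans (max_le (by simp) ?_)
    refine MvPolynomial.totalDegree_finsetSum_le fun i _ => ?_
    refine (MvPolynomial.totalDegree_mul _ _).trans ?_
    simp
  · conv_rhs => rw [← (EuclideanSpace.basisFun (Fin n) ℝ).sum_repr x]
    simp [value, mul_comm]

theorem aestronglyMeasurable_frobenius {μ : Measure (Sp n)}
    {H : Sp n → Matrix (Fin n) (Fin n) ℝ}
    (hH : ∀ i j, AEStronglyMeasurable (fun x => H x i j) μ) :
    AEStronglyMeasurable (fun x => frobenius (H x)) μ := by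
  unfold frobenius
  refine Real.continuous_sqrt.comp_aestronglyMeasurable ?_
  refine Finset.aestronglyMeasurable_fun_sum _ fun i _ =>
    Finset.aestronglyMeasurable_fun_sum _ fun j _ => (hH i j).pow 2

/-- Approximation of a `W^{2,n}` function by an affine function in the maximum norm. -/
theorem IsW2.exists_affine_abs_sub_le {n : ℕ} (hn : 1 ≤ n) : ∃ C : ℝ, 0 < C ∧
    ∀ {Ω : Set (Sp n)}, IsOpen Ω → Bornology.IsBounded Ω →
    ∀ {u : Sp n → ℝ}, ContinuousOn u (closure Ω) →
    ∀ {G : Sp n → Sp n} {H : Sp n → Matrix (Fin n) (Fin n) ℝ}, IsW2 Ω n u G H →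
    ∀ {K : Set (Sp n)}, Convex ℝ K → IsCompact K → interior K ⊆ Ω → K ⊆ closure Ω →
    ∀ {h : ℝ}, (∀ x ∈ K, ∀ y ∈ K, ‖x - y‖ ≤ h) →
    ∀ {x₀ : Sp n} {r : ℝ}, 0 < r → Metric.closedBall x₀ r ⊆ K →
    ∀ (p : MvPolynomial (Fin n) ℝ) {E : ℝ}, 0 ≤ E →
    eLpNorm (fun x => frobenius (H x - hess p x)) n (volume.restrict K) ≤ ENNReal.ofReal E →
    ∀ ε > 0, ∃ (a : ℝ) (l : Sp n →L[ℝ] ℝ), ∀ x ∈ K,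
      |u x - value p x - (a + l x)| ≤ C * (h ^ 2 / r) * E + ε := by
  have hn0 : (0 : ℝ) < n := by exact_mod_cast hn
  set β := volume.real (Metric.closedBall (0 : Sp n) 1) with hβ
  have hβtop : volume (Metric.closedBall (0 : Sp n) 1) ≠ ⊤ := measure_closedBall_lt_top.ne
  have hβ0 : 0 < β := ENNReal.toReal_pos
    (Metric.measure_closedBall_pos _ _ one_pos).ne' hβtop
  refine ⟨2 / β ^ (1 / (n : ℝ)), by positivity, ?_⟩
  intro Ω hΩ hΩb u huc G H hu K hK hKc hKΩ hKcl h hKh x₀ r hr hball p E hE hHE ε hε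
  have hx₀ : x₀ ∈ K := hball (Metric.mem_closedBall_self hr.le)
  have hx₀i : x₀ ∈ interior K :=
    interior_mono hball (by rw [interior_closedBall _ hr.ne']; exact Metric.mem_ball_self hr)
  have hh : 0 ≤ h := (norm_nonneg _).trans (hKh x₀ hx₀ x₀ hx₀)
  have hwc : ContinuousOn (fun x => u x - value p x) K :=
    (huc.mono hKcl).sub (continuous_value p).continuousOn
  obtain ⟨δ, hδ, hwδ⟩ := Metric.uniformContinuousOn_iff.1
    (hKc.uniformContinuousOn_of_continuous hwc) (ε / 2) (by positivity)
  -- The bound 1/2 keeps a ball of radius r/2 in the shrunken set; the other bound moves every point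
  -- by less than δ.
  set τ := min (1 / 2) (δ / (2 * (h + 1))) with hτ
  have hτ0 : 0 < τ := by positivity
  have hτ1 : τ ≤ 1 / 2 := min_le_left _ _
  have hτδ : τ * h < δ := by
    have h1 : τ ≤ δ / (2 * (h + 1)) := min_le_right _ _
    rw [le_div_iff₀ (by positivity)] at h1
    nlinarith
  set θ : Sp n →ᵃ[ℝ] Sp n := AffineMap.homothety x₀ (1 - τ) with hθ
  have hθx : ∀ x, θ x = x + τ • (x₀ - x) := fun x => by
    rw [hθ, AffineMap.homothety_apply, vsub_eq_sub, vadd_eq_add]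
    module
  have hθi : ∀ x ∈ K, θ x ∈ interior K := fun x hx => by
    rw [hθx]
    exact hK.add_smul_sub_mem_interior hx hx₀i ⟨hτ0, by linarith⟩
  set K' := θ '' K with hK'
  have hK'K : K' ⊆ interior K := by
    rintro _ ⟨x, hx, rfl⟩
    exact hθi x hx
  have hK'c : IsCompact K' := hKc.image θ.continuous_of_finiteDimensional
  have hball' : Metric.closedBall x₀ (r / 2) ⊆ K' := by
    intro y hy
    refine ⟨x₀ + (1 - τ)⁻¹ • (y - x₀), hball ?_, ?_⟩
    · rw [mem_closedBall_iff_norm] at hy ⊢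
      rw [add_sub_cancel_left, norm_smul, Real.norm_of_nonneg (by
        rw [inv_nonneg]; linarith), inv_mul_le_iff₀ (by linarith)]
      nlinarith
    · have : 1 - τ ≠ 0 := by linarith
      rw [hθ, AffineMap.homothety_apply, vsub_eq_sub, vadd_eq_add, add_sub_cancel_left, smul_smul,
        mul_inv_cancel₀ this, one_smul, sub_add_cancel]
  have hVβ : (r / 2) ^ n * β ≤ volume.real K' := by
    have h1 := measureReal_mono (μ := volume) hball' hK'c.measure_lt_top.ne
    rwa [measureReal_def, Measure.addHaar_closedBall' _ _ (by positivity), finrank_euclideanSpace,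
      Fintype.card_fin, ENNReal.toReal_mul, ENNReal.toReal_ofReal (by positivity)] at h1
  have hV0 : 0 < volume.real K' := lt_of_lt_of_le (by positivity) hVβ
  set S := 2 / β ^ (1 / (n : ℝ)) * (h ^ 2 / r) with hS
  have hS0 : 0 ≤ S := by positivity
  -- Mollification costs δ' in the values and Sδ' through the Hessian, together ε/2. The other ε/2
  -- pays for the shrinking.
  set δ' := ε / (2 * (S + 1)) with hδ'
  have hδ'0 : 0 < δ' := by positivity
  obtain ⟨ψ, hψ, hψu, hψH⟩ :=
    hu.exists_contDiff_approx hn hΩ hΩb huc hK'c (hK'K.trans hKΩ) hδ'0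
  have hn1 : (1 : ℝ≥0∞) ≤ n := by exact_mod_cast hn
  have hHm : ∀ i j, AEStronglyMeasurable (fun x => H x i j) (volume.restrict K') := fun i j =>
    (hu.memLp_hess i j).1.mono_measure (Measure.restrict_mono (hK'K.trans hKΩ) le_rfl)
  have hnorm : eLpNorm (fun x => frobenius (hessian (fun x => ψ x - value p x) x)) n
      (volume.restrict K') ≤ ENNReal.ofReal (E + δ') := by
    have hcψ := continuous_hessian hψ
    have hcp := continuous_hess p
    have hle : ∀ᵐ x ∂(volume.restrict K'),
        ‖frobenius (hessian (fun x => ψ x - value p x) x)‖ ≤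
        (fun x => frobenius (hessian ψ x - H x)) x + (fun x => frobenius (H x - hess p x)) x := by
      refine ae_of_all _ fun x => ?_
      rw [Real.norm_of_nonneg (frobenius_nonneg _),
        hessian_sub hψ ((contDiff_value p).of_le two_le_infty), hessian_value]
      refine le_trans (le_of_eq ?_) (frobenius_add_le _ _)
      congr 1
      abel
    refine (eLpNorm_mono_ae_real hle).trans ?_
    refine (eLpNorm_add_le (aestronglyMeasurable_frobenius fun i j => ?_)
      (aestronglyMeasurable_frobenius fun i j => ?_) hn1).trans ?_
    · exact (hcψ.matrix_elem i j).aestronglyMeasurable.sub (hHm i j)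
    · exact (hHm i j).sub (hcp.matrix_elem i j).aestronglyMeasurable
    · rw [add_comm E, ENNReal.ofReal_add hδ'0.le hE]
      refine add_le_add hψH (le_trans ?_ hHE)
      exact eLpNorm_mono_measure _ (Measure.restrict_mono (hK'K.trans interior_subset) le_rfl)
  obtain ⟨a, l, hal⟩ := NonconformingFEM.exists_affine_abs_sub_le hn (hK.affine_image θ) hK'c
    (fun x hx y hy => hKh x (interior_subset (hK'K hx)) y (interior_subset (hK'K hy))) hV0
    (hψ.sub ((contDiff_value p).of_le two_le_infty)) (by positivity : 0 ≤ E + δ')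
    (lintegral_ofReal_pow_le (fun x => frobenius_nonneg _) hn hnorm)
  -- The affine function found on the shrunken set is pulled back by the homothety θ.
  refine ⟨a + l (τ • x₀), (1 - τ) • l, fun x hx => ?_⟩
  have hxK' : θ x ∈ K' := mem_image_of_mem _ hx
  have e1 : a + l (τ • x₀) + ((1 - τ) • l) x = a + l (θ x) := by
    have : θ x = τ • x₀ + (1 - τ) • x := by rw [hθx]; module
    rw [this, map_add, map_smul l (1 - τ) x, smul_apply]
    ring
  rw [e1]
  have h1 : |(u x - value p x) - (u (θ x) - value p (θ x))| ≤ ε / 2 := by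
    rw [← Real.dist_eq]
    refine (hwδ x hx (θ x) (interior_subset (hθi x hx)) ?_).le
    rw [hθx, dist_eq_norm, sub_add_cancel_left, norm_neg, norm_smul,
      Real.norm_of_nonneg hτ0.le]
    exact lt_of_le_of_lt (mul_le_mul_of_nonneg_left (hKh x₀ hx₀ x hx) hτ0.le) hτδ
  have h2 := hψu (θ x) hxK'
  have h3 : |ψ (θ x) - value p (θ x) - (a + l (θ x))| ≤ S * (E + δ') := by
    have h4 := hal (θ x) hxK'
    rw [Real.rpow_sub hV0, Real.rpow_one, mul_div_assoc', le_div_iff₀ (by positivity)] at h4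
    have h5 : |ψ (θ x) - value p (θ x) - (a + l (θ x))| * volume.real K' ^ (1 / (n : ℝ)) ≤
        h ^ 2 * (E + δ') := by
      refine le_of_mul_le_mul_right ?_ hV0
      linarith
    have h6 : r / 2 * β ^ (1 / (n : ℝ)) ≤ volume.real K' ^ (1 / (n : ℝ)) := by
      refine le_trans (le_of_eq ?_) (Real.rpow_le_rpow (by positivity) hVβ (by positivity))
      rw [Real.mul_rpow (by positivity) hβ0.le, one_div,
        Real.pow_rpow_inv_natCast (by positivity) (by omega)]
    have h7 := (mul_le_mul_of_nonneg_left h6 (abs_nonneg _)).trans h5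
    rw [hS, div_mul_div_comm, div_mul_eq_mul_div, le_div_iff₀ (by positivity)]
    linarith
  have h8 : S * δ' + δ' = ε / 2 := by
    rw [hδ']
    field_simp
  rw [abs_le] at h1 h2 h3 ⊢
  constructor <;> nlinarith [h1.1, h1.2, h2.1, h2.2, h3.1, h3.2]

/-- The maximum norm of an error that is orthogonal to all affine functions is controlled by its
Hessian. -/
theorem IsW2.exists_abs_sub_le {n : ℕ} (hn : 1 ≤ n) (R : ℝ) : ∃ C : ℝ, 0 < C ∧
    ∀ {Ω : Set (Sp n)}, IsOpen Ω → Bornology.IsBounded Ω →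
    ∀ {u : Sp n → ℝ}, ContinuousOn u (closure Ω) →
    ∀ {G : Sp n → Sp n} {H : Sp n → Matrix (Fin n) (Fin n) ℝ}, IsW2 Ω n u G H →
    ∀ {K : Set (Sp n)}, Convex ℝ K → IsCompact K → interior K ⊆ Ω → K ⊆ closure Ω →
    ∀ {h : ℝ}, (∀ x ∈ K, ∀ y ∈ K, ‖x - y‖ ≤ h) →
    ∀ {x₀ : Sp n} {r : ℝ}, 0 < r → h ≤ R * r → Metric.closedBall x₀ r ⊆ K →
    ∀ (p : MvPolynomial (Fin n) ℝ) {E : ℝ}, 0 ≤ E →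
    eLpNorm (fun x => frobenius (H x - hess p x)) n (volume.restrict K) ≤ ENNReal.ofReal E →
    (∀ q : MvPolynomial (Fin n) ℝ, q.totalDegree ≤ 1 →
      ∫ x in K, (u x - value p x) * value q x = 0) →
    ∀ x ∈ K, |u x - value p x| ≤ C * h * E := by
  obtain ⟨C₁, hC₁, hA⟩ := IsW2.exists_affine_abs_sub_le hn
  obtain ⟨C₂, hC₂, hB⟩ := IsLinePoly.exists_abs_le n (1 + 1) R
  set β := volume.real (Metric.closedBall (0 : Sp n) 1) with hβ
  have hβ0 : 0 ≤ β := measureReal_nonneg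
  set C₃ := 1 + C₂ * β * |R| ^ n with hC₃
  have hC₃0 : 0 < C₃ := by positivity
  refine ⟨C₃ * C₁ * (|R| + 1), by positivity, ?_⟩
  intro Ω hΩ hΩb u huc G H hu K hK hKc hKΩ hKcl h hKh x₀ r hr hhr hball p E hE hHE horth x hx
  have hx₀ : x₀ ∈ K := hball (Metric.mem_closedBall_self hr.le)
  have hh : 0 ≤ h := (norm_nonneg _).trans (hKh x₀ hx₀ x₀ hx₀)
  have hhr' : h ≤ |R| * r := hhr.trans (mul_le_mul_of_nonneg_right (le_abs_self R) hr.le)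
  have key : ∀ ε > 0, |u x - value p x| ≤ C₃ * (C₁ * (h ^ 2 / r) * E + ε) := by
    intro ε hε
    obtain ⟨a, l, hal⟩ := hA hΩ hΩb huc hu hK hKc hKΩ hKcl hKh hr hball p hE hHE ε hε
    set η := C₁ * (h ^ 2 / r) * E + ε with hη
    have hη0 : 0 ≤ η := by positivity
    have hqc : Continuous fun y => a + l y := by fun_prop
    have hwc : ContinuousOn (fun x => u x - value p x) K :=
      (huc.mono hKcl).sub (continuous_value p).continuousOn
    obtain ⟨z, hz, hmax⟩ := hKc.exists_isMaxOn ⟨x₀, hx₀⟩ hqc.abs.continuousOn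
    set M := |a + l z| with hM
    have hmax' : ∀ y ∈ K, |a + l y| ≤ M := fun y hy => hmax hy
    have hM0 : 0 ≤ M := abs_nonneg _
    obtain ⟨q, hq1, hq⟩ := exists_poly_eq_affine a l
    have horth' : ∫ y in K, (u y - value p y) * (a + l y) = 0 := by
      simpa [hq] using horth q hq1
    have hint1 : IntegrableOn (fun y => (u y - value p y) * (a + l y)) K :=
      (hwc.mul hqc.continuousOn).integrableOn_compact hKc
    have hint2 : IntegrableOn (fun y => (a + l y) * (a + l y)) K :=
      (hqc.mul hqc).continuousOn.integrableOn_compact hKc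
    have hVK : volume.real K ≤ h ^ n * β := by
      have hsub : K ⊆ Metric.closedBall x₀ h := fun y hy => by
        rw [mem_closedBall_iff_norm]
        exact hKh y hy x₀ hx₀
      have h1 := measureReal_mono (μ := volume) hsub measure_closedBall_lt_top.ne
      rwa [measureReal_def (s := Metric.closedBall _ _), Measure.addHaar_closedBall' _ _ hh,
        finrank_euclideanSpace, Fintype.card_fin, ENNReal.toReal_mul,
        ENNReal.toReal_ofReal (by positivity)] at h1
    have hI : ∫ y in K, (a + l y) * (a + l y) ≤ η * M * (h ^ n * β) := by
      -- With w = u - p and q the affine approximation, orthogonality of w to q gives ∫q² = -∫(w -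
      -- q)q.
      have e : ∫ y in K, (a + l y) * (a + l y) =
          ∫ y in K, -((u y - value p y - (a + l y)) * (a + l y)) := by
        rw [← sub_zero (∫ y in K, (a + l y) * (a + l y)), ← horth', ← integral_sub hint2 hint1]
        congr 1
        ext y
        ring
      rw [e]
      have h2 := norm_setIntegral_le_of_norm_le_const (μ := volume) hKc.measure_lt_top (C := η * M)
        (f := fun y => -((u y - value p y - (a + l y)) * (a + l y))) fun y hy => by
          rw [norm_neg, norm_mul]
          exact mul_le_mul (hal y hy) (hmax' y hy) (abs_nonneg _) hη0
      exact (le_abs_self _).trans (h2.trans (mul_le_mul_of_nonneg_left hVK (by positivity)))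
    have hzr : z ∈ Metric.closedBall x₀ (R * r) := by
      rw [mem_closedBall_iff_norm]
      exact (hKh z hz x₀ hx₀).trans hhr
    -- The inverse estimate is applied to q², of degree 1 + 1, at the maximum point of |q|. It reads
    -- M²rⁿ ≤ C ∫q² ≤ CηM|K|, and division by M bounds M by η.
    have hlow := hB _ ((IsLinePoly.affine a l).mul (IsLinePoly.affine a l)) x₀ r hr z hzr
    have hJ : ∫⁻ y in Metric.ball x₀ r, ENNReal.ofReal |(a + l y) * (a + l y)| ≤
        ENNReal.ofReal (η * M * (h ^ n * β)) := by
      refine (lintegral_mono_set (Metric.ball_subset_closedBall.trans hball)).trans ?_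
      simp_rw [abs_mul_self]
      rw [← ofReal_integral_eq_lintegral_ofReal hint2 (ae_of_all _ fun y => mul_self_nonneg _)]
      exact ENNReal.ofReal_le_ofReal hI
    have h3 := hlow.trans (mul_le_mul_right hJ _)
    rw [← ENNReal.ofReal_mul hC₂.le, ENNReal.ofReal_le_ofReal_iff (by positivity), abs_mul,
      ← hM] at h3
    have hMle : M ≤ C₂ * β * |R| ^ n * η := by
      rcases hM0.eq_or_lt with h0 | h0
      · rw [← h0]
        positivity
      have h4 : h ^ n ≤ |R| ^ n * r ^ n := by
        rw [← mul_pow]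
        exact pow_le_pow_left₀ hh hhr' n
      have h5 : M * (M * r ^ n) ≤ M * (C₂ * β * |R| ^ n * η * r ^ n) := by
        calc M * (M * r ^ n) = M * M * r ^ n := by ring
          _ ≤ C₂ * (η * M * (h ^ n * β)) := h3
          _ ≤ C₂ * (η * M * (|R| ^ n * r ^ n * β)) := by gcongr
          _ = _ := by ring
      exact le_of_mul_le_mul_right (le_of_mul_le_mul_left h5 h0) (by positivity)
    have h6 := hal x hx
    have h7 := hmax' x hx
    calc |u x - value p x| = |(u x - value p x - (a + l x)) + (a + l x)| := by ring_nf
      _ ≤ η + M := (abs_add_le _ _).trans (add_le_add h6 h7)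
      _ ≤ C₃ * η := by rw [hC₃]; linarith
  -- The affine function depends on ε but has been eliminated, so ε can tend to zero.
  have h8 : |u x - value p x| ≤ C₃ * (C₁ * (h ^ 2 / r) * E) := by
    refine le_of_forall_pos_le_add fun ε hε => ?_
    have := key (ε / C₃) (by positivity)
    rwa [mul_add, mul_div_cancel₀ _ hC₃0.ne'] at this
  refine h8.trans ?_
  have h9 : h ^ 2 / r ≤ h * (|R| + 1) := by
    rw [div_le_iff₀ hr]
    nlinarith [mul_le_mul_of_nonneg_left hhr' hh]
  calc C₃ * (C₁ * (h ^ 2 / r) * E) ≤ C₃ * (C₁ * (h * (|R| + 1)) * E) := by gcongr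
    _ = _ := by ring

/-! ### Existence of the `L²` projection -/

/-- The L² product on polynomials induces an injective map into the dual space, which is surjective
by equality of finite dimensions. The projection is the preimage of the functional given by `u`. -/
theorem exists_isL2Projection {K : Set (Sp n)} (hKc : IsCompact K) {x₀ : Sp n} {r : ℝ}
    (hr : 0 < r) (hball : Metric.closedBall x₀ r ⊆ K) (k : ℕ) {u : Sp n → ℝ}
    (hu : ContinuousOn u K) : ∃ p, IsL2Projection K k u p := by
  have hint : ∀ {f : Sp n → ℝ}, ContinuousOn f K → IntegrableOn f K := fun hf =>
    hf.integrableOn_compact hKc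
  have hcv : ∀ q : Poly n k, ContinuousOn (value q.1) K := fun q =>
    (continuous_value q.1).continuousOn
  have vadd : ∀ (p q : Poly n k) x, value (p + q).1 x = value p.1 x + value q.1 x := fun p q x => by
    simp [value]
  have vsmul : ∀ (a : ℝ) (q : Poly n k) x, value (a • q).1 x = a * value q.1 x := fun a q x => by
    simp [value]
  let Φ : (f : Sp n → ℝ) → ContinuousOn f K → Module.Dual ℝ (Poly n k) := fun f hf =>
    { toFun := fun q => ∫ x in K, f x * value q.1 x
      map_add' := fun p q => by
        simp only [vadd, mul_add]
        exact integral_add (hint (hf.mul (hcv p))) (hint (hf.mul (hcv q)))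
      map_smul' := fun a q => by
        simp only [vsmul, RingHom.id_apply, smul_eq_mul, mul_left_comm _ a]
        exact integral_const_mul _ _ }
  let B : Poly n k →ₗ[ℝ] Module.Dual ℝ (Poly n k) :=
    { toFun := fun p => Φ (value p.1) (hcv p)
      map_add' := fun p q => by
        ext s
        simp only [Φ, LinearMap.coe_mk, AddHom.coe_mk, LinearMap.add_apply, vadd, add_mul]
        exact integral_add (hint ((hcv p).mul (hcv s))) (hint ((hcv q).mul (hcv s)))
      map_smul' := fun a q => by
        ext s
        simp only [Φ, LinearMap.coe_mk, AddHom.coe_mk, LinearMap.smul_apply, vsmul, mul_assoc,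
          RingHom.id_apply, smul_eq_mul]
        exact integral_const_mul _ _ }
  have hinj : Function.Injective B := by
    rw [injective_iff_map_eq_zero]
    intro p hp
    have h0 : ∫ x in K, value p.1 x * value p.1 x = 0 := by
      have := LinearMap.congr_fun hp p
      exact this
    have hlp := IsLinePoly.value ((MvPolynomial.mem_restrictTotalDegree _ _ _).1 p.2)
    have hzero : ∀ x, value p.1 x = 0 := by
      intro x
      -- The ratio of radii is adapted to the arbitrary point x, so a polynomial with vanishing L²
      -- norm on `K` is zero everywhere.
      obtain ⟨C, -, h⟩ := IsLinePoly.exists_abs_le n (k + k) (‖x - x₀‖ / r)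
      have h1 := h _ (hlp.mul hlp) x₀ r hr x (by
        rw [mem_closedBall_iff_norm, div_mul_cancel₀ _ hr.ne'])
      have h2 : ∫⁻ y in Metric.ball x₀ r, ENNReal.ofReal |value p.1 y * value p.1 y| = 0 := by
        refine le_antisymm ((lintegral_mono_set (Metric.ball_subset_closedBall.trans hball)).trans
          (le_of_eq ?_)) zero_le
        simp_rw [abs_mul_self]
        rw [← ofReal_integral_eq_lintegral_ofReal
          (f := fun y => value p.1 y * value p.1 y) (hint ((hcv p).mul (hcv p)))
            (ae_of_all _ fun y => mul_self_nonneg _), h0, ENNReal.ofReal_zero]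
      rw [h2, mul_zero, nonpos_iff_eq_zero, ENNReal.ofReal_eq_zero, abs_mul_self] at h1
      have h3 : 0 < r ^ n := by positivity
      have h4 : value p.1 x * value p.1 x ≤ 0 := by
        by_contra! h5
        exact absurd h1 (not_le.2 (mul_pos h5 h3))
      nlinarith
    apply Subtype.ext
    apply MvPolynomial.funext
    intro x
    simpa [value] using hzero (WithLp.toLp 2 x)
  have hsurj : Function.Surjective B :=
    (LinearMap.injective_iff_surjective_of_finrank_eq_finrank
      (Subspace.dual_finrank_eq (K := ℝ) (V := Poly n k)).symm).1 hinj
  obtain ⟨p, hp⟩ := hsurj (Φ u hu)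
  refine ⟨p, fun q => ?_⟩
  have h1 : ∫ x in K, value p.1 x * value q.1 x = ∫ x in K, u x * value q.1 x :=
    LinearMap.congr_fun hp q
  simp only [sub_mul]
  rw [integral_sub (f := fun x => u x * value q.1 x) (g := fun x => value p.1 x * value q.1 x)
    (hint (hu.mul (hcv q))) (hint ((hcv p).mul (hcv q))), h1, sub_self]

theorem isL2Projection_l2Projection {K : Set (Sp n)} (hKc : IsCompact K) {x₀ : Sp n} {r : ℝ}
    (hr : 0 < r) (hball : Metric.closedBall x₀ r ⊆ K) (k : ℕ) {u : Sp n → ℝ}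
    (hu : ContinuousOn u K) : IsL2Projection K k u (l2Projection K k u) := by
  have h := exists_isL2Projection hKc hr hball k hu
  rw [l2Projection, dif_pos h]
  exact h.choose_spec

/-! ### Integration along lines transversal to a hyperplane -/

/-- The linear involution exchanging the coordinate transversal to a hyperplane with an additional
coordinate. -/
def shearSwap (ν v : Sp n) : Sp n × ℝ →ₗ[ℝ] Sp n × ℝ where
  toFun z := (z.1 - (inner ℝ ν z.1 : ℝ) • v + z.2 • v, inner ℝ ν z.1)
  map_add' x y := by
    ext1
    · simp only [Prod.fst_add, Prod.snd_add, inner_add_right]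
      module
    · simp [inner_add_right]
  map_smul' a x := by
    ext1
    · simp only [Prod.smul_fst, Prod.smul_snd, real_inner_smul_right, smul_eq_mul,
        RingHom.id_apply]
      module
    · simp [real_inner_smul_right]

theorem shearSwap_comp_self {ν v : Sp n} (h : inner ℝ ν v = (1 : ℝ)) :
    shearSwap ν v ∘ₗ shearSwap ν v = LinearMap.id := by
  refine LinearMap.ext fun z => ?_
  have e : inner ℝ ν (z.1 - (inner ℝ ν z.1 : ℝ) • v + z.2 • v) = z.2 := by
    rw [inner_add_right, inner_sub_right, real_inner_smul_right, real_inner_smul_right, h]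
    ring
  simp only [LinearMap.comp_apply, LinearMap.id_apply, shearSwap, LinearMap.coe_mk, AddHom.coe_mk,
    e]
  ext1
  · simp
  · rfl

/-- An involution has determinant ±1, hence preserves Lebesgue measure; no determinant has to be
computed. -/
theorem map_shearSwap_volume {ν v : Sp n} (h : inner ℝ ν v = (1 : ℝ)) :
    Measure.map (shearSwap ν v) (volume : Measure (Sp n × ℝ)) = volume := by
  have hd : LinearMap.det (shearSwap ν v) * LinearMap.det (shearSwap ν v) = 1 := by
    rw [← LinearMap.det_comp, shearSwap_comp_self h, LinearMap.det_id]
  have hd0 : LinearMap.det (shearSwap ν v) ≠ 0 := fun h0 => by simp [h0] at hd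
  have hd1 : |(LinearMap.det (shearSwap ν v))⁻¹| = 1 := by
    rcases mul_self_eq_one_iff.1 hd with h1 | h1 <;> simp [h1]
  have : (volume : Measure (Sp n × ℝ)).IsAddHaarMeasure :=
    inferInstanceAs ((volume : Measure (Sp n)).prod (volume : Measure ℝ)).IsAddHaarMeasure
  rw [Measure.map_linearMap_addHaar_eq_smul_addHaar _ hd0, hd1]
  simp

/-- The pair (base point y, distance t) is exchanged for (end point of the segment, height s of y
above the hyperplane). An integral over segments thereby becomes a volume integral with a free
parameter s. -/
theorem lintegral_shearSwap {ν v : Sp n} (h : inner ℝ ν v = (1 : ℝ)) (c : Sp n)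
    {Φ : Sp n × ℝ → ℝ≥0∞} (hΦ : Measurable Φ) :
    ∫⁻ y : Sp n, ∫⁻ t : ℝ, Φ (y - (inner ℝ ν (y - c) : ℝ) • v + t • v, inner ℝ ν (y - c)) =
      ∫⁻ x, ∫⁻ s, Φ (x, s) := by
  have hS : Measurable (shearSwap ν v) :=
    (LinearMap.continuous_of_finiteDimensional (shearSwap ν v)).measurable
  set Φ' : Sp n × ℝ → ℝ≥0∞ := fun z => Φ (z.1 + c, z.2) with hΦ'
  have hΦ'm : Measurable Φ' := hΦ.comp (by fun_prop)
  rw [← lintegral_add_right_eq_self (fun y => ∫⁻ t : ℝ, Φ (y - (inner ℝ ν (y - c) : ℝ) • v + t • v,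
      inner ℝ ν (y - c))) c, ← lintegral_add_right_eq_self (fun x => ∫⁻ s, Φ (x, s)) c]
  calc _ = ∫⁻ y, ∫⁻ t, Φ' (shearSwap ν v (y, t)) := by
        refine lintegral_congr fun y => lintegral_congr fun t => ?_
        simp only [Φ', shearSwap, LinearMap.coe_mk, AddHom.coe_mk, add_sub_cancel_right]
        congr 2
        abel
    _ = ∫⁻ z, Φ' (shearSwap ν v z) := by
        exact (lintegral_prod (fun z => Φ' (shearSwap ν v z)) (hΦ'm.comp hS).aemeasurable).symm
    _ = ∫⁻ z, Φ' z := by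
        conv_rhs => rw [← map_shearSwap_volume h]
        rw [lintegral_map hΦ'm hS]
    _ = _ := by
        rw [Measure.volume_eq_prod, lintegral_prod _ hΦ'm.aemeasurable]

/-- The integral over transversal segments emanating from a hyperplane. -/
theorem lintegral_segments_le {ν v c : Sp n} (hν : ‖ν‖ = 1) (hv : ‖v‖ ≤ 2)
    (h : inner ℝ ν v = (1 : ℝ)) {ρ : ℝ} {f : Sp n → ℝ≥0∞} (hf : Measurable f) :
    ∫⁻ y in Metric.ball c ρ, ∫⁻ t in Ioc 0 ρ, f (y - (inner ℝ ν (y - c) : ℝ) • v + t • v) ≤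
      ENNReal.ofReal (2 * ρ) *
        ∫⁻ x in Metric.closedBall c (5 * ρ) ∩ {x | 0 ≤ inner ℝ ν (x - c)}, f x := by
  have hm : MeasurableSet (Metric.closedBall c (5 * ρ) ∩ {x | (0 : ℝ) ≤ inner ℝ ν (x - c)}) :=
    (Metric.isClosed_closedBall.inter
      (isClosed_le continuous_const (by fun_prop))).measurableSet
  set D := Metric.closedBall c (5 * ρ) ∩ {x | (0 : ℝ) ≤ inner ℝ ν (x - c)} with hD
  -- Heights of points of the ball lie in [-ρ, ρ], whose length is the factor 2ρ. The end points are
  -- within ρ + 2ρ + 2ρ of c.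
  set Φ : Sp n × ℝ → ℝ≥0∞ := fun z => (Icc (-ρ) ρ).indicator 1 z.2 * D.indicator f z.1 with hΦ
  have hΦm : Measurable Φ := by
    refine Measurable.mul ?_ ?_
    · exact (measurable_one.indicator measurableSet_Icc).comp measurable_snd
    · exact (hf.indicator hm).comp measurable_fst
  calc _ ≤ ∫⁻ y : Sp n, ∫⁻ t : ℝ, Φ (y - (inner ℝ ν (y - c) : ℝ) • v + t • v,
      inner ℝ ν (y - c)) := by
        rw [← lintegral_indicator measurableSet_ball]
        refine lintegral_mono fun y => ?_
        by_cases hy : y ∈ Metric.ball c ρ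
        · rw [indicator_of_mem hy, ← lintegral_indicator measurableSet_Ioc]
          refine lintegral_mono fun t => ?_
          by_cases ht : t ∈ Ioc 0 ρ
          · rw [indicator_of_mem ht]
            rw [mem_ball_iff_norm] at hy
            have h1 : |(inner ℝ ν (y - c) : ℝ)| ≤ ‖y - c‖ := by
              have := abs_real_inner_le_norm ν (y - c)
              rwa [hν, one_mul] at this
            have h2 := abs_le.1 (h1.trans hy.le)
            have hx : y - (inner ℝ ν (y - c) : ℝ) • v + t • v ∈ D := by
              constructor
              · rw [mem_closedBall_iff_norm]
                have e : y - (inner ℝ ν (y - c) : ℝ) • v + t • v - c =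
                    (y - c) - (inner ℝ ν (y - c) : ℝ) • v + t • v := by abel
                rw [e]
                refine (norm_add_le _ _).trans ((add_le_add_left (norm_sub_le _ _) _).trans ?_)
                rw [norm_smul, norm_smul, Real.norm_eq_abs, Real.norm_of_nonneg ht.1.le]
                have h3 : |(inner ℝ ν (y - c) : ℝ)| * ‖v‖ ≤ ρ * 2 :=
                  mul_le_mul (h1.trans hy.le) hv (norm_nonneg _) (ht.1.le.trans ht.2)
                have h4 : t * ‖v‖ ≤ ρ * 2 :=
                  mul_le_mul ht.2 hv (norm_nonneg _) (ht.1.le.trans ht.2)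
                linarith
              · rw [mem_ofPred_eq]
                have e : y - (inner ℝ ν (y - c) : ℝ) • v + t • v - c =
                    (y - c) - (inner ℝ ν (y - c) : ℝ) • v + t • v := by abel
                rw [e, inner_add_right, inner_sub_right, real_inner_smul_right,
                  real_inner_smul_right, h]
                linarith [ht.1]
            simp only [hΦ]
            rw [indicator_of_mem hx, indicator_of_mem (show inner ℝ ν (y - c) ∈ Icc (-ρ) ρ from h2)]
            simp
          · simp [ht]
        · simp [hy]
    _ = ∫⁻ x, ∫⁻ s, Φ (x, s) := lintegral_shearSwap h c hΦm
    _ = ∫⁻ x, ENNReal.ofReal (2 * ρ) * D.indicator f x := by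
        refine lintegral_congr fun x => ?_
        simp only [hΦ]
        rw [lintegral_mul_const _ (measurable_one.indicator measurableSet_Icc),
          lintegral_indicator_one measurableSet_Icc, Real.volume_Icc]
        congr 2
        ring
    _ = _ := by
        rw [lintegral_const_mul _ (hf.indicator hm), lintegral_indicator hm]

/-! ### Jumps of gradients -/

theorem setLIntegral_ofReal_le_of_eLpNorm_le {S : Set (Sp n)} {g : Sp n → ℝ} (hg : ∀ x, 0 ≤ g x)
    (hgm : AEStronglyMeasurable g (volume.restrict S)) {p : ℕ} (hp : 1 ≤ p) {E : ℝ}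
    (h : eLpNorm g p (volume.restrict S) ≤ ENNReal.ofReal E) :
    ∫⁻ x in S, ENNReal.ofReal (g x) ≤ ENNReal.ofReal E * volume S ^ (1 - 1 / (p : ℝ)) := by
  have h1 := eLpNorm_le_eLpNorm_mul_rpow_measure_univ (μ := volume.restrict S) (p := 1)
    (q := (p : ℝ≥0∞)) (f := g) (by exact_mod_cast hp) hgm
  rw [eLpNorm_one_eq_lintegral_enorm] at h1
  simp only [Measure.restrict_apply MeasurableSet.univ, univ_inter, ENNReal.toReal_one,
    ENNReal.toReal_natCast, div_one] at h1
  simp_rw [Real.enorm_eq_ofReal (hg _)] at h1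
  exact h1.trans (mul_le_mul_left h _)

theorem totalDegree_pderiv_le {k : ℕ} {p : MvPolynomial (Fin n) ℝ} (hp : p.totalDegree ≤ k)
    (i : Fin n) : (MvPolynomial.pderiv i p).totalDegree ≤ k := by
  rw [MvPolynomial.as_sum p, map_sum]
  refine MvPolynomial.totalDegree_finsetSum_le fun s hs => ?_
  rw [MvPolynomial.pderiv_monomial]
  refine (MvPolynomial.totalDegree_monomial_le _ _).trans
    (le_trans ?_ ((MvPolynomial.le_totalDegree hs).trans hp))
  classical exact Finsupp.sum_le_sum_index tsub_le_self (fun _ _ => monotone_id) (by simp)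

theorem isLinePoly_inner_grad_sub {k : ℕ} {p p' : MvPolynomial (Fin n) ℝ} (hp : p.totalDegree ≤ k)
    (hp' : p'.totalDegree ≤ k) (v : Sp n) :
    IsLinePoly k fun y => inner ℝ (grad p y - grad p' y) v := by
  have e : (fun y => inner ℝ (grad p y - grad p' y) v) = fun y => ∑ i, v i *
      (value (MvPolynomial.pderiv i p) y - value (MvPolynomial.pderiv i p') y) := by
    ext y
    simp [PiLp.inner_apply, grad]
  rw [e]
  exact IsLinePoly.sum _ fun i _ => ((IsLinePoly.value (totalDegree_pderiv_le hp i)).sub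
    (IsLinePoly.value (totalDegree_pderiv_le hp' i))).const_mul _

/-- The projection onto a hyperplane along a transversal direction. -/
def obliqueProj (ν v c : Sp n) : Sp n →ᵃ[ℝ] Sp n :=
  (LinearMap.id - (innerₛₗ ℝ ν).smulRight v).toAffineMap +
    AffineMap.const ℝ (Sp n) ((inner ℝ ν c : ℝ) • v)

theorem obliqueProj_apply (ν v c y : Sp n) :
    obliqueProj ν v c y = y - (inner ℝ ν (y - c) : ℝ) • v := by
  simp only [obliqueProj, AffineMap.coe_add, Pi.add_apply, LinearMap.coe_toAffineMap,
    LinearMap.sub_apply,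
    LinearMap.id_apply, LinearMap.smulRight_apply, innerₛₗ_apply_apply, AffineMap.const_apply,
    inner_sub_right]
  module

/-- Taylor's formula on both sides of a hyperplane. -/
theorem ofReal_mul_abs_inner_grad_sub_le {ψ : Sp n → ℝ} (hψ : ContDiff ℝ 2 ψ)
    (p p' : MvPolynomial (Fin n) ℝ) {y v : Sp n} (hv : ‖v‖ ≤ 2) {ρ η : ℝ} (hρ : 0 < ρ)
    (h1 : |ψ y - value p y| ≤ η) (h2 : |ψ (y + ρ • v) - value p (y + ρ • v)| ≤ η)
    (h3 : |ψ y - value p' y| ≤ η) (h4 : |ψ (y + ρ • -v) - value p' (y + ρ • -v)| ≤ η) :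
    ENNReal.ofReal |inner ℝ (grad p y - grad p' y) v| ≤ ENNReal.ofReal (4 * η / ρ) +
      4 * (∫⁻ t in Ioc 0 ρ,
        ENNReal.ofReal (frobenius (hessian (fun x => ψ x - value p x) (y + t • v)))) +
      4 * ∫⁻ t in Ioc 0 ρ,
        ENNReal.ofReal (frobenius (hessian (fun x => ψ x - value p' x) (y + t • -v))) := by
  have hη : 0 ≤ η := (abs_nonneg _).trans h1
  have hw : ∀ p : MvPolynomial (Fin n) ℝ, ContDiff ℝ 2 fun x => ψ x - value p x := fun p =>
    hψ.sub ((contDiff_value p).of_le two_le_infty)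
  have hfd : ∀ (p : MvPolynomial (Fin n) ℝ) (z : Sp n),
      fderiv ℝ (fun x => ψ x - value p x) y z = fderiv ℝ ψ y z - inner ℝ (grad p y) z := by
    intro p z
    rw [fderiv_fun_sub (hψ.differentiable (by norm_num) y) (hasFDerivAt_value p y).differentiableAt,
      (hasFDerivAt_value p y).fderiv]
    rfl
  have hc : ∀ (p : MvPolynomial (Fin n) ℝ) (z : Sp n), Continuous fun t : ℝ =>
      frobenius (hessian (fun x => ψ x - value p x) (y + t • z)) := fun p z =>
    (continuous_frobenius.comp (continuous_hessian (hw p))).comp (by fun_prop)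
  have htay : ∀ (p : MvPolynomial (Fin n) ℝ) (z : Sp n), ‖z‖ ≤ 2 →
      |(ψ (y + ρ • z) - value p (y + ρ • z)) - (ψ y - value p y) -
        ρ * (fderiv ℝ ψ y z - inner ℝ (grad p y) z)| ≤
      ρ * (4 * ∫ t in Ioc 0 ρ, frobenius (hessian (fun x => ψ x - value p x) (y + t • z))) := by
    intro p z hz
    have := abs_taylor_le (hw p) y z hρ.le
    rw [hfd] at this
    refine this.trans ?_
    rw [intervalIntegral.integral_of_le hρ.le, ← integral_const_mul, ← integral_const_mul]
    have hcc := hc p z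
    refine setIntegral_mono_on ?_ ?_ measurableSet_Ioc fun t ht => ?_
    · refine Continuous.integrableOn_Ioc ?_
      exact (continuous_const.sub continuous_id).mul (continuous_const.mul hcc)
    · exact Continuous.integrableOn_Ioc (continuous_const.mul (continuous_const.mul hcc))
    · have h0 := frobenius_nonneg (hessian (fun x => ψ x - value p x) (y + t • z))
      have h4 : ‖z‖ ^ 2 ≤ 4 := by nlinarith [norm_nonneg z]
      have := ht.1
      have := ht.2
      gcongr
      linarith
  set I := ∫ t in Ioc 0 ρ, frobenius (hessian (fun x => ψ x - value p x) (y + t • v)) with hI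
  set I' := ∫ t in Ioc 0 ρ, frobenius (hessian (fun x => ψ x - value p' x) (y + t • -v)) with hI'
  have hI0 : 0 ≤ I := integral_nonneg fun _ => frobenius_nonneg _
  have hI0' : 0 ≤ I' := integral_nonneg fun _ => frobenius_nonneg _
  -- The expansions of ψ - p along v and of ψ - p' along -v are added; the derivative of ψ at y
  -- cancels. The four boundary values give 4η/ρ, and ‖v‖² ≤ 4 gives the other factors.
  have hreal : |inner ℝ (grad p y - grad p' y) v| ≤ 4 * η / ρ + 4 * I + 4 * I' := by
    have t1 := htay p v hv
    have t2 := htay p' (-v) (by rwa [norm_neg])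
    rw [map_neg, inner_neg_right] at t2
    rw [inner_sub_left]
    have : |(inner ℝ (grad p y) v - inner ℝ (grad p' y) v : ℝ)| * ρ ≤
        4 * η + 4 * I * ρ + 4 * I' * ρ := by
      rw [← abs_of_pos hρ, ← abs_mul, abs_of_pos hρ]
      rw [abs_le] at t1 t2 h1 h2 h3 h4 ⊢
      constructor <;> nlinarith [t1.1, t1.2, t2.1, t2.2, h1.1, h1.2, h2.1, h2.2, h3.1, h3.2,
        h4.1, h4.2]
    rw [← le_div_iff₀ hρ] at this
    refine this.trans (le_of_eq ?_)
    field_simp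
  have hof : ∀ (p : MvPolynomial (Fin n) ℝ) (z : Sp n), ∫⁻ t in Ioc 0 ρ,
      ENNReal.ofReal (frobenius (hessian (fun x => ψ x - value p x) (y + t • z))) =
      ENNReal.ofReal (∫ t in Ioc 0 ρ,
        frobenius (hessian (fun x => ψ x - value p x) (y + t • z))) := fun p z =>
    (ofReal_integral_eq_lintegral_ofReal (hc p z).integrableOn_Ioc
      (ae_of_all _ fun _ => frobenius_nonneg _)).symm
  rw [hof, hof, ← hI, ← hI']
  have e4 : (4 : ℝ≥0∞) = ENNReal.ofReal 4 := by simp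
  rw [e4, ← ENNReal.ofReal_mul (by norm_num), ← ENNReal.ofReal_mul (by norm_num),
    ← ENNReal.ofReal_add (by positivity) (by positivity),
    ← ENNReal.ofReal_add (by positivity) (by positivity)]
  exact ENNReal.ofReal_le_ofReal hreal

/-- It replaces a trace inequality for ∇u. The jump of the v-derivative is a polynomial on the
hyperplane; its mean over base points is bounded by Taylor's formula on both sides, and polynomial
norm equivalence gives the pointwise bound. -/
theorem IsW2.exists_abs_inner_grad_sub_le {n : ℕ} (hn : 1 ≤ n) (k : ℕ) (R : ℝ) :
    ∃ C : ℝ, 0 < C ∧ ∀ {Ω : Set (Sp n)}, IsOpen Ω → Bornology.IsBounded Ω →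
    ∀ {u : Sp n → ℝ}, ContinuousOn u (closure Ω) →
    ∀ {G : Sp n → Sp n} {H : Sp n → Matrix (Fin n) (Fin n) ℝ}, IsW2 Ω n u G H →
    ∀ {p p' : MvPolynomial (Fin n) ℝ}, p.totalDegree ≤ k → p'.totalDegree ≤ k →
    ∀ {ν v c : Sp n}, ‖ν‖ = 1 → ‖v‖ ≤ 2 → inner ℝ ν v = (1 : ℝ) →
    ∀ {ρ : ℝ}, 0 < ρ → Metric.closedBall c (5 * ρ) ⊆ Ω →
    ∀ {η D : ℝ}, 0 ≤ η → 0 ≤ D →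
    (∀ x ∈ Metric.closedBall c (5 * ρ), 0 ≤ inner ℝ ν (x - c) → |u x - value p x| ≤ η) →
    (∀ x ∈ Metric.closedBall c (5 * ρ), inner ℝ ν (x - c) ≤ 0 → |u x - value p' x| ≤ η) →
    (∫⁻ x in Metric.closedBall c (5 * ρ) ∩ {x | 0 ≤ inner ℝ ν (x - c)},
      ENNReal.ofReal (frobenius (H x - hess p x)) ≤ ENNReal.ofReal D) →
    (∫⁻ x in Metric.closedBall c (5 * ρ) ∩ {x | inner ℝ ν (x - c) ≤ 0},
      ENNReal.ofReal (frobenius (H x - hess p' x)) ≤ ENNReal.ofReal D) →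
    ∀ x ∈ Metric.closedBall c (R * ρ), inner ℝ ν (x - c) = (0 : ℝ) →
      |inner ℝ (grad p x - grad p' x) v| ≤ C * (η / ρ + ρ * D / ρ ^ n) := by
  obtain ⟨C₂, hC₂, hB⟩ := IsLinePoly.exists_abs_le n k R
  set β := volume.real (Metric.ball (0 : Sp n) 1) with hβ
  have hβ0 : 0 ≤ β := measureReal_nonneg
  refine ⟨C₂ * (4 * β + 16), by positivity, ?_⟩
  intro Ω hΩ hΩb u huc G H hu p p' hp hp' ν v c hν hv hνv ρ hρ hB5 η D hη hD hup hup' hDp hDp' x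
    hx hxν
  set B := Metric.closedBall c (5 * ρ) with hBdef
  have hBc : IsCompact B := isCompact_closedBall _ _
  have hPx : obliqueProj ν v c x = x := by rw [obliqueProj_apply, hxν, zero_smul, sub_zero]
  -- Composition with the projection along v extends the jump from the hyperplane to a full ball,
  -- where the n-dimensional inverse estimate applies. Points of the hyperplane are fixed.
  have hlp := (isLinePoly_inner_grad_sub hp hp' v).comp (obliqueProj ν v c)
  have hx2 := hB _ hlp c ρ hρ x hx
  simp only [hPx] at hx2
  have hBtop : volume B ≠ ⊤ := hBc.measure_lt_top.ne
  set W := (volume B ^ (1 - 1 / (n : ℝ))).toReal with hW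
  have hexp : 0 ≤ 1 - 1 / (n : ℝ) := by
    rw [sub_nonneg, div_le_one (by exact_mod_cast hn)]
    exact_mod_cast hn
  have hWtop : volume B ^ (1 - 1 / (n : ℝ)) ≠ ⊤ := ENNReal.rpow_ne_top_of_nonneg hexp hBtop
  have hW0 : 0 ≤ W := ENNReal.toReal_nonneg
  have hHm : ∀ i j, AEStronglyMeasurable (fun x => H x i j) (volume.restrict B) := fun i j =>
    (hu.memLp_hess i j).1.mono_measure (Measure.restrict_mono hB5 le_rfl)
  -- The bound for a mollification at distance δ. The factor 16 collects 4 from Taylor's formula, 2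
  -- from the range of heights and 2 from the two sides.
  have key : ∀ δ > 0, |inner ℝ (grad p x - grad p' x) v| * ρ ^ n ≤
      C₂ * (4 * (η + δ) / ρ * (ρ ^ n * β) + 16 * ρ * (D + δ * W)) := by
    intro δ hδ
    obtain ⟨ψ, hψ, hψu, hψH⟩ := hu.exists_contDiff_approx hn hΩ hΩb huc hBc hB5 hδ
    have hNc : ∀ p : MvPolynomial (Fin n) ℝ,
        Continuous fun y => frobenius (hessian (fun x => ψ x - value p x) y) := fun p =>
      continuous_frobenius.comp
        (continuous_hessian (hψ.sub ((contDiff_value p).of_le two_le_infty)))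
    have hNm : ∀ p : MvPolynomial (Fin n) ℝ, Measurable fun y =>
        ENNReal.ofReal (frobenius (hessian (fun x => ψ x - value p x) y)) := fun p =>
      (ENNReal.continuous_ofReal.comp (hNc p)).measurable
    have hψHm : AEStronglyMeasurable (fun x => frobenius (hessian ψ x - H x))
        (volume.restrict B) := aestronglyMeasurable_frobenius fun i j =>
      ((continuous_hessian hψ).matrix_elem i j).aestronglyMeasurable.sub (hHm i j)
    have hψ1 : ∫⁻ x in B, ENNReal.ofReal (frobenius (hessian ψ x - H x)) ≤
        ENNReal.ofReal (δ * W) := by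
      refine (setLIntegral_ofReal_le_of_eLpNorm_le (fun _ => frobenius_nonneg _) hψHm hn
        hψH).trans (le_of_eq ?_)
      rw [ENNReal.ofReal_mul hδ.le, hW, ENNReal.ofReal_toReal hWtop]
    have hNle : ∀ (p : MvPolynomial (Fin n) ℝ) (S : Set (Sp n)), S ⊆ B →
        ∫⁻ x in S, ENNReal.ofReal (frobenius (H x - hess p x)) ≤ ENNReal.ofReal D →
        ∫⁻ x in S, ENNReal.ofReal (frobenius (hessian (fun x => ψ x - value p x) x)) ≤
          ENNReal.ofReal (D + δ * W) := by
      intro p S hS hpD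
      have hpt : ∀ x, ENNReal.ofReal (frobenius (hessian (fun x => ψ x - value p x) x)) ≤
          ENNReal.ofReal (frobenius (hessian ψ x - H x)) +
          ENNReal.ofReal (frobenius (H x - hess p x)) := by
        intro x
        rw [← ENNReal.ofReal_add (frobenius_nonneg _) (frobenius_nonneg _)]
        apply ENNReal.ofReal_le_ofReal
        rw [hessian_sub hψ ((contDiff_value p).of_le two_le_infty), hessian_value]
        refine le_trans (le_of_eq ?_) (frobenius_add_le _ _)
        congr 1
        abel
      refine (lintegral_mono hpt).trans ?_
      rw [lintegral_add_left' (hψHm.mono_measure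
        (Measure.restrict_mono hS le_rfl)).aemeasurable.ennreal_ofReal, add_comm D,
        ENNReal.ofReal_add (by positivity) hD]
      exact add_le_add ((lintegral_mono_set hS).trans hψ1) hpD
    have hψp : ∀ x ∈ B, 0 ≤ inner ℝ ν (x - c) → |ψ x - value p x| ≤ η + δ := by
      intro x hx hxν
      have h1 := hψu x hx
      have h2 := hup x hx hxν
      calc _ = |(ψ x - u x) + (u x - value p x)| := by ring_nf
        _ ≤ _ := (abs_add_le _ _).trans (by linarith)
    have hψp' : ∀ x ∈ B, inner ℝ ν (x - c) ≤ 0 → |ψ x - value p' x| ≤ η + δ := by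
      intro x hx hxν
      have h1 := hψu x hx
      have h2 := hup' x hx hxν
      calc _ = |(ψ x - u x) + (u x - value p' x)| := by ring_nf
        _ ≤ _ := (abs_add_le _ _).trans (by linarith)
    have hpt : ∀ y ∈ Metric.ball c ρ,
        ENNReal.ofReal |inner ℝ (grad p (obliqueProj ν v c y) - grad p' (obliqueProj ν v c y)) v| ≤
        ENNReal.ofReal (4 * (η + δ) / ρ) +
        4 * (∫⁻ t in Ioc 0 ρ, ENNReal.ofReal (frobenius (hessian (fun x => ψ x - value p x)
          (y - (inner ℝ ν (y - c) : ℝ) • v + t • v)))) +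
        4 * ∫⁻ t in Ioc 0 ρ, ENNReal.ofReal (frobenius (hessian (fun x => ψ x - value p' x)
          (y - (inner ℝ (-ν) (y - c) : ℝ) • (-v) + t • (-v)))) := by
      intro y hy
      rw [mem_ball_iff_norm] at hy
      -- Reversing both ν and v leaves the projection unchanged, so the segment estimate with -ν and
      -- -v covers the opposite half ball.
      have e1 : y - (inner ℝ (-ν) (y - c) : ℝ) • (-v) = y - (inner ℝ ν (y - c) : ℝ) • v := by
        rw [inner_neg_left]
        module
      rw [e1, obliqueProj_apply]
      set z := y - (inner ℝ ν (y - c) : ℝ) • v with hz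
      have e2 : z - c = (y - c) - (inner ℝ ν (y - c) : ℝ) • v := by rw [hz]; abel
      have hzν : inner ℝ ν (z - c) = (0 : ℝ) := by
        rw [e2, inner_sub_right, real_inner_smul_right, hνv]
        ring
      have hzn : ‖z - c‖ ≤ 3 * ρ := by
        rw [e2]
        refine (norm_sub_le _ _).trans ?_
        rw [norm_smul, Real.norm_eq_abs]
        have h1 : |(inner ℝ ν (y - c) : ℝ)| ≤ ‖y - c‖ := by
          have := abs_real_inner_le_norm ν (y - c)
          rwa [hν, one_mul] at this
        have h3 : |(inner ℝ ν (y - c) : ℝ)| * ‖v‖ ≤ ρ * 2 :=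
          mul_le_mul (h1.trans hy.le) hv (norm_nonneg _) hρ.le
        linarith
      have hmem : ∀ s : Sp n, ‖s‖ ≤ 2 * ρ → z + s ∈ B := by
        intro s hs
        rw [hBdef, mem_closedBall_iff_norm, add_sub_right_comm]
        exact (norm_add_le _ _).trans (by linarith)
      have hval : ∀ s : Sp n, inner ℝ ν (z + s - c) = (inner ℝ ν s : ℝ) := by
        intro s
        rw [add_sub_right_comm, inner_add_right, hzν, zero_add]
      have hρv : ‖ρ • v‖ ≤ 2 * ρ := by
        rw [norm_smul, Real.norm_of_nonneg hρ.le]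
        nlinarith
      have hz0 : z ∈ B := by simpa using hmem 0 (by simpa using hρ.le)
      refine ofReal_mul_abs_inner_grad_sub_le hψ p p' hv hρ (hψp z hz0 hzν.ge)
        (hψp _ (hmem _ hρv) ?_) (hψp' z hz0 hzν.le) (hψp' _ (hmem _ ?_) ?_)
      · rw [hval, real_inner_smul_right, hνv]
        linarith
      · rwa [smul_neg, norm_neg]
      · rw [hval, real_inner_smul_right, inner_neg_right, hνv]
        linarith
    have hseg := lintegral_segments_le (c := c) hν hv hνv (ρ := ρ) (hNm p)
    have hseg' := lintegral_segments_le (c := c) (ν := -ν) (v := -v) (by rwa [norm_neg])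
      (by rwa [norm_neg]) (by rwa [inner_neg_neg]) (ρ := ρ) (hNm p')
    have hset : {x | (0 : ℝ) ≤ inner ℝ (-ν) (x - c)} = {x | (inner ℝ ν (x - c) : ℝ) ≤ 0} := by
      ext x
      simp [inner_neg_left]
    rw [hset] at hseg'
    have h1 := hseg.trans (mul_le_mul_right (hNle p _ inter_subset_left hDp) _)
    have h2 := hseg'.trans (mul_le_mul_right (hNle p' _ inter_subset_left hDp') _)
    rw [← ENNReal.ofReal_mul (by positivity)] at h1 h2
    have hmeas : ∀ (p : MvPolynomial (Fin n) ℝ) (ν v : Sp n), Measurable fun y : Sp n =>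
        ∫⁻ t in Ioc 0 ρ, ENNReal.ofReal (frobenius (hessian (fun x => ψ x - value p x)
          (y - (inner ℝ ν (y - c) : ℝ) • v + t • v))) := by
      intro p ν v
      refine Measurable.lintegral_prod_right' (f := fun z : Sp n × ℝ => ENNReal.ofReal
        (frobenius (hessian (fun x => ψ x - value p x)
          (z.1 - (inner ℝ ν (z.1 - c) : ℝ) • v + z.2 • v)))) ?_
      exact (hNm p).comp (by fun_prop)
    have h3 : ∫⁻ y in Metric.ball c ρ, ENNReal.ofReal
        |inner ℝ (grad p (obliqueProj ν v c y) - grad p' (obliqueProj ν v c y)) v| ≤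
        ENNReal.ofReal (4 * (η + δ) / ρ * (ρ ^ n * β) + 16 * ρ * (D + δ * W)) := by
      refine (setLIntegral_mono' measurableSet_ball hpt).trans ?_
      rw [lintegral_add_left (by
          exact (measurable_const.add ((hmeas p ν v).const_mul 4))),
        lintegral_add_left measurable_const, lintegral_const_mul _ (hmeas p ν v),
        lintegral_const_mul _ (hmeas p' (-ν) (-v)), setLIntegral_const,
        Measure.addHaar_ball_of_pos _ _ hρ, finrank_euclideanSpace, Fintype.card_fin]
      have hβ' : volume (Metric.ball (0 : Sp n) 1) = ENNReal.ofReal β :=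
        (ofReal_measureReal measure_ball_lt_top.ne).symm
      have e4 : (4 : ℝ≥0∞) = ENNReal.ofReal 4 := by simp
      refine (add_le_add (add_le_add le_rfl (mul_le_mul_right h1 4))
        (mul_le_mul_right h2 4)).trans (le_of_eq ?_)
      rw [hβ', e4, ← ENNReal.ofReal_mul (by positivity), ← ENNReal.ofReal_mul (by positivity),
        ← ENNReal.ofReal_mul (by positivity), ← ENNReal.ofReal_add (by positivity) (by positivity),
        ← ENNReal.ofReal_add (by positivity) (by positivity)]
      congr 1
      ring
    have h4 := hx2.trans (mul_le_mul_right h3 _)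
    rwa [← ENNReal.ofReal_mul hC₂.le, ENNReal.ofReal_le_ofReal_iff (by positivity)] at h4
  have hlim : |inner ℝ (grad p x - grad p' x) v| * ρ ^ n ≤
      C₂ * (4 * η / ρ * (ρ ^ n * β) + 16 * ρ * D) := by
    set S := C₂ * (4 / ρ * (ρ ^ n * β) + 16 * ρ * W) with hS
    have hS0 : 0 ≤ S := by positivity
    refine le_of_forall_pos_le_add fun ε hε => ?_
    have h1 := key (ε / (S + 1)) (by positivity)
    have h2 : C₂ * (4 * (η + ε / (S + 1)) / ρ * (ρ ^ n * β) + 16 * ρ * (D + ε / (S + 1) * W)) =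
        C₂ * (4 * η / ρ * (ρ ^ n * β) + 16 * ρ * D) + S * (ε / (S + 1)) := by
      rw [hS]; ring
    have h3 : S * (ε / (S + 1)) ≤ ε := by
      rw [mul_div_assoc', div_le_iff₀ (by positivity)]
      nlinarith
    linarith
  have hρn : 0 < ρ ^ n := by positivity
  rw [← le_div_iff₀ hρn] at hlim
  refine hlim.trans ?_
  have e : C₂ * (4 * η / ρ * (ρ ^ n * β) + 16 * ρ * D) / ρ ^ n =
      C₂ * (4 * β * (η / ρ) + 16 * (ρ * D / ρ ^ n)) := by
    field_simp
  rw [e, mul_assoc C₂]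
  refine mul_le_mul_of_nonneg_left ?_ hC₂.le
  have h5 : 0 ≤ η / ρ := by positivity
  have h6 : 0 ≤ ρ * D / ρ ^ n := by positivity
  nlinarith [mul_nonneg hβ0 h6]

/-- The direction ν controls the normal part of g. Adding to ν the unit vector along the tangential
part and subtracting controls the tangential part by 2M. The bound 2 on ‖v‖ is what this sum needs.
-/
theorem norm_le_of_abs_inner_le {ν g : Sp n} (hν : ‖ν‖ = 1) {M : ℝ}
    (h : ∀ v : Sp n, ‖v‖ ≤ 2 → inner ℝ ν v = (1 : ℝ) → |inner ℝ g v| ≤ M) : ‖g‖ ≤ 3 * M := by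
  have hνν : inner ℝ ν ν = (1 : ℝ) := by rw [real_inner_self_eq_norm_sq, hν, one_pow]
  have h1 := h ν (by rw [hν]; norm_num) hνν
  have hM : 0 ≤ M := (abs_nonneg _).trans h1
  set τ := g - (inner ℝ g ν : ℝ) • ν with hτ
  have hντ : inner ℝ ν τ = (0 : ℝ) := by
    rw [hτ, inner_sub_right, real_inner_smul_right, hνν, real_inner_comm]
    ring
  have hgτ : inner ℝ g τ = ‖τ‖ ^ 2 := by
    rw [← real_inner_self_eq_norm_sq]
    conv_rhs => rw [hτ, inner_sub_left, ← hτ, real_inner_smul_left, hντ]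
    ring
  have h2 : ‖τ‖ ≤ 2 * M := by
    rcases eq_or_ne τ 0 with h0 | h0
    · rw [h0, norm_zero]
      positivity
    have hτ0 : 0 < ‖τ‖ := norm_pos_iff.2 h0
    have h3 := h (ν + ‖τ‖⁻¹ • τ) (by
      refine (norm_add_le _ _).trans ?_
      rw [norm_smul, norm_inv, norm_norm, inv_mul_cancel₀ hτ0.ne', hν]
      norm_num) (by rw [inner_add_right, real_inner_smul_right, hντ, hνν]; ring)
    rw [inner_add_right, real_inner_smul_right, hgτ] at h3
    have e : ‖τ‖⁻¹ * ‖τ‖ ^ 2 = ‖τ‖ := by field_simp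
    rw [e] at h3
    rw [abs_le] at h1 h3
    linarith [h1.1, h3.2]
  calc ‖g‖ = ‖τ + (inner ℝ g ν : ℝ) • ν‖ := by rw [hτ, sub_add_cancel]
    _ ≤ ‖τ‖ + |inner ℝ g ν| := by
      refine (norm_add_le _ _).trans (le_of_eq ?_)
      rw [norm_smul, hν, mul_one, Real.norm_eq_abs]
    _ ≤ 3 * M := by linarith

/-! ### Estimates on cells and sides -/

/-- The frontier of a convex set is null, and the interior of a cell lies in Ω because Ω is the
interior of its closure. Almost-everywhere statements and integrability on Ω thus transfer to cells
that only lie in the closure. -/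
theorem restrict_hull_le {Ω : Set (Sp n)} (hΩ : IsBoundedLipschitz Ω) {T : Finset (Sp n)}
    (hT : hull T ⊆ closure Ω) : volume.restrict (hull T) ≤ volume.restrict Ω := by
  have h1 : (hull T : Set (Sp n)) =ᵐ[volume] interior (hull T) := by
    have h2 := (convex_convexHull ℝ (T : Set (Sp n))).addHaar_frontier volume
    refine (ae_eq_set.2 ⟨measure_mono_null ?_ h2, ?_⟩)
    · intro x hx
      exact ⟨subset_closure hx.1, hx.2⟩
    · rw [sdiff_eq_empty.2 interior_subset, measure_empty]
  rw [Measure.restrict_congr_set h1]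
  refine Measure.restrict_mono ?_ le_rfl
  rw [← hΩ.interior_closure]
  exact interior_mono hT

theorem memLp_frobenius {μ : Measure (Sp n)} {p : ℝ≥0∞}
    {H : Sp n → Matrix (Fin n) (Fin n) ℝ} (hH : ∀ i j, MemLp (fun x => H x i j) p μ) :
    MemLp (fun x => frobenius (H x)) p μ := by
  have h1 : MemLp (fun x => ∑ i, ∑ j, |H x i j|) p μ :=
    memLp_finsetSum _ fun i _ => memLp_finsetSum _ fun j _ => (hH i j).norm
  refine h1.mono (aestronglyMeasurable_frobenius fun i j => (hH i j).1) (ae_of_all _ fun x => ?_)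
  rw [Real.norm_of_nonneg (frobenius_nonneg _)]
  exact (frobenius_le_sum _).trans (le_abs_self _)

theorem memLp_of_continuous {f : Sp n → ℝ} (hf : Continuous f) (T : Finset (Sp n)) (p : ℝ≥0∞) :
    MemLp f p (volume.restrict (hull T)) := by
  have hc := IsSimplex.isCompact_hull T
  have : IsFiniteMeasure (volume.restrict (hull T)) := ⟨by
    rw [Measure.restrict_apply_univ]
    exact hc.measure_lt_top⟩
  obtain ⟨C, hC⟩ := hc.exists_bound_of_continuousOn hf.continuousOn
  exact MemLp.of_bound hf.aestronglyMeasurable C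
    (by filter_upwards [ae_restrict_mem hc.isClosed.measurableSet] with x hx using hC x hx)

/-- The `Lⁿ` norm of the Hessian of an approximation error on a cell. -/
def hessError (H : Sp n → Matrix (Fin n) (Fin n) ℝ) (p : MvPolynomial (Fin n) ℝ)
    (T : Finset (Sp n)) : ℝ :=
  (∫ x in hull T, frobenius (H x - hess p x) ^ n) ^ (1 / (n : ℝ))

theorem hessError_nonneg (H : Sp n → Matrix (Fin n) (Fin n) ℝ) (p : MvPolynomial (Fin n) ℝ)
    (T : Finset (Sp n)) : 0 ≤ hessError H p T :=
  Real.rpow_nonneg (integral_nonneg fun _ => pow_nonneg (frobenius_nonneg _) _) _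

theorem hessError_pow (hn : 1 ≤ n) (H : Sp n → Matrix (Fin n) (Fin n) ℝ)
    (p : MvPolynomial (Fin n) ℝ) (T : Finset (Sp n)) :
    hessError H p T ^ n = ∫ x in hull T, frobenius (H x - hess p x) ^ n := by
  rw [hessError, one_div, Real.rpow_inv_natCast_pow
    (integral_nonneg fun _ => pow_nonneg (frobenius_nonneg _) _) (by omega)]

section

variable {Ω : Set (Sp n)} {u : Sp n → ℝ} {G : Sp n → Sp n} {H : Sp n → Matrix (Fin n) (Fin n) ℝ}

theorem IsW2.memLp_hess_sub (hΩ : IsBoundedLipschitz Ω) (hu : IsW2 Ω n u G H)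
    {T : Finset (Sp n)} (hT : hull T ⊆ closure Ω) (p : MvPolynomial (Fin n) ℝ) (i j : Fin n) :
    MemLp (fun x => (H x - hess p x) i j) n (volume.restrict (hull T)) :=
  ((hu.memLp_hess i j).mono_measure (restrict_hull_le hΩ hT)).sub
    (memLp_of_continuous ((continuous_hess p).matrix_elem i j) T n)

theorem IsW2.eLpNorm_hess_sub_le (hn : 1 ≤ n) (hΩ : IsBoundedLipschitz Ω) (hu : IsW2 Ω n u G H)
    {T : Finset (Sp n)} (hT : hull T ⊆ closure Ω) (p : MvPolynomial (Fin n) ℝ) :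
    eLpNorm (fun x => frobenius (H x - hess p x)) n (volume.restrict (hull T)) ≤
      ENNReal.ofReal (hessError H p T) := by
  have hm := memLp_frobenius (hu.memLp_hess_sub hΩ hT p)
  rw [hm.eLpNorm_eq_integral_rpow_norm (by positivity) (by simp)]
  apply ENNReal.ofReal_le_ofReal
  rw [hessError, one_div]
  simp [abs_of_nonneg (frobenius_nonneg _)]

end

/-- The inscribed ball has radius κ h_T, so the ratio of diameter to inradius is κ⁻¹ and the
constant is uniform over all cells. Degree k ≥ 1 supplies the orthogonality to affine functions. -/
theorem IsW2.exists_abs_sub_l2Projection_le (hn : 1 ≤ n) {κ : ℝ} (hκ : 0 < κ) :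
    ∃ C : ℝ, 0 < C ∧ ∀ {Ω : Set (Sp n)}, IsBoundedLipschitz Ω →
    ∀ {u : Sp n → ℝ}, ContinuousOn u (closure Ω) →
    ∀ {G : Sp n → Sp n} {H : Sp n → Matrix (Fin n) (Fin n) ℝ}, IsW2 Ω n u G H →
    ∀ {T : Finset (Sp n)}, hull T ⊆ closure Ω → 0 < diam T →
    ∀ {x₀ : Sp n}, Metric.closedBall x₀ (κ * diam T) ⊆ hull T →
    ∀ {k : ℕ}, 1 ≤ k → ∀ {p : Poly n k}, IsL2Projection (hull T) k u p →
    ∀ x ∈ hull T, |u x - value p.1 x| ≤ C * diam T * hessError H p.1 T := by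
  obtain ⟨C, hC, h⟩ := IsW2.exists_abs_sub_le hn κ⁻¹
  refine ⟨C, hC, ?_⟩
  intro Ω hΩ u huc G H hu T hT hdiam x₀ hball k hk p hp
  refine h hΩ.isOpen hΩ.isBounded huc hu (convex_convexHull ℝ _) (IsSimplex.isCompact_hull T) ?_ hT
    (fun x hx y hy => IsSimplex.norm_sub_le_diam hx hy) (mul_pos hκ hdiam) ?_ hball p.1
    (hessError_nonneg H p.1 T) (hu.eLpNorm_hess_sub_le hn hΩ hT p.1) fun q hq =>
      hp ⟨q, (MvPolynomial.mem_restrictTotalDegree _ _ _).2 (hq.trans hk)⟩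
  · rw [← hΩ.interior_closure]
    exact interior_mono hT
  · rw [inv_mul_cancel_left₀ hκ.ne']

/-- The jumps of values and gradients across a side, for an approximation with small errors. -/
theorem IsW2.exists_jump_le (hn : 2 ≤ n) (k : ℕ) {κ C₁ : ℝ} (hκ : 0 < κ) (hC₁ : 0 < C₁) :
    ∃ C : ℝ, 0 < C ∧ ∀ {Ω : Set (Sp n)}, IsBoundedLipschitz Ω →
    ∀ {u : Sp n → ℝ}, ContinuousOn u (closure Ω) →
    ∀ {G : Sp n → Sp n} {H : Sp n → Matrix (Fin n) (Fin n) ℝ}, IsW2 Ω n u G H →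
    ∀ {T T' F : Finset (Sp n)}, IsSimplex T → IsSimplex T' → hull T ⊆ closure Ω →
    hull T' ⊆ closure Ω → F ⊆ T → F ⊆ T' → F.card = n → hull T ∩ hull T' = hull F →
    0 < diam T → 0 < diam T' →
    ∀ {x₀ x₀' : Sp n}, Metric.closedBall x₀ (κ * diam T) ⊆ hull T →
    Metric.closedBall x₀' (κ * diam T') ⊆ hull T' →
    ∀ {p p' : MvPolynomial (Fin n) ℝ}, p.totalDegree ≤ k → p'.totalDegree ≤ k →
    (∀ x ∈ hull T, |u x - value p x| ≤ C₁ * diam T * hessError H p T) →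
    (∀ x ∈ hull T', |u x - value p' x| ≤ C₁ * diam T' * hessError H p' T') →
    0 < diam F ∧ ∀ x ∈ hull F,
      |value p x - value p' x| ≤ C * diam F * (hessError H p T + hessError H p' T') ∧
      ‖grad p x - grad p' x‖ ≤ C * (hessError H p T + hessError H p' T') := by
  have hn1 : 1 ≤ n := by omega
  have hn0 : (0 : ℝ) < n := by exact_mod_cast hn1
  obtain ⟨C₂, hC₂, hjump⟩ := IsW2.exists_abs_inner_grad_sub_le hn1 k (6 * n / κ)
  set β := volume.real (Metric.closedBall (0 : Sp n) 1) with hβ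
  have hβ0 : 0 ≤ β := measureReal_nonneg
  set C₄ := 5 ^ (n - 1) * β ^ (1 - 1 / (n : ℝ)) with hC₄
  have hC₄0 : 0 ≤ C₄ := by positivity
  set C₅ := 3 * (C₂ * (C₁ * (6 * n) / κ ^ 2 + C₄)) with hC₅
  have hC₅0 : 0 ≤ C₅ := by positivity
  refine ⟨C₁ / κ + C₅, by positivity, ?_⟩
  intro Ω hΩ u huc G H hu T T' F hTs hTs' hT hT' hF hF' hFc hinter hd hd' x₀ x₀' hball hball' p p'
    hp hp' hup hup'
  set E := hessError H p T with hE
  set E' := hessError H p' T' with hE'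
  have hE0 : 0 ≤ E := hessError_nonneg _ _ _
  have hE0' : 0 ≤ E' := hessError_nonneg _ _ _
  -- A side has n ≥ 2 vertices, and two of them are at least κ h_T apart. Hence h_F, h_T and h_T'
  -- are comparable.
  obtain ⟨a, haF, b, hbF, hab⟩ := Finset.one_lt_card.1 (by omega : 1 < F.card)
  have hFle : κ * diam T ≤ diam F :=
    (hTs.le_norm_sub_of_ne (by positivity) hball (hF haF) (hF hbF) hab).trans
      (IsSimplex.norm_sub_le_diam (subset_convexHull ℝ _ haF) (subset_convexHull ℝ _ hbF))
  have hFle' : κ * diam T' ≤ diam F :=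
    (hTs'.le_norm_sub_of_ne (by positivity) hball' (hF' haF) (hF' hbF) hab).trans
      (IsSimplex.norm_sub_le_diam (subset_convexHull ℝ _ haF) (subset_convexHull ℝ _ hbF))
  have hF0 : 0 < diam F := lt_of_lt_of_le (by positivity) hFle
  have hFT : hull F ⊆ hull T := convexHull_mono (by exact_mod_cast hF)
  have hFT' : hull F ⊆ hull T' := convexHull_mono (by exact_mod_cast hF')
  have hdF : diam F ≤ diam T := Metric.diam_mono hFT (IsSimplex.isCompact_hull T).isBounded
  have hdF' : diam F ≤ diam T' := Metric.diam_mono hFT' (IsSimplex.isCompact_hull T').isBounded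
  have hdT : diam T ≤ diam F / κ := by rw [le_div_iff₀ hκ]; linarith
  have hdT' : diam T' ≤ diam F / κ := by rw [le_div_iff₀ hκ]; linarith
  set η := C₁ * (diam F / κ) * (E + E') with hη
  have hη0 : 0 ≤ η := by positivity
  have hupη : ∀ x ∈ hull T, |u x - value p x| ≤ C₁ * (diam F / κ) * E := fun x hx =>
    (hup x hx).trans (by gcongr)
  have hupη' : ∀ x ∈ hull T', |u x - value p' x| ≤ C₁ * (diam F / κ) * E' := fun x hx =>
    (hup' x hx).trans (by gcongr)
  have hle1 : C₁ * (diam F / κ) * E ≤ η := by rw [hη]; gcongr; linarith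
  have hle2 : C₁ * (diam F / κ) * E' ≤ η := by rw [hη]; gcongr; linarith
  set r := κ * diam F with hr
  have hr0 : 0 < r := by positivity
  obtain ⟨ν, hν, hFν, hpos, hneg⟩ := hTs.exists_normal_of_neighbour hn1 hTs' hinter hr0
    ((Metric.closedBall_subset_closedBall (by rw [hr]; gcongr)).trans hball)
    ((Metric.closedBall_subset_closedBall (by rw [hr]; gcongr)).trans hball') hF hF' hFc
  set c := barycenter F with hc
  have hcF : c ∈ hull F := barycenter_mem_hull ⟨a, haF⟩
  -- The divisor 6 leaves room: the closed ball of radius 5ρ lies in the open ball of radius r/n,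
  -- which is covered by the two cells and therefore contained in Ω.
  set ρ := r / (6 * n) with hρ
  have hρ0 : 0 < ρ := by positivity
  have hρr : 5 * ρ < r / n := by
    have : r / n = 6 * ρ := by rw [hρ]; field_simp
    rw [this]; linarith
  have hBr : Metric.closedBall c (5 * ρ) ⊆ Metric.closedBall c (r / n) :=
    Metric.closedBall_subset_closedBall hρr.le
  have hrΩ : Metric.ball c (r / n) ⊆ Ω := by
    rw [← hΩ.interior_closure]
    refine interior_maximal (fun x hx => ?_) Metric.isOpen_ball
    rcases le_total 0 (inner ℝ ν (x - c) : ℝ) with h | h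
    · exact hT (hpos x (Metric.ball_subset_closedBall hx) h)
    · exact hT' (hneg x (Metric.ball_subset_closedBall hx) h)
  have hBΩ : Metric.closedBall c (5 * ρ) ⊆ Ω := (Metric.closedBall_subset_ball hρr).trans hrΩ
  -- Hölder on a ball of radius 5ρ: the volume to the power 1 - 1/n scales like ρ^(n-1). Therefore
  -- ρD/ρⁿ is a constant multiple of E + E', with no power of the mesh-size left.
  set D := (E + E') * (C₄ * ρ ^ (n - 1)) with hD
  have hD0 : 0 ≤ D := by positivity
  have hexp : 0 ≤ 1 - 1 / (n : ℝ) := by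
    rw [sub_nonneg, div_le_one hn0]
    exact_mod_cast hn1
  have hvol : volume (Metric.closedBall c (5 * ρ)) ^ (1 - 1 / (n : ℝ)) =
      ENNReal.ofReal (C₄ * ρ ^ (n - 1)) := by
    rw [Measure.addHaar_closedBall' _ _ (by positivity), finrank_euclideanSpace, Fintype.card_fin,
      ← ofReal_measureReal (μ := volume) (s := Metric.closedBall (0 : Sp n) 1)
        measure_closedBall_lt_top.ne, ← hβ, ← ENNReal.ofReal_mul (by positivity),
      ENNReal.ofReal_rpow_of_nonneg (by positivity) hexp]
    congr 1
    rw [Real.mul_rpow (by positivity) hβ0, hC₄]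
    have e : ((5 * ρ) ^ n) ^ (1 - 1 / (n : ℝ)) = (5 * ρ) ^ (n - 1) := by
      rw [← Real.rpow_natCast, ← Real.rpow_natCast, ← Real.rpow_mul (by positivity)]
      congr 1
      rw [Nat.cast_sub hn1]
      field_simp
      push_cast
      ring
    rw [e, mul_pow]
    ring
  have hDle : ∀ (S : Finset (Sp n)) (q : MvPolynomial (Fin n) ℝ) (U : Set (Sp n)),
      hull S ⊆ closure Ω → U ⊆ hull S → U ⊆ Metric.closedBall c (5 * ρ) →
      hessError H q S ≤ E + E' →
      ∫⁻ x in U, ENNReal.ofReal (frobenius (H x - hess q x)) ≤ ENNReal.ofReal D := by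
    intro S q U hS hUS hUB hle
    have hmono : volume.restrict U ≤ volume.restrict (hull S) := Measure.restrict_mono hUS le_rfl
    have hm := (memLp_frobenius (hu.memLp_hess_sub hΩ hS q)).mono_measure hmono
    have h1 := setLIntegral_ofReal_le_of_eLpNorm_le (fun x => frobenius_nonneg (H x - hess q x))
      hm.1 hn1 ((eLpNorm_mono_measure _ hmono).trans (hu.eLpNorm_hess_sub_le hn1 hΩ hS q))
    refine h1.trans ?_
    rw [hD, ENNReal.ofReal_mul (by positivity), ← hvol]
    gcongr
  have hgrad : ∀ x ∈ hull F, ‖grad p x - grad p' x‖ ≤ C₅ * (E + E') := by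
    intro x hx
    have hxB : x ∈ Metric.closedBall c (6 * n / κ * ρ) := by
      rw [mem_closedBall_iff_norm]
      have : 6 * n / κ * ρ = diam F := by
        rw [hρ, hr]; field_simp
      rw [this]
      exact IsSimplex.norm_sub_le_diam hx hcF
    have h1 := norm_le_of_abs_inner_le hν (g := grad p x - grad p' x) fun v hv hνv =>
      hjump hΩ.isOpen hΩ.isBounded huc hu hp hp' hν hv hνv hρ0 hBΩ hη0 hD0
        (fun y hy hyν => (hupη y (hpos y (hBr hy) hyν)).trans hle1)
        (fun y hy hyν => (hupη' y (hneg y (hBr hy) hyν)).trans hle2)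
        (hDle T p _ hT (fun y hy => hpos y (hBr hy.1) hy.2) inter_subset_left (by linarith))
        (hDle T' p' _ hT' (fun y hy => hneg y (hBr hy.1) hy.2) inter_subset_left (by linarith))
        x hxB (hFν x hx)
    refine h1.trans (le_of_eq ?_)
    have e1 : η / ρ = C₁ * (6 * n) / κ ^ 2 * (E + E') := by
      rw [hη, hρ, hr]; field_simp
    have e2 : ρ * D / ρ ^ n = C₄ * (E + E') := by
      have : ρ ^ n = ρ * ρ ^ (n - 1) := by rw [← pow_succ', Nat.sub_add_cancel hn1]
      rw [hD, this]
      field_simp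
    rw [e1, e2, hC₅]
    ring
  refine ⟨hF0, fun x hx => ⟨?_, ?_⟩⟩
  · have h1 := hupη x (hFT hx)
    have h2 := hupη' x (hFT' hx)
    calc |value p x - value p' x| = |(u x - value p' x) - (u x - value p x)| := by ring_nf
      _ ≤ C₁ * (diam F / κ) * E' + C₁ * (diam F / κ) * E :=
        (abs_sub _ _).trans (add_le_add h2 h1)
      _ = C₁ / κ * diam F * (E + E') := by ring
      _ ≤ _ := by gcongr; linarith
  · refine (hgrad x hx).trans ?_
    gcongr
    have : 0 < C₁ / κ := by positivity
    linarith

/-! ### Triangulations -/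

namespace Triangulation

variable {Ω : Set (Sp n)} (M : Triangulation Ω) {T T' : Finset (Sp n)}

theorem isSimplex (hT : T ∈ M.cells) : IsSimplex T := ⟨M.card_eq T hT, M.indep T hT⟩

theorem hull_subset_closure (hT : T ∈ M.cells) : hull T ⊆ closure Ω := by
  rw [← M.cover]
  exact subset_biUnion_of_mem (u := fun S : Finset (Sp n) => hull S) hT

theorem hull_inter_hull (hT : T ∈ M.cells) (hT' : T' ∈ M.cells) :
    hull T ∩ hull T' = hull (side T T') := by
  rw [M.inter T hT T' hT', side, hull, Finset.coe_inter]

end Triangulation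

theorem diam_pos_of_one_lt_card {F : Finset (Sp n)} (hF : 1 < F.card) : 0 < diam F := by
  obtain ⟨a, ha, b, hb, hab⟩ := Finset.one_lt_card.1 hF
  exact (norm_pos_iff.2 (sub_ne_zero.2 hab)).trans_le
    (IsSimplex.norm_sub_le_diam (subset_convexHull ℝ _ ha) (subset_convexHull ℝ _ hb))

theorem diam_mono {F T : Finset (Sp n)} (h : F ⊆ T) : diam F ≤ diam T :=
  Metric.diam_mono (convexHull_mono (by exact_mod_cast h)) (IsSimplex.isCompact_hull T).isBounded

theorem side_comm (T T' : Finset (Sp n)) : side T T' = side T' T := by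
  classical
  exact Finset.inter_comm _ _

theorem side_subset_left (T T' : Finset (Sp n)) : side T T' ⊆ T := by
  classical
  exact Finset.inter_subset_left

theorem side_subset_right (T T' : Finset (Sp n)) : side T T' ⊆ T' := by
  classical
  exact Finset.inter_subset_right

namespace Triangulation

variable {Ω : Set (Sp n)} (M : Triangulation Ω) {T T' : Finset (Sp n)}

theorem mem_neighbours :
    T' ∈ M.neighbours T ↔ T' ∈ M.cells ∧ T' ≠ T ∧ (side T T').card = n := by
  classical
  exact Finset.mem_filter

theorem mem_neighbours_comm (hT : T ∈ M.cells) (h : T' ∈ M.neighbours T) :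
    T ∈ M.neighbours T' := by
  rw [mem_neighbours] at h ⊢
  exact ⟨hT, h.2.1.symm, by rw [side_comm, h.2.2]⟩

/-- A cell has at most one neighbour for every subset of its vertices. -/
theorem card_neighbours_le (hn : 2 ≤ n) {κ : ℝ} (hκ : 0 < κ)
    (hball : ∀ T ∈ M.cells, ∃ x, Metric.closedBall x (κ * diam T) ⊆ hull T) (hT : T ∈ M.cells) :
    (M.neighbours T).card ≤ 2 ^ (n + 1) := by
  rw [← M.card_eq T hT, ← Finset.card_powerset]
  -- Neighbours with the same side coincide, so they inject into the subsets of the n + 1 vertices.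
  refine Finset.card_le_card_of_injOn (fun T' => side T T')
    (fun T' _ => Finset.mem_coe.2 (Finset.mem_powerset.2 (side_subset_left T T'))) ?_
  intro T' h' T'' h'' he
  rw [Finset.mem_coe, mem_neighbours] at h' h''
  have he : side T T' = side T T'' := he
  have hF : 0 < diam (side T T') := diam_pos_of_one_lt_card (by omega)
  have hb : ∀ S ∈ M.cells, side T T' ⊆ S →
      ∃ x, Metric.closedBall x (κ * diam (side T T')) ⊆ hull S := by
    intro S hS hle
    obtain ⟨x, hx⟩ := hball S hS
    exact ⟨x, (Metric.closedBall_subset_closedBall (by gcongr; exact diam_mono hle)).trans hx⟩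
  have hs'' : side T T' ⊆ T'' := he ▸ side_subset_right T T''
  obtain ⟨x, hx⟩ := hb T hT (side_subset_left _ _)
  obtain ⟨x', hx'⟩ := hb T' h'.1 (side_subset_right _ _)
  obtain ⟨x'', hx''⟩ := hb T'' h''.1 hs''
  exact (M.isSimplex hT).eq_of_side_eq (by omega) (M.isSimplex h'.1) (M.isSimplex h''.1)
    (M.hull_inter_hull hT h'.1) (he ▸ M.hull_inter_hull hT h''.1) (M.inter T' h'.1 T'' h''.1)
    (mul_pos hκ hF) hx hx' hx'' (side_subset_left _ _) (side_subset_right _ _) hs'' h'.2.2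

end Triangulation

/-! ### The stabilization -/

theorem setIntegral_pow_le {m : ℕ} {s : Set (Sp n)} {μ : Measure (Sp n)} {w : Sp n → ℝ} {a c : ℝ}
    (hw : ∀ x ∈ s, 0 ≤ w x) (hwa : ∀ x ∈ s, w x ≤ a) (ha : 0 ≤ a) (hc : 0 ≤ c)
    (hμ : μ s ≤ ENNReal.ofReal c) :
    ∫ x in s, w x ^ m ∂μ ≤ a ^ m * c := by
  have h : ∀ x ∈ s, ‖w x ^ m‖ ≤ a ^ m := fun x hx => by
    rw [Real.norm_of_nonneg (pow_nonneg (hw x hx) m)]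
    exact pow_le_pow_left₀ (hw x hx) (hwa x hx) m
  refine (Real.le_norm_self _).trans
    ((norm_setIntegral_le_of_norm_le_const (hμ.trans_lt ENNReal.ofReal_lt_top) h).trans ?_)
  gcongr
  exact ENNReal.toReal_le_of_le_ofReal hc hμ

/-- Scaling: the measure of a side is at most C h_F^(n-1), and the exponents 1 - 2n + n + (n - 1)
and 1 - n + (n - 1) both vanish. -/
theorem exists_jump_terms_le (hn : 2 ≤ n) : ∃ C : ℝ, 0 < C ∧
    ∀ {Ω : Set (Sp n)} {M : Triangulation Ω} {k : ℕ} (v : Vnc M k) (T T' : M.cells),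
    (side T.1 T'.1).card = n → ∀ {a : ℝ}, 0 ≤ a →
    (∀ x ∈ hull (side T.1 T'.1),
      |value (v T).1 x - value (v T').1 x| ≤ diam (side T.1 T'.1) * a ∧
      ‖grad (v T).1 x - grad (v T').1 x‖ ≤ a) →
    diam (side T.1 T'.1) ^ (1 - 2 * (n : ℤ)) * jumpValue v T T' +
      diam (side T.1 T'.1) ^ (1 - (n : ℤ)) * jumpGrad v T T' ≤ C * a ^ n := by
  obtain ⟨C, hC, hμ⟩ := exists_euclideanHausdorffMeasure_hull_le (n - 1)
  refine ⟨2 * C, by positivity, ?_⟩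
  intro Ω M k v T T' hF a ha h
  have hind : AffineIndependent ℝ ((↑) : side T.1 T'.1 → Sp n) :=
    (M.indep T.1 T.2).mono (t := (T.1 : Set (Sp n))) (s := (side T.1 T'.1 : Set (Sp n)))
      (by exact_mod_cast side_subset_left _ _)
  have hμF := hμ n (side T.1 T'.1) hind (by omega)
  have hd : 0 < diam (side T.1 T'.1) := diam_pos_of_one_lt_card (by omega)
  set d := diam (side T.1 T'.1) with hdef
  have h1 : jumpValue v T T' ≤ (d * a) ^ n * (C * d ^ (n - 1)) :=
    setIntegral_pow_le (fun _ _ => abs_nonneg _) (fun x hx => (h x hx).1) (by positivity)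
      (by positivity) hμF
  have h2 : jumpGrad v T T' ≤ a ^ n * (C * d ^ (n - 1)) :=
    setIntegral_pow_le (fun _ _ => norm_nonneg _) (fun x hx => (h x hx).2) ha
      (by positivity) hμF
  have e2 : d ^ (1 - (n : ℤ)) * d ^ (n - 1) = 1 := by
    rw [← zpow_natCast, ← zpow_add₀ hd.ne', Nat.cast_sub (by omega)]
    simp
  have e1 : d ^ (1 - 2 * (n : ℤ)) * (d ^ n * d ^ (n - 1)) = 1 := by
    rw [← pow_add, ← zpow_natCast, ← zpow_add₀ hd.ne', Nat.cast_add, Nat.cast_sub (by omega)]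
    convert zpow_zero d using 2
    push_cast
    ring
  calc _ ≤ d ^ (1 - 2 * (n : ℤ)) * ((d * a) ^ n * (C * d ^ (n - 1))) +
        d ^ (1 - (n : ℤ)) * (a ^ n * (C * d ^ (n - 1))) := by gcongr
    _ = C * a ^ n * (d ^ (1 - 2 * (n : ℤ)) * (d ^ n * d ^ (n - 1))) +
        C * a ^ n * (d ^ (1 - (n : ℤ)) * d ^ (n - 1)) := by rw [mul_pow]; ring
    _ = 2 * C * a ^ n := by rw [e1, e2]; ring

/-- Each side contributes errors of its two cells. Since the neighbour relation is symmetric and of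
bounded degree, every cell error occurs boundedly often in the sum. -/
theorem exists_stabilization_le (hn : 2 ≤ n) : ∃ C : ℝ, 0 < C ∧
    ∀ {Ω : Set (Sp n)} {M : Triangulation Ω} {k : ℕ} (v : Vnc M k) {B : ℝ} {E : M.cells → ℝ},
    0 ≤ B → (∀ T, 0 ≤ E T) → (∀ T ∈ M.cells, (M.neighbours T).card ≤ 2 ^ (n + 1)) →
    (∀ T T' : M.cells, T'.1 ∈ M.neighbours T.1 → ∀ x ∈ hull (side T.1 T'.1),
      |value (v T).1 x - value (v T').1 x| ≤ diam (side T.1 T'.1) * (B * (E T + E T')) ∧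
      ‖grad (v T).1 x - grad (v T').1 x‖ ≤ B * (E T + E T')) →
    stabilization v ≤ C * B ^ n * ∑ T, E T ^ n := by
  classical
  obtain ⟨C, hC, h⟩ := exists_jump_terms_le hn
  refine ⟨C * 2 ^ (n - 1) * (2 * 2 ^ (n + 1)), by positivity, ?_⟩
  intro Ω M k v B E hB hE hcard hj
  have hterm : stabilization v ≤ ∑ T : M.cells, ∑ T' : M.cells with T'.1 ∈ M.neighbours T.1,
      C * 2 ^ (n - 1) * B ^ n * (E T ^ n + E T' ^ n) := by
    have hst : stabilization v = ∑ T : M.cells, ∑ T' : M.cells with T'.1 ∈ M.neighbours T.1,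
        (diam (side T.1 T'.1) ^ (1 - 2 * (n : ℤ)) * jumpValue v T T' +
          diam (side T.1 T'.1) ^ (1 - (n : ℤ)) * jumpGrad v T T') :=
      Finset.sum_congr rfl fun T _ => Finset.sum_congr (by ext; simp) fun _ _ => rfl
    rw [hst]
    refine Finset.sum_le_sum fun T _ => ?_
    refine Finset.sum_le_sum fun T' hT' => ?_
    have hT' : T'.1 ∈ M.neighbours T.1 := (Finset.mem_filter.1 hT').2
    refine (h v T T' (M.mem_neighbours.1 hT').2.2
      (mul_nonneg hB (add_nonneg (hE T) (hE T'))) (hj T T' hT')).trans ?_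
    rw [mul_pow]
    have := add_pow_le (hE T) (hE T') n
    calc C * (B ^ n * (E T + E T') ^ n)
        ≤ C * (B ^ n * (2 ^ (n - 1) * (E T ^ n + E T' ^ n))) := by gcongr
      _ = _ := by ring
  have hcard' : ∀ T : M.cells,
      ((Finset.univ.filter fun T' : M.cells => T'.1 ∈ M.neighbours T.1).card : ℝ) ≤
        2 ^ (n + 1) := by
    intro T
    have : (Finset.univ.filter fun T' : M.cells => T'.1 ∈ M.neighbours T.1).card ≤
        (M.neighbours T.1).card :=
      Finset.card_le_card_of_injOn (fun T' => T'.1)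
        (fun T' hT' => (Finset.mem_filter.1 hT').2) (fun _ _ _ _ h => Subtype.ext h)
    exact_mod_cast this.trans (hcard T.1 T.2)
  have hleft : ∑ T : M.cells, ∑ T' : M.cells with T'.1 ∈ M.neighbours T.1, E T ^ n ≤
      2 ^ (n + 1) * ∑ T, E T ^ n := by
    rw [Finset.mul_sum]
    refine Finset.sum_le_sum fun T _ => ?_
    rw [Finset.sum_const, nsmul_eq_mul]
    have := pow_nonneg (hE T) n
    gcongr
    exact hcard' T
  -- Exchanging the roles of the two cells, by symmetry of the neighbour relation.
  have hright : ∑ T : M.cells, ∑ T' : M.cells with T'.1 ∈ M.neighbours T.1, E T' ^ n =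
      ∑ T : M.cells, ∑ T' : M.cells with T'.1 ∈ M.neighbours T.1, E T ^ n := by
    refine Finset.sum_comm' fun T T' => ?_
    simp only [Finset.mem_univ, Finset.mem_filter, true_and, and_true]
    exact ⟨M.mem_neighbours_comm T.2, M.mem_neighbours_comm T'.2⟩
  refine hterm.trans ?_
  simp_rw [← Finset.mul_sum, Finset.sum_add_distrib]
  rw [hright]
  calc _ ≤ C * 2 ^ (n - 1) * B ^ n * (2 ^ (n + 1) * ∑ T, E T ^ n + 2 ^ (n + 1) * ∑ T, E T ^ n) := by
        gcongr
    _ = _ := by ring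

/-! ### The residual -/

theorem abs_sum_mul_le_frobenius (A H : Matrix (Fin n) (Fin n) ℝ) :
    |∑ i, ∑ j, A i j * H i j| ≤ frobenius A * frobenius H := by
  rw [frobenius, frobenius, ← Real.sqrt_mul (by positivity)]
  apply Real.abs_le_sqrt
  simp_rw [← Fintype.sum_prod_type']
  exact Finset.sum_mul_sq_le_sq_mul_sq _ _ _

theorem ae_norm_le_of_memLp_top {α E : Type*} [MeasurableSpace α] [NormedAddCommGroup E]
    {μ : Measure α} {f : α → E} (hf : MemLp f ⊤ μ) :
    ∀ᵐ x ∂μ, ‖f x‖ ≤ (eLpNorm f ⊤ μ).toReal := by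
  have h := ae_le_eLpNormEssSup (f := f) (μ := μ)
  rw [← eLpNorm_exponent_top] at h
  filter_upwards [h] with x hx
  rw [← toReal_enorm]
  exact ENNReal.toReal_mono hf.2.ne hx

theorem add_add_pow_le {a b c : ℝ} (ha : 0 ≤ a) (hb : 0 ≤ b) (hc : 0 ≤ c) (m : ℕ) :
    (a + b + c) ^ m ≤ 3 ^ m * (a ^ m + b ^ m + c ^ m) := by
  have key : ∀ x : ℝ, 0 ≤ x → a ≤ x → b ≤ x → c ≤ x → x ^ m ≤ a ^ m + b ^ m + c ^ m →
      (a + b + c) ^ m ≤ 3 ^ m * (a ^ m + b ^ m + c ^ m) := by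
    intro x hx h1 h2 h3 h4
    calc (a + b + c) ^ m ≤ (3 * x) ^ m := by gcongr; linarith
      _ = 3 ^ m * x ^ m := mul_pow _ _ _
      _ ≤ _ := by gcongr
  have ha' := pow_nonneg ha m
  have hb' := pow_nonneg hb m
  have hc' := pow_nonneg hc m
  rcases le_total a b with h1 | h1 <;> rcases le_total b c with h2 | h2 <;>
    rcases le_total a c with h3 | h3 <;>
    first
    | exact key a ha le_rfl (by linarith) (by linarith) (by linarith)
    | exact key b hb (by linarith) le_rfl (by linarith) (by linarith)
    | exact key c hc (by linarith) (by linarith) le_rfl (by linarith)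

/-- By the equation, f - Lp = L(u - p) almost everywhere. A is bounded as a continuous function on a
compact set, b and c by their essential suprema. -/
theorem exists_residual_le (hn : 1 ≤ n) {Ω : Set (Sp n)} (hΩ : IsBoundedLipschitz Ω)
    {lam Lam : ℝ} {A : Sp n → Matrix (Fin n) (Fin n) ℝ} {b : Sp n → Sp n} {c : Sp n → ℝ}
    (hcoef : CoefficientAssumption Ω lam Lam A b c) :
    ∃ C : ℝ, 0 < C ∧ ∀ {f g u : Sp n → ℝ} {G : Sp n → Sp n}
      {H : Sp n → Matrix (Fin n) (Fin n) ℝ}, IsStrongSolutionW2 Ω A b c f g u G H →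
    ∀ {T : Finset (Sp n)}, hull T ⊆ closure Ω → ∀ p : MvPolynomial (Fin n) ℝ,
      ∫ x in hull T, |f x - diffOp A b c x (value p x) (grad p x) (hess p x)| ^ n ≤
        C * ((∫ x in hull T, |u x - value p x| ^ n) + (∫ x in hull T, ‖G x - grad p x‖ ^ n) +
          ∫ x in hull T, frobenius (H x - hess p x) ^ n) := by
  obtain ⟨K, hK⟩ := hΩ.isBounded.isCompact_closure.exists_bound_of_continuousOn
    (continuous_frobenius.comp_continuousOn hcoef.continuousOn)
  have hb := ae_norm_le_of_memLp_top hcoef.memLp_b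
  have hc := ae_norm_le_of_memLp_top hcoef.memLp_c
  set Kb := (eLpNorm b ⊤ (volume.restrict Ω)).toReal
  set Kc := (eLpNorm c ⊤ (volume.restrict Ω)).toReal
  have hKb : 0 ≤ Kb := ENNReal.toReal_nonneg
  have hKc : 0 ≤ Kc := ENNReal.toReal_nonneg
  set B := |K| + Kb + Kc + 1
  have hB : 0 < B := by positivity
  refine ⟨B ^ n * 3 ^ n, by positivity, ?_⟩
  intro f g u G H hu T hT p
  have hle := restrict_hull_le hΩ hT
  have hac := Measure.absolutelyContinuous_of_le hle
  have hn0 : n ≠ 0 := by omega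
  have hval := ((hu.w2.memLp.mono_measure hle).sub
    (memLp_of_continuous (continuous_value p) T n)).integrable_norm_pow hn0
  have hgrad : MemLp (fun x => G x - grad p x) n (volume.restrict (hull T)) :=
    MemLp.of_eval_piLp fun i => ((hu.w2.memLp_grad i).mono_measure hle).sub
      (memLp_of_continuous (continuous_value (MvPolynomial.pderiv i p)) T n)
  have hgrad := hgrad.integrable_norm_pow hn0
  have hhess := (memLp_frobenius (hu.w2.memLp_hess_sub hΩ hT p)).integrable_norm_pow hn0
  simp only [Pi.sub_apply, Real.norm_eq_abs, abs_of_nonneg (frobenius_nonneg _)] at hval hhess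
  have hvg : Integrable (fun x => |u x - value p x| ^ n + ‖G x - grad p x‖ ^ n)
    (volume.restrict (hull T)) := hval.add hgrad
  rw [← integral_add hval hgrad, ← integral_add hvg hhess, ← integral_const_mul]
  refine integral_mono_of_nonneg (ae_of_all _ fun x => by positivity)
    ((hvg.add hhess).const_mul _) ?_
  filter_upwards [hac.ae_le hu.pde, hac.ae_le hb, hac.ae_le hc,
    ae_restrict_mem (IsSimplex.isCompact_hull T).isClosed.measurableSet] with x hpde hbx hcx hxT
  have hKx : frobenius (A x) ≤ |K| := ((le_abs_self _).trans (hK x (hT hxT))).trans (le_abs_self K)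
  have hsplit : f x - diffOp A b c x (value p x) (grad p x) (hess p x) =
      -(∑ i, ∑ j, A x i j * (H x - hess p x) i j) + inner ℝ (b x) (G x - grad p x) +
        c x * (u x - value p x) := by
    rw [← hpde]
    simp only [diffOp, Matrix.sub_apply, mul_sub, Finset.sum_sub_distrib, inner_sub_right]
    ring
  have h1 : |∑ i, ∑ j, A x i j * (H x - hess p x) i j| ≤ B * frobenius (H x - hess p x) := by
    refine (abs_sum_mul_le_frobenius _ _).trans ?_
    have := frobenius_nonneg (H x - hess p x)
    gcongr
    linarith
  have h2 : |inner ℝ (b x) (G x - grad p x)| ≤ B * ‖G x - grad p x‖ := by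
    refine (abs_real_inner_le_norm _ _).trans ?_
    gcongr
    linarith [abs_nonneg K]
  have h3 : |c x * (u x - value p x)| ≤ B * |u x - value p x| := by
    rw [abs_mul]
    gcongr
    rw [Real.norm_eq_abs] at hcx
    linarith [abs_nonneg K]
  have h4 : |f x - diffOp A b c x (value p x) (grad p x) (hess p x)| ≤
      B * (|u x - value p x| + ‖G x - grad p x‖ + frobenius (H x - hess p x)) := by
    rw [hsplit]
    refine (abs_add_three _ _ _).trans ?_
    rw [abs_neg]
    linarith
  calc _ ≤ (B * (|u x - value p x| + ‖G x - grad p x‖ + frobenius (H x - hess p x))) ^ n :=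
        pow_le_pow_left₀ (abs_nonneg _) h4 n
    _ ≤ B ^ n * (3 ^ n * (|u x - value p x| ^ n + ‖G x - grad p x‖ ^ n +
          frobenius (H x - hess p x) ^ n)) := by
        rw [mul_pow]
        gcongr
        exact add_add_pow_le (abs_nonneg _) (norm_nonneg _) (frobenius_nonneg _) n
    _ = _ := by rw [mul_assoc]

/-! ### The functional at the projection -/

theorem Psi_nonneg {Ω : Set (Sp n)} {M : Triangulation Ω} {k : ℕ}
    (A : Sp n → Matrix (Fin n) (Fin n) ℝ) (b : Sp n → Sp n) (c f : Sp n → ℝ) {α σ : ℝ}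
    (hα : 0 ≤ α) (hσ : 0 ≤ σ) {vt : Vnc M k × ℝ} (ht : 0 ≤ vt.2) : 0 ≤ Psi A b c f α σ vt := by
  have hd : ∀ F : Finset (Sp n), 0 ≤ diam F := fun F => Metric.diam_nonneg
  have hs : 0 ≤ stabilization vt.1 :=
    Finset.sum_nonneg fun T _ => Finset.sum_nonneg fun T' _ => add_nonneg
      (mul_nonneg (zpow_nonneg (hd _) _) (integral_nonneg fun _ => by positivity))
      (mul_nonneg (zpow_nonneg (hd _) _) (integral_nonneg fun _ => by positivity))
  have hr : 0 ≤ ∑ T : M.cells, ∫ x in hull T.1,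
      |f x - diffOp A b c x (value (vt.1 T).1 x) (grad (vt.1 T).1 x) (hess (vt.1 T).1 x)| ^ n :=
    Finset.sum_nonneg fun T _ => integral_nonneg fun _ => by positivity
  unfold Psi
  positivity

theorem projectionError_pow (hn : 1 ≤ n) {Ω : Set (Sp n)} (M : Triangulation Ω) (k : ℕ)
    (u : Sp n → ℝ) (G : Sp n → Sp n) (H : Sp n → Matrix (Fin n) (Fin n) ℝ) :
    projectionError M k u G H ^ n = ∑ T : M.cells,
      ((∫ x in hull T.1, |u x - value (pwProjection M k u T).1 x| ^ n) +
        (∫ x in hull T.1, ‖G x - grad (pwProjection M k u T).1 x‖ ^ n) +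
        ∫ x in hull T.1, frobenius (H x - hess (pwProjection M k u T).1 x) ^ n) := by
  rw [projectionError, brokenW2Norm, one_div, Real.rpow_inv_natCast_pow _ (by omega)]
  exact Finset.sum_nonneg fun T _ => add_nonneg (add_nonneg (integral_nonneg fun _ => by positivity)
    (integral_nonneg fun _ => by positivity))
    (integral_nonneg fun _ => pow_nonneg (frobenius_nonneg _) _)

theorem sum_hessError_pow_le (hn : 1 ≤ n) {Ω : Set (Sp n)} (M : Triangulation Ω) (k : ℕ)
    (u : Sp n → ℝ) (G : Sp n → Sp n) (H : Sp n → Matrix (Fin n) (Fin n) ℝ) :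
    ∑ T : M.cells, hessError H (pwProjection M k u T).1 T.1 ^ n ≤ projectionError M k u G H ^ n := by
  rw [projectionError_pow hn]
  refine Finset.sum_le_sum fun T _ => ?_
  rw [hessError_pow hn]
  exact le_add_of_nonneg_left (add_nonneg (integral_nonneg fun _ => by positivity)
    (integral_nonneg fun _ => by positivity))

theorem projectionError_nonneg {Ω : Set (Sp n)} (M : Triangulation Ω) (k : ℕ)
    (u : Sp n → ℝ) (G : Sp n → Sp n) (H : Sp n → Matrix (Fin n) (Fin n) ℝ) :
    0 ≤ projectionError M k u G H :=
  Real.rpow_nonneg (Finset.sum_nonneg fun T _ => add_nonneg (add_nonneg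
    (integral_nonneg fun _ => by positivity) (integral_nonneg fun _ => by positivity))
    (integral_nonneg fun _ => pow_nonneg (frobenius_nonneg _) _)) _

/-- One cell contribution is at most the whole sum. This fits the constraint, where a single t has
to bound the error in all cells. -/
theorem hessError_le_projectionError (hn : 1 ≤ n) {Ω : Set (Sp n)} (M : Triangulation Ω) (k : ℕ)
    (u : Sp n → ℝ) (G : Sp n → Sp n) (H : Sp n → Matrix (Fin n) (Fin n) ℝ) (T : M.cells) :
    hessError H (pwProjection M k u T).1 T.1 ≤ projectionError M k u G H := by
  refine le_of_pow_le_pow_left₀ (n := n) (by omega) (projectionError_nonneg M k u G H)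
    (le_trans ?_ (sum_hessError_pow_le hn M k u G H))
  exact Finset.single_le_sum
    (f := fun T : M.cells => hessError H (pwProjection M k u T).1 T.1 ^ n)
    (fun T _ => pow_nonneg (hessError_nonneg _ _ _) n) (Finset.mem_univ T)

/-- The piecewise projection, together with a multiple of its error, is admissible, and its
functional is bounded by the error. -/
theorem exists_admissible_Psi_le (hn : 2 ≤ n) {k : ℕ} (hk : 1 ≤ k) {Ω : Set (Sp n)}
    (hΩ : IsBoundedLipschitz Ω) {lam Lam : ℝ} {A : Sp n → Matrix (Fin n) (Fin n) ℝ}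
    {b : Sp n → Sp n} {c : Sp n → ℝ} (hcoef : CoefficientAssumption Ω lam Lam A b c)
    {α σ κ : ℝ} (hα : 0 < α) (hσ : 0 < σ) (hκ : 0 < κ) :
    ∃ C : ℝ, 0 < C ∧ ∀ M : Triangulation Ω,
      (∀ T ∈ M.cells, ∃ x, Metric.closedBall x (κ * diam T) ⊆ hull T) →
      ∀ {f g u : Sp n → ℝ} {G : Sp n → Sp n} {H : Sp n → Matrix (Fin n) (Fin n) ℝ},
        IsStrongSolutionW2 Ω A b c f g u G H →
      ∀ {gh : Vnc M k}, AgreesOnBoundary gh g →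
        ∃ vt ∈ admissible gh, Psi A b c f α σ vt ≤ C * projectionError M k u G H ^ n := by
  have hn1 : 1 ≤ n := by omega
  obtain ⟨C₁, hC₁, hproj⟩ := IsW2.exists_abs_sub_l2Projection_le hn1 hκ
  obtain ⟨C₂, hC₂, hjump⟩ := IsW2.exists_jump_le hn k hκ hC₁
  obtain ⟨C₃, hC₃, hstab⟩ := exists_stabilization_le hn
  obtain ⟨C₄, hC₄, hres⟩ := exists_residual_le hn1 hΩ hcoef
  set D := Metric.diam (closure Ω) with hD
  have hD0 : 0 ≤ D := Metric.diam_nonneg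
  refine ⟨α * (C₁ * D) ^ n + C₄ + σ * (C₃ * C₂ ^ n), by positivity, ?_⟩
  intro M hball f g u G H hu gh hgh
  set P := pwProjection M k u with hP
  set err := projectionError M k u G H with herr
  have herr0 : 0 ≤ err := projectionError_nonneg M k u G H
  have hdiam : ∀ T : M.cells, 0 < diam T.1 := fun T =>
    diam_pos_of_one_lt_card (by rw [M.card_eq T.1 T.2]; omega)
  have hsup : ∀ T : M.cells, ∀ x ∈ hull T.1,
      |u x - value (P T).1 x| ≤ C₁ * diam T.1 * hessError H (P T).1 T.1 := by
    intro T
    obtain ⟨x₀, hx₀⟩ := hball T.1 T.2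
    have hT := M.hull_subset_closure T.2
    exact hproj hΩ hu.continuousOn hu.w2 hT (hdiam T) hx₀ hk
      (isL2Projection_l2Projection (IsSimplex.isCompact_hull _) (mul_pos hκ (hdiam T)) hx₀ k
        (hu.continuousOn.mono hT))
  have hdeg : ∀ T : M.cells, (P T).1.totalDegree ≤ k := fun T =>
    (MvPolynomial.mem_restrictTotalDegree _ _ _).1 (P T).2
  have hstabP : stabilization P ≤ C₃ * C₂ ^ n * err ^ n := by
    refine (hstab P hC₂.le (fun T => hessError_nonneg H (P T).1 T.1)
      (fun T hT => M.card_neighbours_le hn hκ hball hT) ?_).trans ?_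
    · intro T T' hTT' x hx
      obtain ⟨x₀, hx₀⟩ := hball T.1 T.2
      obtain ⟨x₀', hx₀'⟩ := hball T'.1 T'.2
      have h := (hjump hΩ hu.continuousOn hu.w2 (M.isSimplex T.2) (M.isSimplex T'.2)
        (M.hull_subset_closure T.2) (M.hull_subset_closure T'.2) (side_subset_left _ _)
        (side_subset_right _ _) (M.mem_neighbours.1 hTT').2.2 (M.hull_inter_hull T.2 T'.2)
        (hdiam T) (hdiam T') hx₀ hx₀' (hdeg T) (hdeg T') (hsup T) (hsup T')).2 x hx
      exact ⟨h.1.trans_eq (by ring), h.2⟩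
    · gcongr
      exact sum_hessError_pow_le hn1 M k u G H
  -- This t is the maximum-norm bound with every cell diameter replaced by D, the diameter of the
  -- closure of Ω; its n-th power is a constant multiple of the n-th power of the error.
  refine ⟨(P, C₁ * D * err), ⟨by positivity, ?_⟩, ?_⟩
  · rintro T z ⟨⟨-, hz⟩, hzT⟩
    have hle : |u z - value (P T).1 z| ≤ C₁ * D * err := by
      refine (hsup T z hzT).trans ?_
      have h1 : diam T.1 ≤ D :=
        Metric.diam_mono (M.hull_subset_closure T.2) hΩ.isBounded.isCompact_closure.isBounded
      have h2 := hessError_le_projectionError hn1 M k u G H T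
      gcongr
      exact hessError_nonneg _ _ _
    rw [hgh T z ⟨hzT, hz⟩, ← hu.boundary z hz]
    exact abs_le.1 hle
  · have hresP : ∑ T : M.cells, ∫ x in hull T.1, |f x - diffOp A b c x (value (P T).1 x)
        (grad (P T).1 x) (hess (P T).1 x)| ^ n ≤ C₄ * err ^ n := by
      rw [herr, projectionError_pow hn1, Finset.mul_sum]
      exact Finset.sum_le_sum fun T _ => hres hu (M.hull_subset_closure T.2) (P T).1
    calc Psi A b c f α σ (P, C₁ * D * err)
        ≤ α * (C₁ * D * err) ^ n + C₄ * err ^ n + σ * (C₃ * C₂ ^ n * err ^ n) := by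
          unfold Psi
          gcongr
      _ = _ := by rw [mul_pow]; ring

end NonconformingFEM

end

/-! ### The main theorem -/

open NonconformingFEM
theorem corollary3p7 (n : ℕ) (hn : n = 2 ∨ n = 3) (k : ℕ) (hk : 2 ≤ k)
    (Ω : Set (Sp n)) (hΩ : IsBoundedLipschitz Ω)
    (lam Lam : ℝ) (A : Sp n → Matrix (Fin n) (Fin n) ℝ) (b : Sp n → Sp n) (c : Sp n → ℝ)
    (hcoef : CoefficientAssumption Ω lam Lam A b c)
    (α σ κ : ℝ) (hα : 0 < α) (hσ : 0 < σ) (hκ : 0 < κ) :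
    ∃ C : ℝ, 0 < C ∧
      ∀ M : ℕ → Triangulation Ω, QuasiUniform κ M →
        Tendsto (fun j => (M j).meshSize) atTop (𝓝 0) →
      ∀ f : Sp n → ℝ, MemLp f n (volume.restrict Ω) →
      ∀ g : Sp n → ℝ, ContinuousOn g (frontier Ω) →
      ∀ (u : Sp n → ℝ) (G : Sp n → Sp n) (H : Sp n → Matrix (Fin n) (Fin n) ℝ),
        IsStrongSolutionW2 Ω A b c f g u G H →
      ∀ gh : (j : ℕ) → Vnc (M j) k, (∀ j, AgreesOnBoundary (gh j) g) →
      ∀ j : ℕ,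
        sInf (Psi A b c f α σ '' admissible (gh j)) ≤ C * projectionError (M j) k u G H ^ n ∧
        ∀ (uh : Vnc (M j) k) (t : ℝ), (uh, t) ∈ admissible (gh j) →
          IsMinOn (Psi A b c f α σ) (admissible (gh j)) (uh, t) →
          Psi A b c f α σ (uh, t) ≤ C * projectionError (M j) k u G H ^ n := by
  obtain ⟨C, hC, h⟩ := exists_admissible_Psi_le (by omega : 2 ≤ n) (by omega : 1 ≤ k) hΩ hcoef
    hα hσ hκ
  refine ⟨C, hC, ?_⟩
  intro M hM _ f _ g _ u G H hu gh hgh j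
  obtain ⟨vt, hvt, hle⟩ := h (M j) (fun T hT => (hM j T hT).1) hu (hgh j)
  -- The real infimum is bounded by a member only if the set is bounded below; nonnegativity of Ψ on
  -- admissible pairs provides the lower bound 0.
  refine ⟨(csInf_le ⟨0, ?_⟩ (mem_image_of_mem _ hvt)).trans hle,
    fun uh t _ hmin => (isMinOn_iff.1 hmin vt hvt).trans hle⟩
  rintro _ ⟨w, hw, rfl⟩
  exact Psi_nonneg A b c f hα.le hσ.le hw.1
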